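/- Let $D\subset\mathbb R^d$ be a domain (a nonempty connected open set), and let $m(dx)=m(x)\,dx$ be the measure on $D$ whose density $m$ is a bounded continuous function on $\overline D$ with $m(x)>0$ for every $x\in\overline D$ and $\int_D m(x)\,dx<\infty$. Let $$\mathrm{BL}(D)=\Big\{u\in L^2_{loc}(D):\ \frac{\partial u}{\partial x_i}\in L^2(D),\ 1\le i\le d\Big\}$$ (derivatives in the sense of distributions), and $\mathbf D(u,v)=\sum_{i=1}^d\int_D\frac{\partial u}{\partial x_i}\frac{\partial v}{\partial x_i}\,dx$ for $u,v\in\mathrm{BL}(D)$. Put $\mathcal E^*=\tfrac12\mathbf D$ and $\mathcal F^*=\mathrm{BL}(D)\cap L^2(D;m)$. Then: (i) $(\mathcal E^*,\mathcal F^*)$ is a Dirichlet form on $L^2(D;m)$, i.e. a densely defined, nonnegative definite, symmetric bilinear form that is closed ($\mathcal F^*$ is complete for $\mathcal E^*(u,u)+\|u\|_{L^2(D;m)}^2$) and Markovian ($v=(u\vee0)\wedge1\in\mathcal F^*$ and $\mathcal E^*(v,v)\le\mathcal E^*(u,u)$ for $u\in\mathcal F^*$). (ii) It is recurrent: let $(T_t)_{t>0}$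 be the strongly continuous semigroup of symmetric contractions on $L^2(D;m)$ generated by $(\mathcal E^*,\mathcal F^*)$, let $S_t$ be the bounded operator on $L^1(D;m)$ extending $f\mapsto\int_0^tT_sf\,ds$ from $L^1\cap L^2$, and let $Gf=\lim_{N\to\infty}S_Nf\in[0,\infty]$ for $0\le f\in L^1(D;m)$; then $m(\{0<Gf<\infty\})=0$ for every such $f$. (iii) Its extended Dirichlet space is $(\tfrac12\mathbf D,\mathrm{BL}(D))$: a function $u:D\to\mathbb R$ is the $m$-a.e. limit of some sequence $(u_n)\subset\mathcal F^*$ with $\mathcal E^*(u_n-u_k,u_n-u_k)\to0$ as $n,k\to\infty$ (an approximating sequence of $u$) if and only if $u\in\mathrm{BL}(D)$; and for $u,v\in\mathrm{BL}(D)$ and any approximating sequences $(u_n)$ of $u$ and $(v_n)$ of $v$, $\mathcal E^*(u_n,v_n)\to\tfrac12\mathbf D(u,v)$. -/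

import Mathlib

open MeasureTheory Filter Topology
open scoped ENNReal ContDiff

noncomputable section

namespace BeppoLevi

/-! ### Symmetric forms on `L²(X; μ)`

A symmetric form is a pair `(F, E)`: the domain `F` is a set of elements of `L²(X; μ)`, and only the
values of `E` on `F × F` matter. -/

section Forms

variable {X : Type*} [MeasurableSpace X]

/-- `(E, F)` is a Dirichlet form on `L²(X; μ)`: `F` is a dense linear subspace, `E` is a nonnegative
definite symmetric bilinear form on `F`, `F` is complete for `E₁ = E + (·,·)`, and the unit
contraction operates on `(E, F)`. -/
structure IsDirichletForm (μ : Measure X) (F : Set (Lp ℝ 2 μ))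
    (E : Lp ℝ 2 μ → Lp ℝ 2 μ → ℝ) : Prop where
  zero_mem : (0 : Lp ℝ 2 μ) ∈ F
  add_mem : ∀ u ∈ F, ∀ v ∈ F, u + v ∈ F
  smul_mem : ∀ (c : ℝ), ∀ u ∈ F, c • u ∈ F
  dense : Dense F
  symm : ∀ u ∈ F, ∀ v ∈ F, E u v = E v u
  add_left : ∀ u ∈ F, ∀ v ∈ F, ∀ w ∈ F, E (u + v) w = E u w + E v w
  smul_left : ∀ (c : ℝ), ∀ u ∈ F, ∀ v ∈ F, E (c • u) v = c * E u v
  nonneg : ∀ u ∈ F, 0 ≤ E u u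
  closed : ∀ u : ℕ → Lp ℝ 2 μ, (∀ n, u n ∈ F) →
    Tendsto (fun p : ℕ × ℕ => E (u p.1 - u p.2) (u p.1 - u p.2) + ‖u p.1 - u p.2‖ ^ 2)
      atTop (𝓝 0) →
    ∃ v ∈ F, Tendsto (fun n => E (u n - v) (u n - v) + ‖u n - v‖ ^ 2) atTop (𝓝 0)
  markov : ∀ u ∈ F, ∀ v : Lp ℝ 2 μ, (v =ᵐ[μ] fun x => min (max (u x) 0) 1) →
    v ∈ F ∧ E v v ≤ E u u

/-- `(T t)_{t > 0}` is the `L²`-semigroup generated by `(E, F)`: a strongly continuous semigroup of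
symmetric contractions whose infinitesimal generator is the operator `A` determined by
`E(u, v) = -(A u, v)` for all `v ∈ F`. -/
structure IsSemigroupOf (μ : Measure X) (F : Set (Lp ℝ 2 μ)) (E : Lp ℝ 2 μ → Lp ℝ 2 μ → ℝ)
    (T : ℝ → Lp ℝ 2 μ →L[ℝ] Lp ℝ 2 μ) : Prop where
  add : ∀ s t : ℝ, 0 < s → 0 < t → T (s + t) = (T s).comp (T t)
  contraction : ∀ t : ℝ, 0 < t → ‖T t‖ ≤ 1
  symm : ∀ t : ℝ, 0 < t → ∀ f g : Lp ℝ 2 μ, inner ℝ (T t f) g = inner ℝ f (T t g)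
  continuous : ∀ f : Lp ℝ 2 μ, Tendsto (fun t => T t f) (𝓝[>] 0) (𝓝 f)
  generator : ∀ u w : Lp ℝ 2 μ,
    Tendsto (fun t : ℝ => t⁻¹ • (T t u - u)) (𝓝[>] 0) (𝓝 w) ↔
      u ∈ F ∧ ∀ v ∈ F, E u v = -inner ℝ w v

/-- For every `t ≥ 0`, `S t` is the bounded operator on `L¹(X; μ)` that extends
`f ↦ ∫₀ᵗ T_s f ds` (Bochner integral in `L²`) from `L¹ ∩ L²`. -/
def IsL1Extension (μ : Measure X) (T : ℝ → Lp ℝ 2 μ →L[ℝ] Lp ℝ 2 μ)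
    (S : ℝ → Lp ℝ 1 μ →L[ℝ] Lp ℝ 1 μ) : Prop :=
  ∀ t : ℝ, 0 ≤ t → ∀ (f : Lp ℝ 1 μ) (g : Lp ℝ 2 μ), f =ᵐ[μ] g →
    S t f =ᵐ[μ] (∫ s in (0 : ℝ)..t, T s g : Lp ℝ 2 μ)

/-- `G f = lim_{N → ∞} S_N f ∈ [0, ∞]`, for nonnegative `f ∈ L¹(X; μ)`. -/
def green {μ : Measure X} (S : ℝ → Lp ℝ 1 μ →L[ℝ] Lp ℝ 1 μ) (f : Lp ℝ 1 μ) (x : X) : ℝ≥0∞ :=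
  limsup (fun N : ℕ => ENNReal.ofReal (S (N : ℝ) f x)) atTop

/-- Recurrence of `(E, F)`: with `T` the semigroup generated by the form, `S_t = ∫₀ᵗ T_s ds`
extended to `L¹` and `G f = lim S_N f`, one has `μ (0 < G f < ∞) = 0` for all `f ∈ L¹₊`.
(For a Dirichlet form, `T` and `S` exist and are unique on `t > 0`, resp. `t ≥ 0`.) -/
def IsRecurrent (μ : Measure X) (F : Set (Lp ℝ 2 μ)) (E : Lp ℝ 2 μ → Lp ℝ 2 μ → ℝ) : Prop :=
  ∃ (T : ℝ → Lp ℝ 2 μ →L[ℝ] Lp ℝ 2 μ) (S : ℝ → Lp ℝ 1 μ →L[ℝ] Lp ℝ 1 μ),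
    IsSemigroupOf μ F E T ∧ IsL1Extension μ T S ∧
      ∀ f : Lp ℝ 1 μ, 0 ≤ f → μ {x | 0 < green S f x ∧ green S f x < ⊤} = 0

/-- `a` is an approximating sequence of the function `u`: it lies in `F`, is `E`-Cauchy, and
converges to `u` `μ`-almost everywhere. -/
structure IsApproxSeq (μ : Measure X) (F : Set (Lp ℝ 2 μ)) (E : Lp ℝ 2 μ → Lp ℝ 2 μ → ℝ)
    (u : X → ℝ) (a : ℕ → Lp ℝ 2 μ) : Prop where
  mem : ∀ n, a n ∈ F
  cauchy : Tendsto (fun p : ℕ × ℕ => E (a p.1 - a p.2) (a p.1 - a p.2)) atTop (𝓝 0)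
  ae_tendsto : ∀ᵐ x ∂μ, Tendsto (fun n => a n x) atTop (𝓝 (u x))

/-- The extended Dirichlet space `F_e`, as a set of (representatives of) functions. -/
def extendedSpace (μ : Measure X) (F : Set (Lp ℝ 2 μ)) (E : Lp ℝ 2 μ → Lp ℝ 2 μ → ℝ) :
    Set (X → ℝ) :=
  {u | ∃ a, IsApproxSeq μ F E u a}

/-- The extended Dirichlet space of `(E, F)`, with the form extended to it by
`E(u, v) = lim E(aₙ, bₙ)` along approximating sequences, is the space `(Q, H)`. -/
def IsExtendedDirichletSpace (μ : Measure X) (F : Set (Lp ℝ 2 μ))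
    (E : Lp ℝ 2 μ → Lp ℝ 2 μ → ℝ) (H : Set (X → ℝ)) (Q : (X → ℝ) → (X → ℝ) → ℝ) : Prop :=
  extendedSpace μ F E = H ∧
    ∀ u ∈ H, ∀ v ∈ H, ∀ a b, IsApproxSeq μ F E u a → IsApproxSeq μ F E v b →
      Tendsto (fun n => E (a n) (b n)) atTop (𝓝 (Q u v))

end Forms

/-! ### Beppo Levi functions -/

variable {d : ℕ}

/-- `g` is the `i`-th partial derivative of `u` on `D` in the sense of distributions. -/
def HasWeakPartial (D : Set (EuclideanSpace ℝ (Fin d))) (i : Fin d)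
    (u g : EuclideanSpace ℝ (Fin d) → ℝ) : Prop :=
  ∀ φ : EuclideanSpace ℝ (Fin d) → ℝ, ContDiff ℝ ∞ φ → HasCompactSupport φ → tsupport φ ⊆ D →
    ∫ x in D, u x * fderiv ℝ φ x (EuclideanSpace.single i 1) = -∫ x in D, g x * φ x

/-- `BL(D)`: the functions `u ∈ L²_loc(D)` all of whose distributional first partial derivatives
are in `L²(D)`. The values of `u` off `D` are irrelevant. -/
def BL (D : Set (EuclideanSpace ℝ (Fin d))) : Set (EuclideanSpace ℝ (Fin d) → ℝ) :=
  {u | (∀ K ⊆ D, IsCompact K → MemLp u 2 (volume.restrict K)) ∧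
    ∀ i, ∃ g, MemLp g 2 (volume.restrict D) ∧ HasWeakPartial D i u g}

open Classical in
/-- The `i`-th distributional partial derivative of `u ∈ BL(D)`, unique up to a.e. equality on
`D` (and `0` if there is none in `L²(D)`). -/
def weakPartial (D : Set (EuclideanSpace ℝ (Fin d))) (i : Fin d)
    (u : EuclideanSpace ℝ (Fin d) → ℝ) : EuclideanSpace ℝ (Fin d) → ℝ :=
  if h : ∃ g, MemLp g 2 (volume.restrict D) ∧ HasWeakPartial D i u g then h.choose else 0

/-- The Dirichlet integral `𝐃(u, v) = ∑ i, ∫_D ∂ᵢu ∂ᵢv dx`. -/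
def dirichlet (D : Set (EuclideanSpace ℝ (Fin d))) (u v : EuclideanSpace ℝ (Fin d) → ℝ) : ℝ :=
  ∑ i, ∫ x in D, weakPartial D i u x * weakPartial D i v x

/-- The measure `m(x) dx` on `D`. -/
def densityMeasure (D : Set (EuclideanSpace ℝ (Fin d))) (m : EuclideanSpace ℝ (Fin d) → ℝ) :
    Measure (EuclideanSpace ℝ (Fin d)) :=
  (volume.restrict D).withDensity fun x => ENNReal.ofReal (m x)

/-- `BL(D) ∩ L²(D; m)`. -/
def domainStar (D : Set (EuclideanSpace ℝ (Fin d))) (m : EuclideanSpace ℝ (Fin d) → ℝ) :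
    Set (Lp ℝ 2 (densityMeasure D m)) :=
  {u | (u : EuclideanSpace ℝ (Fin d) → ℝ) ∈ BL D}

/-- The form `½ 𝐃` on `BL(D) ∩ L²(D; m)`. -/
def formStar (D : Set (EuclideanSpace ℝ (Fin d))) (m : EuclideanSpace ℝ (Fin d) → ℝ)
    (u v : Lp ℝ 2 (densityMeasure D m)) : ℝ :=
  1 / 2 * dirichlet D u v

end BeppoLevi

end

set_option linter.unusedSectionVars false

noncomputable section

namespace BeppoLevi

/-! ### Generation of semigroups by resolvents -/

section Generation

variable {H : Type*} [NormedAddCommGroup H] [InnerProductSpace ℝ H] [CompleteSpace H]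

/-! The analytic core is the `L²` modulus of continuity of a function with a square integrable weak
derivative: a translation by `h` changes `u` by at most `‖∂_h u‖` in `L²` of a set whose translates
along the segment stay in `D` (`exists_translate_sub_eq`). Difference quotients then show that
normal contractions do not increase weak derivatives (`exists_hasWeakDir_comp`), which gives the
Markov property. Integrating over `h` bounds the double integral of `|u(x) - u(y)|²` over a small
ball by the gradient, a Poincaré inequality (`lintegral_lintegral_sub_sq_le`).

The form is closed because an `E₁`-Cauchy sequence converges in `L²(D; m)`, hence in `L²` on compact
subsets of `D`, where `m` is bounded below, and weak derivatives survive such limits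
(`HasWeakDir.of_tendsto`). For the extended space, an approximating sequence has convergent
gradients; the Poincaré inequality upgrades its almost everywhere convergence to local `L²`
convergence, so the limit lies in `BL(D)` with the limiting gradient (`hasWeakDir_of_ae_tendsto`).
Conversely, the truncations of `u ∈ BL(D)` are in `L²(D; m)` because this measure is finite, and
their gradients converge weakly to that of `u` without exceeding its norm, hence strongly
(`tendsto_grad_trunc`).

For recurrence, the resolvents come from the Riesz theorem for `E₁` and the semigroup from Yosida
approximation (`exists_semigroup`). The constant `1` is in the domain and has zero gradient, so `T_t
1 = 1`. Now `∫₀ᴺ T_s f ds = ∑_{k<N} T₁ᵏ g` with `g = ∫₀¹ T_s f ds`, and the mean ergodic theorem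
gives a limit `p` of the averages. Where `p > 0` the sums diverge; where `p = 0` every `T₁ᵏ g`
vanishes, as is seen by testing against the fixed functions `1 - ((n + 1) p) ∧ 1`
(`iterate_ae_eq_zero`). So the Green function takes only the values `0` and `∞`. -/

theorem hasSum_exp_apply (B : H →L[ℝ] H) (u : H) :
    HasSum (fun k : ℕ => ((k.factorial : ℝ)⁻¹) • (B ^ k) u) (NormedSpace.exp B u) := by
  have h := NormedSpace.exp_series_hasSum_exp' (𝕂 := ℝ) B
  simpa using (ContinuousLinearMap.apply ℝ H u).hasSum h

theorem norm_exp_le_exp_norm (B : H →L[ℝ] H) : ‖NormedSpace.exp B‖ ≤ Real.exp ‖B‖ := by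
  refine ContinuousLinearMap.opNorm_le_bound _ (Real.exp_nonneg _) fun u => ?_
  have h := hasSum_exp_apply B u
  have h2 : HasSum (fun k : ℕ => ((k.factorial : ℝ)⁻¹ * ‖B‖ ^ k) * ‖u‖) (Real.exp ‖B‖ * ‖u‖) := by
    have := NormedSpace.exp_series_hasSum_exp' (𝕂 := ℝ) ‖B‖
    rw [← Real.exp_eq_exp_ℝ] at this
    simpa using this.mul_right ‖u‖
  rw [← h.tsum_eq]
  refine tsum_of_norm_bounded h2 fun k => ?_
  rw [norm_smul, norm_inv, mul_assoc]
  have : ‖(B ^ k) u‖ ≤ ‖B‖ ^ k * ‖u‖ := by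
    refine (ContinuousLinearMap.le_opNorm _ _).trans ?_
    gcongr
    rcases k with _ | k
    · rw [pow_zero, pow_zero]; exact ContinuousLinearMap.norm_id_le
    · exact norm_pow_le' _ (Nat.succ_pos _)
  have h3 : ‖(k.factorial : ℝ)‖ = k.factorial := by simp
  rw [h3]
  gcongr

theorem exp_smul_sub_one (J : H →L[ℝ] H) (c : ℝ) :
    NormedSpace.exp (c • (J - 1)) = Real.exp (-c) • NormedSpace.exp (c • J) := by
  have e : c • (J - 1) = (algebraMap ℝ (H →L[ℝ] H) (-c)) + c • J := by
    rw [Algebra.algebraMap_eq_smul_one]; module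
  let _ : NormedAlgebra ℚ (H →L[ℝ] H) := NormedAlgebra.restrictScalars ℚ ℝ _
  rw [e, NormedSpace.exp_add_of_commute (Algebra.commute_algebraMap_left _ _),
    ← NormedSpace.algebraMap_exp_comm, ← Real.exp_eq_exp_ℝ, Algebra.algebraMap_eq_smul_one,
    smul_mul_assoc, one_mul]

/-- The scalar factor `e^{-c}` offsets `e^{c‖J‖}`. This makes the Yosida exponentials contractions
uniformly in `n`. -/
theorem norm_exp_smul_sub_one_le {J : H →L[ℝ] H} (hJ : ‖J‖ ≤ 1) {c : ℝ} (hc : 0 ≤ c) :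
    ‖NormedSpace.exp (c • (J - 1))‖ ≤ 1 := by
  rw [exp_smul_sub_one, norm_smul, Real.norm_eq_abs, Real.abs_exp]
  calc Real.exp (-c) * ‖NormedSpace.exp (c • J)‖ ≤ Real.exp (-c) * Real.exp (c * 1) := by
        gcongr
        refine (norm_exp_le_exp_norm _).trans (Real.exp_le_exp.2 ?_)
        rw [norm_smul, Real.norm_of_nonneg hc]
        gcongr
    _ = 1 := by rw [← Real.exp_add]; simp

/-- Duhamel's argument: `s ↦ e^{sA} e^{(t-s)B} u` interpolates between the two exponentials, and
since `A` and `B` commute its derivative is `e^{sA} e^{(t-s)B} (A u - B u)`, of norm at most `‖A u -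
B u‖`. -/
theorem norm_exp_sub_exp_le {A B : H →L[ℝ] H} (hAB : Commute A B)
    (hA : ∀ t : ℝ, 0 ≤ t → ‖NormedSpace.exp (t • A)‖ ≤ 1)
    (hB : ∀ t : ℝ, 0 ≤ t → ‖NormedSpace.exp (t • B)‖ ≤ 1) {t : ℝ} (ht : 0 ≤ t) (u : H) :
    ‖NormedSpace.exp (t • A) u - NormedSpace.exp (t • B) u‖ ≤ t * ‖A u - B u‖ := by
  let f : ℝ → H := fun s => (NormedSpace.exp (s • A) * NormedSpace.exp ((t - s) • B)) u
  let f' : ℝ → H := fun s =>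
    (NormedSpace.exp (s • A) * NormedSpace.exp ((t - s) • B)) (A u - B u)
  have hd : ∀ s, HasDerivAt f (f' s) s := fun s => by
    have h1 := hasDerivAt_exp_smul_const (𝕂 := ℝ) A s
    have h2 : HasDerivAt (fun s : ℝ => NormedSpace.exp ((t - s) • B))
        (-(NormedSpace.exp ((t - s) • B) * B)) s := by
      have := (hasDerivAt_exp_smul_const (𝕂 := ℝ) B (t - s)).scomp s
        ((hasDerivAt_id s).const_sub t)
      simpa [Function.comp_def] using this
    have h3 := (ContinuousLinearMap.apply ℝ H u).hasFDerivAt.comp_hasDerivAt s (h1.mul h2)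
    convert! h3 using 1
    have hc : A * NormedSpace.exp ((t - s) • B) = NormedSpace.exp ((t - s) • B) * A :=
      ((hAB.smul_right (t - s)).exp_right).eq
    simp only [f', map_sub, ContinuousLinearMap.apply_apply, add_apply]
    rw [mul_assoc, hc]
    simp [sub_eq_add_neg]
  have hb : ∀ s ∈ Set.Ico (0 : ℝ) t, ‖f' s‖ ≤ ‖A u - B u‖ := fun s hs => by
    refine (ContinuousLinearMap.le_opNorm _ _).trans (mul_le_of_le_one_left (norm_nonneg _) ?_)
    refine (norm_mul_le _ _).trans ?_
    exact mul_le_one₀ (hA s hs.1) (norm_nonneg _) (hB _ (by linarith [hs.2]))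
  have h := norm_image_sub_le_of_norm_deriv_le_segment'
    (fun s _ => (hd s).hasDerivWithinAt) hb t ⟨ht, le_rfl⟩
  simpa [f, mul_comm] using h

/-- A second-order Taylor estimate. The constant is `1` and not `1/2` because the derivative `e^{sA}
A u - A u` is bounded by `t ‖A (A u)‖` uniformly on `[0, t]`. -/
theorem norm_exp_sub_sub_le {A : H →L[ℝ] H}
    (hA : ∀ t : ℝ, 0 ≤ t → ‖NormedSpace.exp (t • A)‖ ≤ 1) {t : ℝ} (ht : 0 ≤ t) (u : H) :
    ‖NormedSpace.exp (t • A) u - u - t • A u‖ ≤ t ^ 2 * ‖A (A u)‖ := by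
  let f : ℝ → H := fun s => NormedSpace.exp (s • A) u - u - s • A u
  have hd : ∀ s, HasDerivAt f (NormedSpace.exp (s • A) (A u) - A u) s := fun s => by
    have h1 := (ContinuousLinearMap.apply ℝ H u).hasFDerivAt.comp_hasDerivAt s
      (hasDerivAt_exp_smul_const (𝕂 := ℝ) A s)
    have h2 := (h1.sub_const u).sub ((hasDerivAt_id s).smul_const (A u))
    refine HasDerivAt.congr_deriv (f := f) h2 ?_
    simp
  have hb : ∀ s ∈ Set.Ico (0 : ℝ) t,
      ‖NormedSpace.exp (s • A) (A u) - A u‖ ≤ t * ‖A (A u)‖ := fun s hs => by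
    have h := norm_exp_sub_exp_le (B := 0) (Commute.zero_right A) hA
      (fun t _ => by rw [smul_zero, NormedSpace.exp_zero]; exact ContinuousLinearMap.norm_id_le) hs.1 (A u)
    simp only [smul_zero, NormedSpace.exp_zero, one_apply_eq_self,
      zero_apply, sub_zero] at h
    exact h.trans (by gcongr; exact hs.2.le)
  have h := norm_image_sub_le_of_norm_deriv_le_segment'
    (fun s _ => (hd s).hasDerivWithinAt) hb t ⟨ht, le_rfl⟩
  calc _ = ‖f t - f 0‖ := by simp [f]
    _ ≤ _ := h
    _ = _ := by ring

/-- `J n = (1 - A / (n + 1))⁻¹` for the self-adjoint operator with graph `A`. -/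
structure IsResolventFamily (A : H → H → Prop) (J : ℕ → H →L[ℝ] H) : Prop where
  norm_le : ∀ n, ‖J n‖ ≤ 1
  symm : ∀ n f g, inner ℝ (J n f) g = inner ℝ f (J n g)
  graph : ∀ n u w, A u w ↔ J n (u - ((n : ℝ) + 1)⁻¹ • w) = u
  dense : DenseRange (J 0)

/-- The Yosida approximation of the generator. -/
def yosida (J : ℕ → H →L[ℝ] H) (n : ℕ) : H →L[ℝ] H := ((n : ℝ) + 1) • (J n - 1)

/-- The semigroup generated by the Yosida approximation. -/
def yosidaExp (J : ℕ → H →L[ℝ] H) (n : ℕ) (t : ℝ) : H →L[ℝ] H := NormedSpace.exp (t • yosida J n)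

theorem yosidaExp_eq (J : ℕ → H →L[ℝ] H) (n : ℕ) (t : ℝ) :
    yosidaExp J n t = NormedSpace.exp ((t * ((n : ℝ) + 1)) • (J n - 1)) := by
  rw [yosidaExp, yosida, smul_smul]

/-- The expansion `e^{-c} ∑ cᵏ Jᵏ / k!` has nonnegative coefficients, so its partial sums stay in
any convex cone preserved by `J n`. It is applied to the cone of nonnegative functions. -/
theorem yosidaExp_apply_mem {J : ℕ → H →L[ℝ] H} {C : Set H} (hC : IsClosed C)
    (hadd : ∀ u ∈ C, ∀ v ∈ C, u + v ∈ C) (hsmul : ∀ c : ℝ, 0 ≤ c → ∀ u ∈ C, c • u ∈ C)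
    {n : ℕ} (hJ : ∀ u ∈ C, J n u ∈ C) {t : ℝ} (ht : 0 ≤ t) {u : H} (hu : u ∈ C) :
    yosidaExp J n t u ∈ C := by
  rw [yosidaExp_eq, exp_smul_sub_one]
  refine hsmul _ (Real.exp_nonneg _) _ ?_
  refine hC.mem_of_tendsto (hasSum_exp_apply _ u) (.of_forall fun s => ?_)
  have hk : ∀ k : ℕ, (J n ^ k) u ∈ C := fun k => by
    induction k with
    | zero => simpa using hu
    | succ k ih => rw [pow_succ']; exact hJ _ ih
  classical
  induction s using Finset.induction_on with
  | empty => simpa using hsmul 0 le_rfl u hu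
  | insert a s ha ih =>
    rw [Finset.sum_insert ha]
    refine hadd _ ?_ _ ih
    rw [smul_pow, smul_apply, smul_smul]
    exact hsmul _ (by positivity) _ (hk a)

/-! ### Resolvents, Yosida approximations and their convergence. -/

namespace IsResolventFamily

variable {A : H → H → Prop} {J : ℕ → H →L[ℝ] H} (h : IsResolventFamily A J)
include h

theorem graph_apply (n : ℕ) (f : H) : A (J n f) (yosida J n f) := by
  rw [h.graph n]
  have : ((n : ℝ) + 1) ≠ 0 := by positivity
  simp [yosida, smul_smul, this]

theorem yosida_apply (n : ℕ) {u w : H} (hu : A u w) : yosida J n u = J n w := by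
  have h1 := (h.graph n u w).1 hu
  have : ((n : ℝ) + 1) ≠ 0 := by positivity
  rw [map_sub, map_smul, sub_eq_iff_eq_add] at h1
  simp [yosida, h1, smul_smul, this]

theorem graph_map (n : ℕ) {u w : H} (hu : A u w) : A (J n u) (J n w) := by
  rw [h.graph n, ← map_smul, ← map_sub, (h.graph n u w).1 hu]

/-- Since `J k` maps the graph of `A` into itself, `graph n` applies to the pair `(J k (J n f), J k
(yosida J n f))`, and there it reads `J n (J k f) = J k (J n f)`. -/
theorem commute (n k : ℕ) : Commute (J n) (J k) := by
  ext f
  have h1 := (h.graph n _ _).1 (h.graph_map k (h.graph_apply n f))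
  have : ((n : ℝ) + 1) ≠ 0 := by positivity
  simpa [yosida, smul_smul, this] using h1

theorem commute_yosida (n k : ℕ) : Commute (yosida J n) (yosida J k) := by
  unfold yosida
  exact ((((h.commute n k).sub_left (Commute.one_left _)).sub_right
    (Commute.one_right _)).smul_left _).smul_right _

theorem norm_exp_yosida_le (n : ℕ) (t : ℝ) (ht : 0 ≤ t) :
    ‖NormedSpace.exp (t • yosida J n)‖ ≤ 1 := by
  rw [yosida, smul_smul]
  exact norm_exp_smul_sub_one_le (h.norm_le n) (by positivity)

theorem norm_apply_le (n : ℕ) (u : H) : ‖J n u‖ ≤ ‖u‖ := by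
  simpa using (J n).le_of_opNorm_le (h.norm_le n) u

theorem yosidaExp_norm_apply_le (n : ℕ) {t : ℝ} (ht : 0 ≤ t) (u : H) :
    ‖yosidaExp J n t u‖ ≤ ‖u‖ := by
  simpa using (yosidaExp J n t).le_of_opNorm_le (h.norm_exp_yosida_le n t ht) u

/-- Pointwise convergence of contractions is inherited from a dense set. -/
theorem tendsto_apply_of_dense {L : ℕ → H →L[ℝ] H} {M : H →L[ℝ] H}
    (hL : ∀ n u, ‖L n u‖ ≤ ‖u‖) (hM : ∀ u, ‖M u‖ ≤ ‖u‖)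
    (hd : ∀ f, Tendsto (fun n => L n (J 0 f)) atTop (𝓝 (M (J 0 f)))) (u : H) :
    Tendsto (fun n => L n u) atTop (𝓝 (M u)) := by
  rw [Metric.tendsto_atTop]
  intro ε hε
  obtain ⟨f, hf⟩ := h.dense.exists_dist_lt u (ε := ε / 3) (by positivity)
  obtain ⟨N, hN⟩ := Metric.tendsto_atTop.1 (hd f) (ε / 3) (by positivity)
  refine ⟨N, fun n hn => ?_⟩
  rw [dist_eq_norm] at hf ⊢
  have h1 := hN n hn
  rw [dist_eq_norm] at h1
  have h2 := hL n (u - J 0 f)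
  have h3 := hM (u - J 0 f)
  calc ‖L n u - M u‖
      = ‖L n (u - J 0 f) - M (u - J 0 f) + (L n (J 0 f) - M (J 0 f))‖ := by
        congr 1; simp only [map_sub]; abel
    _ ≤ ‖L n (u - J 0 f)‖ + ‖M (u - J 0 f)‖ + ‖L n (J 0 f) - M (J 0 f)‖ :=
        (norm_add_le _ _).trans (by gcongr; exact norm_sub_le _ _)
    _ < ε := by linarith

/-- On the dense range of `J 0` the error is explicit: `J n u - u = (n + 1)⁻¹ • J n w` with `w = A
u`. Contractivity extends the convergence to all of `H`. -/
theorem tendsto_resolvent (u : H) : Tendsto (fun n => J n u) atTop (𝓝 u) := by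
  refine h.tendsto_apply_of_dense (M := 1) h.norm_apply_le (by simp) (fun f => ?_) u
  rw [tendsto_iff_norm_sub_tendsto_zero]
  set w := yosida J 0 f
  have hb : ∀ n : ℕ, ‖J n (J 0 f) - (1 : H →L[ℝ] H) (J 0 f)‖ ≤ ((n : ℝ) + 1)⁻¹ * ‖w‖ := fun n => by
    have h1 := (h.graph n _ _).1 (h.graph_apply 0 f)
    rw [map_sub, map_smul, sub_eq_iff_eq_add, ← sub_eq_iff_eq_add'] at h1
    rw [one_apply_eq_self, h1, norm_smul, norm_inv,
      Real.norm_of_nonneg (by positivity)]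
    gcongr
    exact h.norm_apply_le _ _
  refine squeeze_zero (fun _ => norm_nonneg _) hb ?_
  have := tendsto_one_div_add_atTop_nhds_zero_nat (𝕜 := ℝ)
  simpa using this.mul_const ‖w‖

/-- For `u` in the range of `J 0`, `yosida J n u = J n (A u)` converges, and the Duhamel estimate
transfers the Cauchy property to the exponentials at the cost of a factor `t`. The rest is density.
-/
theorem exists_tendsto_yosidaExp {t : ℝ} (ht : 0 ≤ t) (u : H) :
    ∃ l, Tendsto (fun n => yosidaExp J n t u) atTop (𝓝 l) := by
  refine cauchySeq_tendsto_of_complete ?_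
  have hrange : ∀ f, CauchySeq (fun n => yosidaExp J n t (J 0 f)) := fun f => by
    have hw : CauchySeq (fun n => yosida J n (J 0 f)) := by
      refine Filter.Tendsto.cauchySeq (x := yosida J 0 f) ?_
      simp_rw [fun n => h.yosida_apply n (h.graph_apply 0 f)]
      exact h.tendsto_resolvent _
    rw [Metric.cauchySeq_iff] at hw ⊢
    intro ε hε
    obtain ⟨N, hN⟩ := hw (ε / (t + 1)) (by positivity)
    refine ⟨N, fun a ha b hb => ?_⟩
    have h1 := norm_exp_sub_exp_le (h.commute_yosida a b) (h.norm_exp_yosida_le a)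
      (h.norm_exp_yosida_le b) ht (J 0 f)
    have h2 := hN a ha b hb
    rw [dist_eq_norm, lt_div_iff₀ (by positivity)] at h2
    rw [dist_eq_norm]
    refine h1.trans_lt (lt_of_le_of_lt ?_ h2)
    rw [mul_comm]
    gcongr
    linarith
  rw [Metric.cauchySeq_iff]
  intro ε hε
  obtain ⟨f, hf⟩ := h.dense.exists_dist_lt u (ε := ε / 3) (by positivity)
  obtain ⟨N, hN⟩ := Metric.cauchySeq_iff.1 (hrange f) (ε / 3) (by positivity)
  refine ⟨N, fun a ha b hb => ?_⟩
  rw [dist_eq_norm] at hf ⊢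
  have h1 := hN a ha b hb
  rw [dist_eq_norm] at h1
  have h2 := h.yosidaExp_norm_apply_le a ht (u - J 0 f)
  have h3 := h.yosidaExp_norm_apply_le b ht (u - J 0 f)
  calc ‖yosidaExp J a t u - yosidaExp J b t u‖
      = ‖yosidaExp J a t (u - J 0 f) - yosidaExp J b t (u - J 0 f)
          + (yosidaExp J a t (J 0 f) - yosidaExp J b t (J 0 f))‖ := by
        congr 1; simp only [map_sub]; abel
    _ ≤ ‖yosidaExp J a t (u - J 0 f)‖ + ‖yosidaExp J b t (u - J 0 f)‖
          + ‖yosidaExp J a t (J 0 f) - yosidaExp J b t (J 0 f)‖ :=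
        (norm_add_le _ _).trans (by gcongr; exact norm_sub_le _ _)
    _ < ε := by linarith

/-- The limit of the semigroups of the Yosida approximations. -/
theorem exists_limit_semigroup : ∃ T : ℝ → H →L[ℝ] H, ∀ t, 0 ≤ t → ∀ u,
    Tendsto (fun n => yosidaExp J n t u) atTop (𝓝 (T t u)) := by
  have hex : ∀ t : ℝ, ∃ T : H →L[ℝ] H, 0 ≤ t → ∀ u,
      Tendsto (fun n => yosidaExp J n t u) atTop (𝓝 (T u)) := fun t => by
    by_cases ht : 0 ≤ t
    · choose f hf using h.exists_tendsto_yosidaExp ht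
      exact ⟨continuousLinearMapOfTendsto (fun n => yosidaExp J n t) (tendsto_pi_nhds.2 hf),
        fun _ u => hf u⟩
    · exact ⟨0, fun h0 => absurd h0 ht⟩
  choose T hT using hex
  exact ⟨T, hT⟩

theorem yosida_symm (n : ℕ) (f g : H) :
    inner ℝ (yosida J n f) g = inner ℝ f (yosida J n g) := by
  simp [yosida, inner_smul_left, inner_smul_right, inner_sub_left, inner_sub_right, h.symm]

theorem yosidaExp_symm (n : ℕ) (t : ℝ) (f g : H) :
    inner ℝ (yosidaExp J n t f) g = inner ℝ f (yosidaExp J n t g) := by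
  have hs : IsSelfAdjoint (yosida J n) := by
    rw [ContinuousLinearMap.isSelfAdjoint_iff_isSymmetric]
    exact fun f g => h.yosida_symm n f g
  have : IsSelfAdjoint (yosidaExp J n t) := by
    rw [IsSelfAdjoint, yosidaExp, NormedSpace.star_exp, star_smul, hs.star_eq]
    simp
  exact (ContinuousLinearMap.isSelfAdjoint_iff_isSymmetric.1 this) f g

/-! ### The limit semigroup and its generator. -/

section Limit

variable {T : ℝ → H →L[ℝ] H}
  (hT : ∀ t, 0 ≤ t → ∀ u, Tendsto (fun n => yosidaExp J n t u) atTop (𝓝 (T t u)))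
include hT

theorem limit_norm_apply_le {t : ℝ} (ht : 0 ≤ t) (u : H) : ‖T t u‖ ≤ ‖u‖ :=
  le_of_tendsto (hT t ht u).norm (.of_forall fun n => h.yosidaExp_norm_apply_le n ht u)

theorem limit_add {s t : ℝ} (hs : 0 ≤ s) (ht : 0 ≤ t) : T (s + t) = (T s).comp (T t) := by
  ext u
  refine tendsto_nhds_unique (hT _ (add_nonneg hs ht) u) ?_
  have e : ∀ n, yosidaExp J n (s + t) u =
      yosidaExp J n s (yosidaExp J n t u - T t u) + yosidaExp J n s (T t u) := fun n => by
    let _ : NormedAlgebra ℚ (H →L[ℝ] H) := NormedAlgebra.restrictScalars ℚ ℝ _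
    rw [← map_add, sub_add_cancel, yosidaExp, add_smul, NormedSpace.exp_add_of_commute]
    · rfl
    · exact ((Commute.refl _).smul_left _).smul_right _
  simp_rw [e]
  rw [ContinuousLinearMap.comp_apply, ← zero_add (T s (T t u))]
  refine Tendsto.add ?_ (hT s hs _)
  rw [tendsto_zero_iff_norm_tendsto_zero]
  refine squeeze_zero (fun _ => norm_nonneg _) (fun n => h.yosidaExp_norm_apply_le n hs _) ?_
  exact (tendsto_iff_norm_sub_tendsto_zero.1 (hT t ht u))

theorem limit_symm {t : ℝ} (ht : 0 ≤ t) (f g : H) : inner ℝ (T t f) g = inner ℝ f (T t g) :=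
  tendsto_nhds_unique ((hT t ht f).inner tendsto_const_nhds)
    ((tendsto_const_nhds.inner (hT t ht g)).congr fun n => (h.yosidaExp_symm n t f g).symm)

theorem limit_commute {t : ℝ} (ht : 0 ≤ t) (k : ℕ) (u : H) : T t (J k u) = J k (T t u) := by
  refine tendsto_nhds_unique (hT t ht _)
    ((((J k).continuous.tendsto _).comp (hT t ht u)).congr fun n => ?_)
  have : Commute (J k) (yosidaExp J n t) := by
    refine Commute.exp_right (Commute.smul_right ?_ _)
    unfold yosida
    exact ((h.commute k n).sub_right (Commute.one_right _)).smul_right _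
  exact congrArg (fun L : H →L[ℝ] H => L u) this.eq

theorem limit_norm_sub_le {t : ℝ} (ht : 0 ≤ t) {u w : H} (hu : A u w) :
    ‖T t u - u‖ ≤ t * ‖w‖ := by
  refine le_of_tendsto ((hT t ht u).sub_const u).norm (.of_forall fun n => ?_)
  have h1 := norm_exp_sub_exp_le (B := 0) (Commute.zero_right _) (h.norm_exp_yosida_le n)
    (fun t _ => by rw [smul_zero, NormedSpace.exp_zero]; exact ContinuousLinearMap.norm_id_le) ht u
  simp only [smul_zero, NormedSpace.exp_zero, one_apply_eq_self,
    zero_apply, sub_zero] at h1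
  refine h1.trans ?_
  rw [h.yosida_apply n hu]
  gcongr
  exact h.norm_apply_le n w

theorem limit_norm_sub_sub_le {t : ℝ} (ht : 0 ≤ t) {u w z : H} (hu : A u w) (hw : A w z) :
    ‖T t u - u - t • w‖ ≤ t ^ 2 * ‖z‖ := by
  have hw' : Tendsto (fun n => yosida J n u) atTop (𝓝 w) := by
    simp_rw [fun n => h.yosida_apply n hu]
    exact h.tendsto_resolvent _
  refine le_of_tendsto (((hT t ht u).sub_const u).sub (hw'.const_smul t)).norm
    (.of_forall fun n => ?_)
  refine (norm_exp_sub_sub_le (h.norm_exp_yosida_le n) ht u).trans ?_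
  rw [h.yosida_apply n hu, h.yosida_apply n (h.graph_map n hw)]
  gcongr
  exact (h.norm_apply_le n _).trans (h.norm_apply_le n _)

theorem limit_tendsto_zero (u : H) : Tendsto (fun t => T t u) (𝓝[>] 0) (𝓝 u) := by
  rw [Metric.tendsto_nhds]
  intro ε hε
  obtain ⟨f, hf⟩ := h.dense.exists_dist_lt u (ε := ε / 3) (by positivity)
  set w := yosida J 0 f
  have ht : ∀ᶠ t : ℝ in 𝓝[>] 0, t * ‖w‖ < ε / 3 := by
    have : Tendsto (fun t : ℝ => t * ‖w‖) (𝓝[>] 0) (𝓝 (0 * ‖w‖)) :=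
      (tendsto_id.mono_left nhdsWithin_le_nhds).mul_const _
    rw [zero_mul] at this
    exact this.eventually (gt_mem_nhds (by positivity))
  filter_upwards [ht, self_mem_nhdsWithin] with t ht ht0
  have ht0 : 0 ≤ t := le_of_lt ht0
  rw [dist_eq_norm] at hf ⊢
  have h1 := h.limit_norm_sub_le hT ht0 (h.graph_apply 0 f)
  have h2 := h.limit_norm_apply_le hT ht0 (u - J 0 f)
  calc ‖T t u - u‖ = ‖T t (u - J 0 f) - (u - J 0 f) + (T t (J 0 f) - J 0 f)‖ := by
        congr 1; simp only [map_sub]; abel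
    _ ≤ ‖T t (u - J 0 f)‖ + ‖u - J 0 f‖ + ‖T t (J 0 f) - J 0 f‖ :=
        (norm_add_le _ _).trans (by gcongr; exact norm_sub_le _ _)
    _ < ε := by linarith

/-- The second-order estimate needs a vector in the domain of `A²`, so `u` is approximated in the
graph norm by `p = J 0 (J 0 f)`. The remainder `u - p` costs only `‖w - q‖`, by the first-order
estimate. -/
theorem tendsto_of_graph {u w : H} (hu : A u w) :
    Tendsto (fun t : ℝ => t⁻¹ • (T t u - u)) (𝓝[>] 0) (𝓝 w) := by
  have hu' : J 0 (u - w) = u := by simpa using (h.graph 0 u w).1 hu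
  rw [Metric.tendsto_nhds]
  intro ε hε
  -- The quantity `‖w - q‖` will be at most `2ε/5` and occurs twice; the last `ε/5` pays for the
  -- second-order term.
  obtain ⟨f, hf⟩ := h.dense.exists_dist_lt (u - w) (ε := ε / 5) (by positivity)
  set p := J 0 (J 0 f)
  have hp : A p (J 0 (yosida J 0 f)) := h.graph_map 0 (h.graph_apply 0 f)
  have hpz : A (J 0 (yosida J 0 f)) (yosida J 0 (yosida J 0 f)) := h.graph_apply 0 _
  set q := J 0 (yosida J 0 f)
  set z := yosida J 0 (yosida J 0 f)
  have hsub : A (u - p) (w - q) := by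
    rw [h.graph 0]
    have h1 := (h.graph 0 _ _).1 hp
    have h2 := (h.graph 0 _ _).1 hu
    rw [show u - p - ((0 : ℕ) + 1 : ℝ)⁻¹ • (w - q) =
      (u - ((0 : ℕ) + 1 : ℝ)⁻¹ • w) - (p - ((0 : ℕ) + 1 : ℝ)⁻¹ • q) by module, map_sub, h1, h2]
  have hd : ‖w - q‖ ≤ 2 * (ε / 5) := by
    rw [dist_eq_norm] at hf
    have e : w - q = J 0 (u - w - J 0 f) - (u - w - J 0 f) := by
      have e1 : J 0 (u - w - J 0 f) = u - p := by rw [map_sub, hu']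
      have e2 : q = p - J 0 f := by simp [q, p, yosida]
      rw [e1, e2]; abel
    rw [e]
    have := h.norm_apply_le 0 (u - w - J 0 f)
    refine (norm_sub_le _ _).trans (by linarith)
  have ht : ∀ᶠ t : ℝ in 𝓝[>] 0, t * ‖z‖ < ε / 5 := by
    have : Tendsto (fun t : ℝ => t * ‖z‖) (𝓝[>] 0) (𝓝 (0 * ‖z‖)) :=
      (tendsto_id.mono_left nhdsWithin_le_nhds).mul_const _
    rw [zero_mul] at this
    exact this.eventually (gt_mem_nhds (by positivity))
  filter_upwards [ht, self_mem_nhdsWithin] with t ht ht0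
  have ht0 : 0 < t := ht0
  rw [dist_eq_norm]
  have h1 := h.limit_norm_sub_le hT ht0.le hsub
  have h2 := h.limit_norm_sub_sub_le hT ht0.le hp hpz
  have h3 : ‖t⁻¹ • (T t (u - p) - (u - p))‖ ≤ ‖w - q‖ := by
    rw [norm_smul, norm_inv, Real.norm_of_nonneg ht0.le, inv_mul_le_iff₀ ht0]
    exact h1
  have h4 : ‖t⁻¹ • (T t p - p - t • q)‖ ≤ t * ‖z‖ := by
    rw [norm_smul, norm_inv, Real.norm_of_nonneg ht0.le, inv_mul_le_iff₀ ht0]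
    exact h2.trans_eq (by ring)
  calc ‖t⁻¹ • (T t u - u) - w‖
      = ‖t⁻¹ • (T t (u - p) - (u - p)) - (w - q) + t⁻¹ • (T t p - p - t • q)‖ := by
        congr 1
        rw [smul_sub _ _ (t • q), smul_smul, inv_mul_cancel₀ ht0.ne', one_smul, map_sub]
        module
    _ ≤ ‖t⁻¹ • (T t (u - p) - (u - p))‖ + ‖w - q‖ + ‖t⁻¹ • (T t p - p - t • q)‖ :=
        (norm_add_le _ _).trans (by gcongr; exact norm_sub_le _ _)
    _ < ε := by linarith

/-- For the converse, `J 0` commutes with `T t`, so `J 0 w` is the derivative along `J 0 u`, which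
is already known to be `J 0 u - u`. Hence `J 0 (u - w) = u`, the defining relation of the graph. -/
theorem graph_iff_tendsto (u w : H) :
    Tendsto (fun t : ℝ => t⁻¹ • (T t u - u)) (𝓝[>] 0) (𝓝 w) ↔ A u w := by
  refine ⟨fun hw => ?_, h.tendsto_of_graph hT⟩
  have h1 := ((J 0).continuous.tendsto _).comp hw
  have h2 := h.tendsto_of_graph hT (h.graph_apply 0 u)
  have h3 : J 0 w = yosida J 0 u := by
    refine tendsto_nhds_unique h1 (h2.congr' ?_)
    filter_upwards [self_mem_nhdsWithin] with t ht0
    have ht0 : (0 : ℝ) < t := ht0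
    simp [h.limit_commute hT ht0.le]
  rw [h.graph 0]
  simp [h3, yosida]

end Limit

end IsResolventFamily

end Generation

/-! ### The semigroup of a Dirichlet form -/

section FormSemigroup

variable {X : Type*} [MeasurableSpace X] {μ : Measure X} {F : Set (Lp ℝ 2 μ)}
  {E : Lp ℝ 2 μ → Lp ℝ 2 μ → ℝ}

theorem inner_nonneg_of_nonneg {f g : Lp ℝ 2 μ} (hf : 0 ≤ f) (hg : 0 ≤ g) : 0 ≤ inner ℝ f g := by
  rw [L2.inner_def]
  refine integral_nonneg_of_ae ?_
  filter_upwards [(Lp.coeFn_nonneg f).2 hf, (Lp.coeFn_nonneg g).2 hg] with x h1 h2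
  simpa using mul_nonneg h2 h1

namespace IsDirichletForm

theorem sub_mem (h : IsDirichletForm μ F E) {u v : Lp ℝ 2 μ} (hu : u ∈ F) (hv : v ∈ F) :
    u - v ∈ F := by
  have := h.add_mem u hu _ (h.smul_mem (-1) v hv)
  simpa [sub_eq_add_neg] using this

theorem sub_left (h : IsDirichletForm μ F E) {u v w : Lp ℝ 2 μ} (hu : u ∈ F) (hv : v ∈ F)
    (hw : w ∈ F) : E (u - v) w = E u w - E v w := by
  have h1 := h.add_left u hu _ (h.smul_mem (-1) v hv) w hw
  rw [h.smul_left (-1) v hv w hw] at h1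
  rw [show u - v = u + (-1 : ℝ) • v by module, h1]
  ring

theorem sub_right (h : IsDirichletForm μ F E) {u v w : Lp ℝ 2 μ} (hu : u ∈ F) (hv : v ∈ F)
    (hw : w ∈ F) : E w (u - v) = E w u - E w v := by
  rw [h.symm w hw _ (h.sub_mem hu hv), h.sub_left hu hv hw, h.symm u hu w hw, h.symm v hv w hw]

/-- The domain of a Dirichlet form, as a linear subspace of `L²`. -/
def toSubmodule (h : IsDirichletForm μ F E) : Submodule ℝ (Lp ℝ 2 μ) where
  carrier := F
  zero_mem' := h.zero_mem
  add_mem' hu hv := h.add_mem _ hu _ hv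
  smul_mem' c _ hu := h.smul_mem c _ hu

/-- The domain of a Dirichlet form, with the inner product `E₁ = E + (·,·)`. -/
def Domain (h : IsDirichletForm μ F E) : Type _ := h.toSubmodule

instance (h : IsDirichletForm μ F E) : AddCommGroup h.Domain :=
  inferInstanceAs (AddCommGroup h.toSubmodule)

instance (h : IsDirichletForm μ F E) : Module ℝ h.Domain :=
  inferInstanceAs (Module ℝ h.toSubmodule)

/-- The inclusion of the domain of a Dirichlet form. -/
def inclusion (h : IsDirichletForm μ F E) : h.Domain →ₗ[ℝ] Lp ℝ 2 μ := h.toSubmodule.subtype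

theorem inclusion_mem (h : IsDirichletForm μ F E) (u : h.Domain) : h.inclusion u ∈ F :=
  Subtype.property (p := (· ∈ h.toSubmodule)) u

theorem exists_inclusion_eq (h : IsDirichletForm μ F E) {u : Lp ℝ 2 μ} (hu : u ∈ F) :
    ∃ v : h.Domain, h.inclusion v = u :=
  ⟨(⟨u, hu⟩ : h.toSubmodule), rfl⟩

/-- The inner product `E₁`. -/
abbrev core (h : IsDirichletForm μ F E) : InnerProductSpace.Core ℝ h.Domain where
  inner u v := E (h.inclusion u) (h.inclusion v) + inner ℝ (h.inclusion u) (h.inclusion v)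
  conj_inner_symm u v := by
    simp only [conj_trivial]
    rw [h.symm _ (h.inclusion_mem v) _ (h.inclusion_mem u), real_inner_comm]
  re_inner_nonneg u := by
    simpa using add_nonneg (h.nonneg _ (h.inclusion_mem u))
      (real_inner_self_nonneg (x := h.inclusion u))
  add_left u v w := by
    rw [map_add, h.add_left _ (h.inclusion_mem u) _ (h.inclusion_mem v) _ (h.inclusion_mem w),
      inner_add_left]
    ring
  smul_left u v c := by
    rw [map_smul, h.smul_left _ _ (h.inclusion_mem u) _ (h.inclusion_mem v), real_inner_smul_left]
    simp only [conj_trivial]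
    ring
  definite u hu := by
    have h1 := h.nonneg _ (h.inclusion_mem u)
    have h2 := real_inner_self_nonneg (x := h.inclusion u)
    have h3 : inner ℝ (h.inclusion u) (h.inclusion u) = 0 := by linarith
    rw [inner_self_eq_zero] at h3
    exact Subtype.ext h3

instance (h : IsDirichletForm μ F E) : NormedAddCommGroup h.Domain := h.core.toNormedAddCommGroup

instance (h : IsDirichletForm μ F E) : InnerProductSpace ℝ h.Domain :=
  InnerProductSpace.ofCore h.core.toCore

theorem inner_domain (h : IsDirichletForm μ F E) (u v : h.Domain) :
    inner ℝ u v = E (h.inclusion u) (h.inclusion v) + inner ℝ (h.inclusion u) (h.inclusion v) :=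
  rfl

theorem norm_sq_domain (h : IsDirichletForm μ F E) (u : h.Domain) :
    ‖u‖ ^ 2 = E (h.inclusion u) (h.inclusion u) + ‖h.inclusion u‖ ^ 2 := by
  rw [← real_inner_self_eq_norm_sq, inner_domain, real_inner_self_eq_norm_sq]

instance (h : IsDirichletForm μ F E) : CompleteSpace h.Domain := by
  refine Metric.complete_of_cauchySeq_tendsto fun u hu => ?_
  have hc : Tendsto (fun p : ℕ × ℕ => ‖u p.1 - u p.2‖ ^ 2) atTop (𝓝 0) := by
    have h1 := cauchySeq_iff_tendsto_dist_atTop_0.1 hu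
    simp_rw [dist_eq_norm] at h1
    simpa using h1.pow 2
  obtain ⟨v, hv, hlim⟩ := h.closed (fun n => h.inclusion (u n)) (fun n => h.inclusion_mem _) (by
    simpa only [norm_sq_domain, map_sub] using hc)
  obtain ⟨v, rfl⟩ := h.exists_inclusion_eq hv
  refine ⟨v, ?_⟩
  rw [tendsto_iff_norm_sub_tendsto_zero]
  simp_rw [← map_sub, ← norm_sq_domain] at hlim
  simpa using hlim.sqrt

/-- The inclusion of the domain of a Dirichlet form is continuous. -/
def inclusionL (h : IsDirichletForm μ F E) : h.Domain →L[ℝ] Lp ℝ 2 μ :=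
  h.inclusion.mkContinuous 1 fun u => by
    rw [one_mul]
    refine (abs_le_of_sq_le_sq' ?_ (norm_nonneg _)).2
    rw [norm_sq_domain]
    linarith [h.nonneg _ (h.inclusion_mem u)]

/-- The resolvent `(1 - A)⁻¹` of a Dirichlet form. -/
def resolvent (h : IsDirichletForm μ F E) : Lp ℝ 2 μ →L[ℝ] Lp ℝ 2 μ :=
  -- The adjoint is taken for `E₁` on the domain, so it sends `f` to the Riesz representative of `v
  -- ↦ (f, v)`.
  h.inclusionL ∘L (ContinuousLinearMap.adjoint h.inclusionL)

theorem resolvent_mem (h : IsDirichletForm μ F E) (f : Lp ℝ 2 μ) : h.resolvent f ∈ F :=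
  h.inclusion_mem _

theorem resolvent_spec (h : IsDirichletForm μ F E) (f : Lp ℝ 2 μ) {v : Lp ℝ 2 μ} (hv : v ∈ F) :
    E (h.resolvent f) v + inner ℝ (h.resolvent f) v = inner ℝ f v := by
  obtain ⟨v, rfl⟩ := h.exists_inclusion_eq hv
  exact ContinuousLinearMap.adjoint_inner_left h.inclusionL v f

theorem eq_zero_of_form_add_inner (h : IsDirichletForm μ F E) {u : Lp ℝ 2 μ} (hu : u ∈ F)
    (h0 : E u u + inner ℝ u u ≤ 0) : u = 0 := by
  have h1 := h.nonneg u hu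
  have h2 := real_inner_self_nonneg (x := u)
  exact inner_self_eq_zero.1 (show inner ℝ u u = 0 by linarith)

theorem resolvent_eq (h : IsDirichletForm μ F E) {f u : Lp ℝ 2 μ} (hu : u ∈ F)
    (huv : ∀ v ∈ F, E u v + inner ℝ u v = inner ℝ f v) : h.resolvent f = u := by
  have hm := h.sub_mem (h.resolvent_mem f) hu
  refine sub_eq_zero.1 (h.eq_zero_of_form_add_inner hm ?_)
  rw [h.sub_left (h.resolvent_mem f) hu hm]
  have h1 := h.resolvent_spec f hm
  have h2 := huv _ hm
  rw [inner_sub_left]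
  linarith

theorem resolvent_norm_le (h : IsDirichletForm μ F E) : ‖h.resolvent‖ ≤ 1 := by
  refine ContinuousLinearMap.opNorm_le_bound _ zero_le_one fun f => ?_
  rw [one_mul]
  have h1 := h.resolvent_spec f (h.resolvent_mem f)
  have h2 := h.nonneg _ (h.resolvent_mem f)
  have h3 := real_inner_le_norm f (h.resolvent f)
  rw [real_inner_self_eq_norm_sq] at h1
  rcases (norm_nonneg (h.resolvent f)).eq_or_lt with h0 | h0
  · rw [← h0]; exact norm_nonneg _
  · exact le_of_mul_le_mul_right (by nlinarith) h0

theorem resolvent_symm (h : IsDirichletForm μ F E) (f g : Lp ℝ 2 μ) :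
    inner ℝ (h.resolvent f) g = inner ℝ f (h.resolvent g) := by
  rw [← h.resolvent_spec f (h.resolvent_mem g), real_inner_comm,
    ← h.resolvent_spec g (h.resolvent_mem f), h.symm _ (h.resolvent_mem f) _ (h.resolvent_mem g),
    real_inner_comm]

/-- If `f` is orthogonal to the range, then `E₁(R f, R f) = (f, R f) = 0`, so `R f = 0` and `(f, v)
= E₁(R f, v) = 0` for every `v` in the dense set `F`. -/
theorem resolvent_denseRange (h : IsDirichletForm μ F E) : DenseRange h.resolvent := by
  have : (LinearMap.range h.resolvent.toLinearMap).topologicalClosure = ⊤ := by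
    rw [Submodule.topologicalClosure_eq_top_iff, Submodule.eq_bot_iff]
    intro f hf
    have h1 : inner ℝ (h.resolvent f) f = 0 :=
      (Submodule.mem_orthogonal _ _).1 hf _ ⟨f, rfl⟩
    have h2 := h.resolvent_spec f (h.resolvent_mem f)
    have h3 : h.resolvent f = 0 := by
      refine h.eq_zero_of_form_add_inner (h.resolvent_mem f) ?_
      rw [h2, real_inner_comm, h1]
    have h4 : ∀ v ∈ F, inner ℝ f v = 0 := fun v hv => by
      have h5 := h.resolvent_spec f hv
      have h6 := h.smul_left 0 0 h.zero_mem v hv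
      rw [h3, inner_zero_left] at h5
      rw [zero_smul, zero_mul] at h6
      linarith
    exact h.dense.eq_zero_of_inner_left (𝕜 := ℝ) fun v hv => h4 v hv
  rw [DenseRange, dense_iff_closure_eq]
  exact congrArg (fun S : Submodule ℝ (Lp ℝ 2 μ) => (S : Set (Lp ℝ 2 μ))) this

/-- With `u = R f` and `v = u ⊔ 0`, the bound `E₁(v, v) ≤ E₁(u, u)` yields `E₁(v - u, v - u) ≤ -2
E₁(u, v - u) = -2 (f, v - u) ≤ 0`, so `v = u`. -/
theorem resolvent_nonneg (h : IsDirichletForm μ F E)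
    (hpos : ∀ u ∈ F, u ⊔ 0 ∈ F ∧ E (u ⊔ 0) (u ⊔ 0) ≤ E u u) {f : Lp ℝ 2 μ} (hf : 0 ≤ f) :
    0 ≤ h.resolvent f := by
  set u := h.resolvent f with hu
  have hum : u ∈ F := h.resolvent_mem f
  obtain ⟨hvm, hv⟩ := hpos u hum
  set v := u ⊔ 0 with hvdef
  have hvu : 0 ≤ v - u := sub_nonneg.2 le_sup_left
  have hm := h.sub_mem hvm hum
  have h1 : inner ℝ v v ≤ inner ℝ u u := by
    rw [real_inner_self_eq_norm_sq, real_inner_self_eq_norm_sq]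
    have : ‖v‖ ≤ ‖u‖ := by
      refine norm_le_norm_of_abs_le_abs ?_
      rw [abs_of_nonneg (le_sup_right : 0 ≤ v)]
      exact sup_le (le_abs_self u) (abs_nonneg u)
    gcongr
  have h2 := inner_nonneg_of_nonneg hf hvu
  have h3 := h.resolvent_spec f hm
  rw [← hu] at h3
  have h4 : v - u = 0 := by
    refine h.eq_zero_of_form_add_inner hm ?_
    rw [h.sub_left hvm hum hm, h.sub_right hvm hum hvm, h.sub_right hvm hum hum,
      h.symm v hvm u hum, inner_sub_left, inner_sub_right, inner_sub_right, real_inner_comm u v]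
    rw [h.sub_right hvm hum hum, inner_sub_right] at h3
    linarith
  rw [← sub_eq_zero.1 h4]
  exact le_sup_right

/-- The resolvent of the form `(n + 1)⁻¹ E` is `(1 - A / (n + 1))⁻¹`, so scaling turns the single
construction `resolvent` into the whole family required by `IsResolventFamily`. -/
theorem smul_form (h : IsDirichletForm μ F E) {c : ℝ} (hc : 0 < c) :
    IsDirichletForm μ F fun u v => c * E u v where
  zero_mem := h.zero_mem
  add_mem := h.add_mem
  smul_mem := h.smul_mem
  dense := h.dense
  symm u hu v hv := by rw [h.symm u hu v hv]
  add_left u hu v hv w hw := by rw [h.add_left u hu v hv w hw, mul_add]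
  smul_left a u hu v hv := by rw [h.smul_left a u hu v hv]; ring
  nonneg u hu := mul_nonneg hc.le (h.nonneg u hu)
  closed u hu ht := by
    obtain ⟨v, hv, hlim⟩ := h.closed u hu (by
      refine squeeze_zero (fun p => add_nonneg (h.nonneg _ (h.sub_mem (hu _) (hu _)))
        (sq_nonneg _)) (fun p => ?_) (g := fun p => (c⁻¹ + 1) * (c * E (u p.1 - u p.2)
          (u p.1 - u p.2) + ‖u p.1 - u p.2‖ ^ 2)) (by simpa using ht.const_mul (c⁻¹ + 1))
      have h1 := h.nonneg _ (h.sub_mem (hu p.1) (hu p.2))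
      have h2 : c⁻¹ * (c * E (u p.1 - u p.2) (u p.1 - u p.2)) = E (u p.1 - u p.2) (u p.1 - u p.2) := by
        field_simp
      have h3 : 0 ≤ c⁻¹ * ‖u p.1 - u p.2‖ ^ 2 := by positivity
      have h4 : 0 ≤ c * E (u p.1 - u p.2) (u p.1 - u p.2) := by positivity
      linarith)
    refine ⟨v, hv, squeeze_zero (fun n => add_nonneg (mul_nonneg hc.le
      (h.nonneg _ (h.sub_mem (hu _) hv))) (sq_nonneg _)) (fun n => ?_)
      (g := fun n => (c + 1) * (E (u n - v) (u n - v) + ‖u n - v‖ ^ 2))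
      (by simpa using hlim.const_mul (c + 1))⟩
    have h1 := h.nonneg _ (h.sub_mem (hu n) hv)
    have h3 : 0 ≤ c * ‖u n - v‖ ^ 2 := by positivity
    linarith
  markov u hu v hv := by
    obtain ⟨h1, h2⟩ := h.markov u hu v hv
    exact ⟨h1, by gcongr⟩

/-- The resolvents `(1 - A / (n + 1))⁻¹` of a Dirichlet form. -/
def resolventSeq (h : IsDirichletForm μ F E) (n : ℕ) : Lp ℝ 2 μ →L[ℝ] Lp ℝ 2 μ :=
  (h.smul_form (c := ((n : ℝ) + 1)⁻¹) (by positivity)).resolvent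

theorem isResolventFamily (h : IsDirichletForm μ F E) :
    IsResolventFamily (fun u w => u ∈ F ∧ ∀ v ∈ F, E u v = -inner ℝ w v) h.resolventSeq where
  norm_le n := resolvent_norm_le _
  symm n := resolvent_symm _
  graph n u w := by
    have hn : (0 : ℝ) < (n : ℝ) + 1 := by positivity
    constructor
    · rintro ⟨hu, hw⟩
      refine resolvent_eq _ hu fun v hv => ?_
      rw [hw v hv, inner_sub_left, real_inner_smul_left]
      ring
    · intro hu
      have hm : u ∈ F := by rw [← hu]; exact resolvent_mem _ _
      refine ⟨hm, fun v hv => ?_⟩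
      have h1 := (h.smul_form (c := ((n : ℝ) + 1)⁻¹) (by positivity)).resolvent_spec
        (u - ((n : ℝ) + 1)⁻¹ • w) hv
      rw [show (h.smul_form (c := ((n : ℝ) + 1)⁻¹) (by positivity)).resolvent
        (u - ((n : ℝ) + 1)⁻¹ • w) = u from hu, inner_sub_left, real_inner_smul_left] at h1
      have h2 : ((n : ℝ) + 1)⁻¹ * E u v = ((n : ℝ) + 1)⁻¹ * -inner ℝ w v := by linarith
      exact mul_left_cancel₀ (inv_ne_zero hn.ne') h2
  dense := resolvent_denseRange _

/-- The semigroup of a Dirichlet form exists, inherits the positivity of the resolvents, and fixes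
the elements on which the form vanishes. -/
theorem exists_semigroup (h : IsDirichletForm μ F E) :
    ∃ T : ℝ → Lp ℝ 2 μ →L[ℝ] Lp ℝ 2 μ, IsSemigroupOf μ F E T ∧ T 0 = 1 ∧
      ((∀ u ∈ F, u ⊔ 0 ∈ F ∧ E (u ⊔ 0) (u ⊔ 0) ≤ E u u) → ∀ t, 0 ≤ t → ∀ f, 0 ≤ f → 0 ≤ T t f) ∧
      ∀ u ∈ F, (∀ v ∈ F, E u v = 0) → ∀ t, 0 ≤ t → T t u = u := by
  have hR := h.isResolventFamily
  obtain ⟨T, hT⟩ := hR.exists_limit_semigroup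
  refine ⟨T, ⟨fun s t hs ht => hR.limit_add hT hs.le ht.le, fun t ht => ?_,
    fun t ht => hR.limit_symm hT ht.le, hR.limit_tendsto_zero hT, hR.graph_iff_tendsto hT⟩,
    ?_, fun hpos t ht f hf => ?_, fun u hu h0 t ht => ?_⟩
  · exact ContinuousLinearMap.opNorm_le_bound _ zero_le_one fun u => by
      simpa using hR.limit_norm_apply_le hT ht.le u
  · ext1 u
    refine tendsto_nhds_unique (hT 0 le_rfl u) ?_
    simp [yosidaExp]
  · refine ge_of_tendsto (hT t ht f) (.of_forall fun n => ?_)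
    refine yosidaExp_apply_mem (C := {g : Lp ℝ 2 μ | 0 ≤ g}) isClosed_Ici
      (fun u hu v hv => Set.mem_ofPred.2 (add_nonneg (Set.mem_ofPred.1 hu) (Set.mem_ofPred.1 hv))) (fun c hc u hu => ?_) (fun g hg => ?_) ht hf
    · change 0 ≤ c • u
      rw [← Lp.coeFn_nonneg]
      filter_upwards [Lp.coeFn_smul c u, (Lp.coeFn_nonneg u).2 hu] with x h1 h2
      rw [h1]
      exact mul_nonneg hc h2
    · refine resolvent_nonneg _ (fun u hu => ⟨(hpos u hu).1, ?_⟩) hg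
      have := (hpos u hu).2
      gcongr
  -- Here `A u = 0`, and the first-order estimate `‖T t u - u‖ ≤ t ‖A u‖` forces equality.
  · have := hR.limit_norm_sub_le hT ht (w := 0) ⟨hu, by simpa using h0⟩
    rw [norm_zero, mul_zero] at this
    exact sub_eq_zero.1 (norm_le_zero_iff.1 this)

end IsDirichletForm

end FormSemigroup

/-! ### Recurrence of conservative forms on finite measure spaces -/

section Recurrence

variable {X : Type*} [MeasurableSpace X] {μ : Measure X}

theorem Lp_smul_nonneg {p : ℝ≥0∞} {c : ℝ} (hc : 0 ≤ c) {u : Lp ℝ p μ} (hu : 0 ≤ u) :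
    0 ≤ c • u := by
  rw [← Lp.coeFn_nonneg]
  filter_upwards [Lp.coeFn_smul c u, (Lp.coeFn_nonneg u).2 hu] with x h1 h2
  rw [h1]
  exact mul_nonneg hc h2

instance isOrderedModule_Lp {p : ℝ≥0∞} : IsOrderedModule ℝ (Lp ℝ p μ) :=
  .of_smul_nonneg fun _ hc _ hu => Lp_smul_nonneg hc hu

variable [IsFiniteMeasure μ]

variable (μ) in
/-- The constant function `1` in `L²`. -/
def oneL2 : Lp ℝ 2 μ := Lp.const 2 μ (1 : ℝ)

theorem coeFn_oneL2 : oneL2 μ =ᵐ[μ] fun _ => (1 : ℝ) := Lp.coeFn_const 2 μ (1 : ℝ)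

theorem inner_oneL2 (f : Lp ℝ 2 μ) : inner ℝ (oneL2 μ) f = ∫ x, f x ∂μ := by
  rw [L2.inner_def]
  refine integral_congr_ae ?_
  filter_upwards [coeFn_oneL2 (μ := μ)] with x hx
  simp [hx]

theorem integrable_L2 (f : Lp ℝ 2 μ) : Integrable f μ :=
  ((Lp.memLp f).mono_exponent one_le_two).integrable le_rfl

theorem oneL2_nonneg : 0 ≤ oneL2 μ := by
  rw [← Lp.coeFn_nonneg]
  filter_upwards [coeFn_oneL2 (μ := μ)] with x hx
  simp [hx]

theorem eq_zero_of_inner_oneL2 {f : Lp ℝ 2 μ} (hf : 0 ≤ f) (h : inner ℝ (oneL2 μ) f = 0) :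
    f = 0 := by
  rw [inner_oneL2, integral_eq_zero_iff_of_nonneg_ae ((Lp.coeFn_nonneg f).2 hf)
    (integrable_L2 f)] at h
  exact (Lp.eq_zero_iff_ae_eq_zero).2 h

variable (μ) in
/-- The inclusion of `L²` into `L¹`. -/
def toL1 : Lp ℝ 2 μ →ₗ[ℝ] Lp ℝ 1 μ where
  toFun f := ((Lp.memLp f).mono_exponent one_le_two).toLp f
  map_add' f g := by
    ext1
    filter_upwards [MemLp.coeFn_toLp ((Lp.memLp (f + g)).mono_exponent one_le_two),
      MemLp.coeFn_toLp ((Lp.memLp f).mono_exponent one_le_two),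
      MemLp.coeFn_toLp ((Lp.memLp g).mono_exponent one_le_two), Lp.coeFn_add f g,
      Lp.coeFn_add (((Lp.memLp f).mono_exponent one_le_two).toLp f)
        (((Lp.memLp g).mono_exponent one_le_two).toLp g)] with x h1 h2 h3 h4 h5
    rw [h1, h4, h5, Pi.add_apply, Pi.add_apply, h2, h3]
  map_smul' c f := by
    ext1
    filter_upwards [MemLp.coeFn_toLp ((Lp.memLp (c • f)).mono_exponent one_le_two),
      MemLp.coeFn_toLp ((Lp.memLp f).mono_exponent one_le_two), Lp.coeFn_smul c f,
      Lp.coeFn_smul c (((Lp.memLp f).mono_exponent one_le_two).toLp f)] with x h1 h2 h3 h4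
    rw [h1, h3, RingHom.id_apply, h4, Pi.smul_apply, Pi.smul_apply, h2]

theorem coeFn_toL1 (f : Lp ℝ 2 μ) : toL1 μ f =ᵐ[μ] f :=
  MemLp.coeFn_toLp ((Lp.memLp f).mono_exponent one_le_two)

theorem norm_toL1 (f : Lp ℝ 2 μ) : ‖toL1 μ f‖ = inner ℝ (oneL2 μ) |f| := by
  rw [L1.norm_eq_integral_norm, inner_oneL2]
  refine integral_congr_ae ?_
  filter_upwards [coeFn_toL1 f, Lp.coeFn_abs f] with x h1 h2
  rw [h1, h2, Real.norm_eq_abs]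

theorem denseRange_toL1 : DenseRange (toL1 μ) := by
  refine (Lp.simpleFunc.denseRange (E := ℝ) (μ := μ) (p := 1) ENNReal.one_ne_top).mono ?_
  rintro _ ⟨s, rfl⟩
  have hs := SimpleFunc.memLp_of_isFiniteMeasure (Lp.simpleFunc.toSimpleFunc s) 2 μ
  refine ⟨hs.toLp _, ?_⟩
  ext1
  filter_upwards [coeFn_toL1 (hs.toLp _), hs.coeFn_toLp, Lp.simpleFunc.toSimpleFunc_eq_toFun s]
    with x h1 h2 h3
  rw [h1, h2, h3]

/-- A strongly continuous semigroup of symmetric positive contractions that fixes `1`. -/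
structure IsConservativeSemigroup (T : ℝ → Lp ℝ 2 μ →L[ℝ] Lp ℝ 2 μ) : Prop where
  zero : T 0 = 1
  add : ∀ s t : ℝ, 0 ≤ s → 0 ≤ t → T (s + t) = (T s).comp (T t)
  contraction : ∀ t : ℝ, 0 ≤ t → ‖T t‖ ≤ 1
  symm : ∀ t : ℝ, 0 ≤ t → ∀ f g : Lp ℝ 2 μ, inner ℝ (T t f) g = inner ℝ f (T t g)
  continuous : ∀ f : Lp ℝ 2 μ, Tendsto (fun t => T t f) (𝓝[>] 0) (𝓝 f)
  nonneg : ∀ t : ℝ, 0 ≤ t → ∀ f, 0 ≤ f → 0 ≤ T t f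
  map_one : ∀ t : ℝ, 0 ≤ t → T t (oneL2 μ) = oneL2 μ

namespace IsConservativeSemigroup

variable {T : ℝ → Lp ℝ 2 μ →L[ℝ] Lp ℝ 2 μ} (h : IsConservativeSemigroup T)
include h

theorem norm_apply_le {t : ℝ} (ht : 0 ≤ t) (f : Lp ℝ 2 μ) : ‖T t f‖ ≤ ‖f‖ := by
  simpa using (T t).le_of_opNorm_le (h.contraction t ht) f

theorem norm_sub_le {s t : ℝ} (hs : 0 ≤ s) (ht : 0 ≤ t) (f : Lp ℝ 2 μ) :
    ‖T s f - T t f‖ ≤ ‖T |s - t| f - f‖ := by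
  wlog hst : t ≤ s generalizing s t
  · rw [norm_sub_rev, abs_sub_comm]
    exact this ht hs (le_of_not_ge hst)
  have h1 := h.add t (s - t) ht (sub_nonneg.2 hst)
  rw [add_sub_cancel] at h1
  rw [abs_of_nonneg (sub_nonneg.2 hst), h1, ContinuousLinearMap.comp_apply, ← map_sub]
  exact h.norm_apply_le ht _

/-- The semigroup law and contractivity reduce continuity at `s` to right continuity at `0`. This is
what makes the Bochner integrals `∫₀ᵗ T_s f ds` meaningful. -/
theorem continuousOn (f : Lp ℝ 2 μ) : ContinuousOn (fun s => T s f) (Set.Ici 0) := by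
  have h0 : Tendsto (fun t => ‖T t f - f‖) (𝓝[≥] 0) (𝓝 0) := by
    rw [← tendsto_iff_norm_sub_tendsto_zero, ← Set.Ioi_insert, nhdsWithin_insert]
    refine Tendsto.sup ?_ (h.continuous f)
    rw [tendsto_pure_left, h.zero]
    exact fun s hs => mem_of_mem_nhds hs
  intro s hs
  rw [ContinuousWithinAt, tendsto_iff_norm_sub_tendsto_zero]
  have h1 : Tendsto (fun t : ℝ => |t - s|) (𝓝[≥] s ⊔ 𝓝[Set.Ici 0] s) (𝓝[≥] 0) := by
    refine tendsto_nhdsWithin_iff.2 ⟨?_, .of_forall fun t => Set.mem_Ici.2 (abs_nonneg _)⟩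
    have : Tendsto (fun t : ℝ => |t - s|) (𝓝 s) (𝓝 |s - s|) :=
      (continuous_abs.comp (continuous_id.sub continuous_const)).tendsto s
    simp only [sub_self, abs_zero] at this
    exact this.mono_left (sup_le nhdsWithin_le_nhds nhdsWithin_le_nhds)
  refine squeeze_zero' (.of_forall fun _ => norm_nonneg _) ?_ (h0.comp (h1.mono_left le_sup_right))
  filter_upwards [self_mem_nhdsWithin] with t ht
  exact h.norm_sub_le ht hs f

theorem intervalIntegrable (f : Lp ℝ 2 μ) {a b : ℝ} (ha : 0 ≤ a) (hb : 0 ≤ b) :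
    IntervalIntegrable (fun s => T s f) volume a b := by
  refine ((h.continuousOn f).mono fun s hs => ?_).intervalIntegrable
  exact (le_min ha hb).trans hs.1

theorem integral_add_apply {t : ℝ} (ht : 0 ≤ t) (f g : Lp ℝ 2 μ) :
    ∫ s in (0 : ℝ)..t, T s (f + g) = (∫ s in (0 : ℝ)..t, T s f) + ∫ s in (0 : ℝ)..t, T s g := by
  simp_rw [map_add]
  exact intervalIntegral.integral_add (h.intervalIntegrable f le_rfl ht)
    (h.intervalIntegrable g le_rfl ht)

theorem integral_nonneg {t : ℝ} (ht : 0 ≤ t) {f : Lp ℝ 2 μ} (hf : 0 ≤ f) :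
    0 ≤ ∫ s in (0 : ℝ)..t, T s f := by
  rw [intervalIntegral.integral_of_le ht]
  refine integral_nonneg_of_ae ?_
  filter_upwards [ae_restrict_mem measurableSet_Ioc] with s hs
  exact h.nonneg s hs.1.le f hf

theorem integral_sub_apply {t : ℝ} (ht : 0 ≤ t) (f g : Lp ℝ 2 μ) :
    ∫ s in (0 : ℝ)..t, T s (f - g) = (∫ s in (0 : ℝ)..t, T s f) - ∫ s in (0 : ℝ)..t, T s g := by
  simp_rw [map_sub]
  exact intervalIntegral.integral_sub (h.intervalIntegrable f le_rfl ht)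
    (h.intervalIntegrable g le_rfl ht)

theorem integral_le_abs {t : ℝ} (ht : 0 ≤ t) (f : Lp ℝ 2 μ) :
    |∫ s in (0 : ℝ)..t, T s f| ≤ ∫ s in (0 : ℝ)..t, T s |f| := by
  have h1 := h.integral_nonneg ht (sub_nonneg.2 (le_abs_self f))
  have h2 := h.integral_nonneg ht (f := |f| + f) (by
    rw [← neg_le_iff_add_nonneg]; exact neg_le_abs f)
  rw [h.integral_sub_apply ht] at h1
  rw [h.integral_add_apply ht] at h2
  refine abs_le'.2 ⟨sub_nonneg.1 h1, ?_⟩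
  rwa [← neg_le_iff_add_nonneg] at h2

theorem inner_one_integral {t : ℝ} (ht : 0 ≤ t) (f : Lp ℝ 2 μ) :
    inner ℝ (oneL2 μ) (∫ s in (0 : ℝ)..t, T s f) = t * inner ℝ (oneL2 μ) f := by
  have h1 := (innerSL ℝ (oneL2 μ)).intervalIntegral_comp_comm
    (h.intervalIntegrable f le_rfl ht)
  simp only [innerSL_apply_apply] at h1
  rw [← h1, intervalIntegral.integral_congr (g := fun _ => inner ℝ (oneL2 μ) f)]
  · simp
  · intro s hs
    rw [Set.uIcc_of_le ht] at hs
    simp only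
    rw [← h.symm s hs.1, h.map_one s hs.1]

/-- The operator `f ↦ ∫₀ᵗ T_s f ds`, with values in `L¹`. -/
theorem exists_linearMap (t : ℝ) : ∃ L : Lp ℝ 2 μ →ₗ[ℝ] Lp ℝ 1 μ, 0 ≤ t →
    ∀ f, L f = toL1 μ (∫ s in (0 : ℝ)..t, T s f) := by
  by_cases ht : 0 ≤ t
  · refine ⟨{ toFun := fun f => toL1 μ (∫ s in (0 : ℝ)..t, T s f), map_add' := fun f g => ?_,
              map_smul' := fun c f => ?_ }, fun _ _ => rfl⟩
    · rw [h.integral_add_apply ht, map_add]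
    · simp_rw [map_smul]
      rw [intervalIntegral.integral_smul, map_smul, RingHom.id_apply]
  · exact ⟨0, fun h0 => absurd h0 ht⟩

/-- Positivity replaces `f` by `|f|`, and for `|f|` the total mass is exactly `t ∫ |f|` because
`T_s` is symmetric and fixes `1`. The bound allows the extension to `L¹`. -/
theorem norm_toL1_integral_le {t : ℝ} (ht : 0 ≤ t) (f : Lp ℝ 2 μ) :
    ‖toL1 μ (∫ s in (0 : ℝ)..t, T s f)‖ ≤ t * ‖toL1 μ f‖ := by
  rw [norm_toL1, norm_toL1, ← h.inner_one_integral ht, ← sub_nonneg, ← inner_sub_right]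
  exact inner_nonneg_of_nonneg oneL2_nonneg (sub_nonneg.2 (h.integral_le_abs ht f))

theorem exists_extension : ∃ S : ℝ → Lp ℝ 1 μ →L[ℝ] Lp ℝ 1 μ, ∀ t, 0 ≤ t → ∀ f,
    S t (toL1 μ f) = toL1 μ (∫ s in (0 : ℝ)..t, T s f) := by
  choose L hL using h.exists_linearMap
  refine ⟨fun t => (L t).extendOfNorm (toL1 μ), fun t ht f => ?_⟩
  rw [LinearMap.extendOfNorm_eq denseRange_toL1 ⟨t, fun f => ?_⟩, hL t ht]
  rw [hL t ht]
  exact h.norm_toL1_integral_le ht f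

theorem integral_nat_eq_sum (f : Lp ℝ 2 μ) (N : ℕ) :
    ∫ s in (0 : ℝ)..N, T s f =
      ∑ k ∈ Finset.range N, (T 1)^[k] (∫ s in (0 : ℝ)..1, T s f) := by
  have hiter : ∀ k : ℕ, ∀ g, (T 1)^[k] g = T k g := fun k => by
    induction k with
    | zero => intro g; simp [h.zero]
    | succ k ih =>
      intro g
      rw [Function.iterate_succ_apply', ih, Nat.cast_succ, add_comm (k : ℝ),
        h.add 1 k zero_le_one (Nat.cast_nonneg k)]
      rfl
  have h1 := intervalIntegral.sum_integral_adjacent_intervals (f := fun s => T s f)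
    (μ := volume) (a := fun k : ℕ => (k : ℝ)) (n := N)
    (fun k _ => h.intervalIntegrable f (Nat.cast_nonneg _) (Nat.cast_nonneg _))
  rw [Nat.cast_zero] at h1
  rw [← h1]
  refine Finset.sum_congr rfl fun k _ => ?_
  rw [hiter, ← (T k).intervalIntegral_comp_comm (h.intervalIntegrable f le_rfl zero_le_one)]
  have h2 := intervalIntegral.integral_comp_add_right (a := 0) (b := 1) (fun s => T s f) (k : ℝ)
  rw [zero_add, add_comm (1 : ℝ)] at h2
  rw [Nat.cast_succ, ← h2]
  refine intervalIntegral.integral_congr fun s hs => ?_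
  rw [Set.uIcc_of_le zero_le_one] at hs
  rw [add_comm, h.add k s (Nat.cast_nonneg k) hs.1]
  rfl

theorem iterate_nonneg {g : Lp ℝ 2 μ} (hg : 0 ≤ g) (k : ℕ) : 0 ≤ (T 1)^[k] g := by
  induction k with
  | zero => simpa using hg
  | succ k ih => rw [Function.iterate_succ_apply']; exact h.nonneg 1 zero_le_one _ ih

theorem mono {t : ℝ} (ht : 0 ≤ t) {f g : Lp ℝ 2 μ} (hfg : f ≤ g) : T t f ≤ T t g := by
  have := h.nonneg t ht _ (sub_nonneg.2 hfg)
  rwa [map_sub, sub_nonneg] at this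

/-- Positivity gives `T 1 (p ⊓ 1) ≤ p ⊓ 1`, and both sides have the same integral since `T 1` is
symmetric and fixes `1`. -/
theorem map_inf_one {p : Lp ℝ 2 μ} (hp : T 1 p = p) : T 1 (p ⊓ oneL2 μ) = p ⊓ oneL2 μ := by
  have hle : T 1 (p ⊓ oneL2 μ) ≤ p ⊓ oneL2 μ := by
    refine le_inf ?_ ?_
    · exact (h.mono zero_le_one inf_le_left).trans_eq hp
    · exact (h.mono zero_le_one inf_le_right).trans_eq (h.map_one 1 zero_le_one)
  refine (sub_eq_zero.1 (eq_zero_of_inner_oneL2 (sub_nonneg.2 hle) ?_)).symm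
  rw [inner_sub_right, ← h.symm 1 zero_le_one, h.map_one 1 zero_le_one, sub_self]

theorem inner_iterate {q : Lp ℝ 2 μ} (hq : T 1 q = q) (g : Lp ℝ 2 μ) (k : ℕ) :
    inner ℝ ((T 1)^[k] g) q = inner ℝ g q := by
  induction k with
  | zero => simp
  | succ k ih => rw [Function.iterate_succ_apply', h.symm 1 zero_le_one, hq, ih]

/-- The mean ergodic theorem: `p` is the orthogonal projection of `g` onto the fixed space, whence
the last clause. -/
theorem exists_fixed_limit (g : Lp ℝ 2 μ) : ∃ p, T 1 p = p ∧
    Tendsto (fun N : ℕ => (N : ℝ)⁻¹ • ∑ k ∈ Finset.range N, (T 1)^[k] g) atTop (𝓝 p) ∧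
    ∀ q, T 1 q = q → inner ℝ g q = inner ℝ p q := by
  set K := ((T 1 : Lp ℝ 2 μ →ₗ[ℝ] Lp ℝ 2 μ)).eqLocus
    ((1 : Lp ℝ 2 μ →L[ℝ] Lp ℝ 2 μ) : Lp ℝ 2 μ →ₗ[ℝ] Lp ℝ 2 μ) with hK
  have h1 := (T 1).tendsto_birkhoffAverage_orthogonalProjection (h.contraction 1 zero_le_one) g
  refine ⟨_, ?_, h1, fun q hq => ?_⟩
  · exact (K.orthogonalProjectionOnto g).2
  · have h2 := Submodule.inner_orthogonalProjectionOnto_eq_of_mem_left (K := K) ⟨q, hq⟩ g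
    rw [real_inner_comm, real_inner_comm q]
    exact h2.symm

/-- The orbit of a nonnegative function vanishes where its ergodic limit does. -/
theorem iterate_ae_eq_zero {g p : Lp ℝ 2 μ} (hg : 0 ≤ g) (hp0 : 0 ≤ p) (hp : T 1 p = p)
    (hgp : ∀ q, T 1 q = q → inner ℝ g q = inner ℝ p q) (k : ℕ) :
    ∀ᵐ x ∂μ, p x = 0 → ((T 1)^[k] g) x = 0 := by
  set v := (T 1)^[k] g
  have hv0 : 0 ≤ v := h.iterate_nonneg hg k
  have hv : Integrable v μ := integrable_L2 v
  have hpm : MeasurableSet {x | p x = 0} :=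
    (Lp.stronglyMeasurable p).measurable (measurableSet_singleton 0)
  have hle : ∀ n : ℕ, ∫ x in {x | p x = 0}, v x ∂μ ≤ ((n : ℝ) + 1)⁻¹ * μ.real Set.univ := fun n => by
    -- This fixed function satisfies `0 ≤ q ≤ 1`, equals `1` where `p = 0`, and vanishes where `p ≥
    -- 1 / (n + 1)`, so that `p q ≤ 1 / (n + 1)`. Pairing it with `v` is the same as pairing it with
    -- `p`.
    set q := oneL2 μ - (((n : ℝ) + 1) • p) ⊓ oneL2 μ with hqdef
    have hq : T 1 q = q := by
      rw [map_sub, h.map_one 1 zero_le_one, h.map_inf_one]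
      rw [map_smul, hp]
    have hqx : ∀ᵐ x ∂μ, q x = 1 - min (((n : ℝ) + 1) * p x) 1 := by
      filter_upwards [Lp.coeFn_sub (oneL2 μ) ((((n : ℝ) + 1) • p) ⊓ oneL2 μ),
        Lp.coeFn_inf (((n : ℝ) + 1) • p) (oneL2 μ), Lp.coeFn_smul ((n : ℝ) + 1) p,
        coeFn_oneL2 (μ := μ)] with x h1 h2 h3 h4
      rw [h1, Pi.sub_apply, h2, Pi.inf_apply, h3, h4, Pi.smul_apply, smul_eq_mul]
    have hvq : Integrable (fun x => v x * q x) μ := by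
      have := L2.integrable_inner (𝕜 := ℝ) q v
      simpa using this
    calc ∫ x in {x | p x = 0}, v x ∂μ
        = ∫ x in {x | p x = 0}, v x * q x ∂μ := by
          refine setIntegral_congr_ae hpm ?_
          filter_upwards [hqx] with x hx hx0
          have hx0 : p x = 0 := hx0
          rw [hx, hx0]; simp
      _ ≤ ∫ x, v x * q x ∂μ := by
          refine setIntegral_le_integral hvq ?_
          filter_upwards [hqx, (Lp.coeFn_nonneg v).2 hv0] with x hx hvx
          rw [hx]
          exact mul_nonneg hvx (sub_nonneg.2 (min_le_right _ _))
      _ = inner ℝ p q := by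
          rw [← hgp q hq, ← h.inner_iterate hq g k, L2.inner_def]
          refine integral_congr_ae (.of_forall fun x => ?_)
          simp [v, mul_comm]
      _ ≤ ∫ _, ((n : ℝ) + 1)⁻¹ ∂μ := by
          rw [L2.inner_def]
          refine integral_mono_ae (L2.integrable_inner p q) (integrable_const _) ?_
          filter_upwards [hqx, (Lp.coeFn_nonneg p).2 hp0] with x hx hpx
          have hpx : 0 ≤ p x := hpx
          have hn : (0 : ℝ) < (n : ℝ) + 1 := by positivity
          simp only [RCLike.inner_apply, conj_trivial, hx]
          rcases le_total (((n : ℝ) + 1) * p x) 1 with h1 | h1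
          · have h2 : p x ≤ ((n : ℝ) + 1)⁻¹ := by
              rw [← one_div, le_div_iff₀ hn]; linarith
            rw [min_eq_left h1]
            refine le_trans ?_ h2
            exact mul_le_of_le_one_left hpx (by linarith [mul_nonneg hn.le hpx])
          · rw [min_eq_right h1]; simp; positivity
      _ = ((n : ℝ) + 1)⁻¹ * μ.real Set.univ := by
          rw [integral_const, smul_eq_mul, mul_comm]
  have hzero : ∫ x in {x | p x = 0}, v x ∂μ ≤ 0 := by
    refine ge_of_tendsto' (x := atTop) (f := fun n : ℕ => ((n : ℝ) + 1)⁻¹ * μ.real Set.univ) ?_ hle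
    have := tendsto_one_div_add_atTop_nhds_zero_nat (𝕜 := ℝ)
    simpa using this.mul_const (μ.real Set.univ)
  have hv0' : 0 ≤ᵐ[μ.restrict {x | p x = 0}] v := ae_restrict_of_ae ((Lp.coeFn_nonneg v).2 hv0)
  have h2 := (integral_eq_zero_iff_of_nonneg_ae hv0' hv.integrableOn).1
    (le_antisymm hzero (integral_nonneg_of_ae hv0'))
  exact (ae_restrict_iff' hpm).1 h2

/-- For `0 ≤ f ∈ L²`, the integrals `∫₀ᴺ T_s f ds` vanish or tend to infinity. -/
theorem integral_tendsto_or_eq_zero {f : Lp ℝ 2 μ} (hf : 0 ≤ f) :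
    ∀ᵐ x ∂μ, Tendsto (fun N : ℕ => (∫ s in (0 : ℝ)..N, T s f : Lp ℝ 2 μ) x) atTop atTop ∨
      ∀ N : ℕ, (∫ s in (0 : ℝ)..N, T s f : Lp ℝ 2 μ) x = 0 := by
  set g := ∫ s in (0 : ℝ)..1, T s f
  have hg : 0 ≤ g := h.integral_nonneg zero_le_one hf
  obtain ⟨p, hp, hlim, hgp⟩ := h.exists_fixed_limit g
  have hsum0 : ∀ N : ℕ, 0 ≤ ∑ k ∈ Finset.range N, (T 1)^[k] g := fun N =>
    Finset.sum_nonneg fun k _ => h.iterate_nonneg hg k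
  have hp0 : 0 ≤ p := ge_of_tendsto' hlim fun N =>
    Lp_smul_nonneg (by positivity) (hsum0 N)
  -- Norm convergence gives almost everywhere convergence only along a subsequence; this suffices
  -- because the sums increase in `N`.
  obtain ⟨ns, hns, hae⟩ := (tendstoInMeasure_of_tendsto_Lp hlim).exists_seq_tendsto_ae
  have hsum : ∀ᵐ x ∂μ, ∀ N : ℕ, (∫ s in (0 : ℝ)..N, T s f : Lp ℝ 2 μ) x =
      ∑ k ∈ Finset.range N, ((T 1)^[k] g) x := by
    rw [ae_all_iff]
    intro N
    rw [h.integral_nat_eq_sum f N]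
    filter_upwards [Lp.coeFn_finsetSum (Finset.range N) fun k => (T 1)^[k] g] with x hx
    simpa using hx
  have hsmul : ∀ᵐ x ∂μ, ∀ N : ℕ, ((N : ℝ)⁻¹ • ∑ k ∈ Finset.range N, (T 1)^[k] g : Lp ℝ 2 μ) x =
      (N : ℝ)⁻¹ * (∫ s in (0 : ℝ)..N, T s f : Lp ℝ 2 μ) x := by
    rw [ae_all_iff]
    intro N
    rw [h.integral_nat_eq_sum f N]
    filter_upwards [Lp.coeFn_smul ((N : ℝ)⁻¹) (∑ k ∈ Finset.range N, (T 1)^[k] g)] with x hx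
    simpa using hx
  have hnn : ∀ᵐ x ∂μ, ∀ k : ℕ, 0 ≤ ((T 1)^[k] g) x := by
    rw [ae_all_iff]
    exact fun k => (Lp.coeFn_nonneg _).2 (h.iterate_nonneg hg k)
  have hz : ∀ᵐ x ∂μ, ∀ k : ℕ, p x = 0 → ((T 1)^[k] g) x = 0 := by
    rw [ae_all_iff]
    exact h.iterate_ae_eq_zero hg hp0 hp hgp
  filter_upwards [hae, hsum, hsmul, hnn, hz, (Lp.coeFn_nonneg p).2 hp0] with x hx hs hsm hn hzx hpx
  rcases (show 0 ≤ p x from hpx).eq_or_lt with h0 | h0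
  · right
    intro N
    rw [hs]
    exact Finset.sum_eq_zero fun k _ => hzx k h0.symm
  · left
    have hmono : Monotone fun N : ℕ => (∫ s in (0 : ℝ)..N, T s f : Lp ℝ 2 μ) x := by
      refine monotone_nat_of_le_succ fun N => ?_
      rw [hs, hs, Finset.sum_range_succ]
      exact le_add_of_nonneg_right (hn N)
    refine tendsto_atTop_of_monotone_of_subseq hmono (φ := ns) (l := atTop) ?_
    have h1 : Tendsto (fun i => ((ns i : ℕ) : ℝ)) atTop atTop :=
      tendsto_natCast_atTop_atTop.comp hns.tendsto_atTop
    refine (h1.atTop_mul_pos h0 hx).congr' ?_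
    filter_upwards [h1.eventually_gt_atTop 0] with i hi
    rw [hsm, ← mul_assoc, mul_inv_cancel₀ hi.ne', one_mul]
    rfl

end IsConservativeSemigroup

/-- The truncations of a nonnegative integrable function converge in `L¹`. -/
theorem exists_truncation {f : Lp ℝ 1 μ} (hf : 0 ≤ f) : ∃ g : ℕ → Lp ℝ 2 μ, (∀ n, 0 ≤ g n) ∧
    (∀ n, toL1 μ (g n) ≤ f) ∧ Tendsto (fun n => toL1 μ (g n)) atTop (𝓝 f) := by
  have hm : ∀ n : ℕ, MemLp (fun x => min (f x) n) 2 μ := fun n => by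
    refine MemLp.of_bound ((Lp.aestronglyMeasurable f).inf aestronglyMeasurable_const) (n : ℝ) ?_
    filter_upwards [(Lp.coeFn_nonneg f).2 hf] with x hx
    rw [Real.norm_of_nonneg (le_min hx (Nat.cast_nonneg n))]
    exact min_le_right _ _
  have hc : ∀ᵐ x ∂μ, ∀ n, toL1 μ ((hm n).toLp _) x = min (f x) n := by
    rw [ae_all_iff]
    intro n
    filter_upwards [coeFn_toL1 ((hm n).toLp _), (hm n).coeFn_toLp] with x h1 h2
    rw [h1, h2]
  refine ⟨fun n => (hm n).toLp _, fun n => ?_, fun n => ?_, ?_⟩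
  · rw [← Lp.coeFn_nonneg]
    filter_upwards [(Lp.coeFn_nonneg f).2 hf, (hm n).coeFn_toLp] with x hx h1
    rw [h1]
    exact le_min hx (Nat.cast_nonneg n)
  · rw [← Lp.coeFn_le]
    filter_upwards [hc] with x hx
    rw [hx]
    exact min_le_left _ _
  · rw [tendsto_iff_norm_sub_tendsto_zero]
    have hfi : Integrable f μ := L1.integrable_coeFn f
    have h1 : Tendsto (fun n : ℕ => ∫ x, ‖min (f x) n - f x‖ ∂μ) atTop (𝓝 (∫ _, (0 : ℝ) ∂μ)) := by
      refine tendsto_integral_of_dominated_convergence (fun x => ‖f x‖) (fun n => ?_) hfi.norm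
        (fun n => ?_) ?_
      · exact (((Lp.aestronglyMeasurable f).inf aestronglyMeasurable_const).sub
          (Lp.aestronglyMeasurable f)).norm
      · filter_upwards [(Lp.coeFn_nonneg f).2 hf] with x hx
        have hx : 0 ≤ f x := hx
        rw [norm_norm, Real.norm_eq_abs, Real.norm_of_nonneg hx, abs_sub_comm,
          abs_of_nonneg (sub_nonneg.2 (min_le_left _ _))]
        linarith [le_min hx (Nat.cast_nonneg (α := ℝ) n)]
      · refine .of_forall fun x => ?_
        refine tendsto_const_nhds.congr' ?_
        filter_upwards [eventually_ge_atTop ⌈f x⌉₊] with n hn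
        rw [min_eq_left ((Nat.le_ceil _).trans (Nat.cast_le.2 hn)), sub_self, norm_zero]
    rw [integral_zero] at h1
    refine h1.congr fun n => ?_
    rw [L1.norm_eq_integral_norm]
    refine integral_congr_ae ?_
    filter_upwards [hc, Lp.coeFn_sub (toL1 μ ((hm n).toLp _)) f] with x hx h2
    rw [h2, Pi.sub_apply, hx]

/-! ### The extension to `L¹` and the Green function. -/

theorem IsConservativeSemigroup.extension_nonneg {T : ℝ → Lp ℝ 2 μ →L[ℝ] Lp ℝ 2 μ}
    (h : IsConservativeSemigroup T) {S : ℝ → Lp ℝ 1 μ →L[ℝ] Lp ℝ 1 μ}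
    (hS : ∀ t, 0 ≤ t → ∀ f, S t (toL1 μ f) = toL1 μ (∫ s in (0 : ℝ)..t, T s f))
    {t : ℝ} (ht : 0 ≤ t) {f : Lp ℝ 1 μ} (hf : 0 ≤ f) : 0 ≤ S t f := by
  obtain ⟨g, hg, -, hlim⟩ := exists_truncation hf
  refine ge_of_tendsto' (((S t).continuous.tendsto f).comp hlim) fun n => ?_
  rw [Function.comp_apply, hS t ht, ← Lp.coeFn_nonneg]
  filter_upwards [coeFn_toL1 (∫ s in (0 : ℝ)..t, T s (g n)),
    (Lp.coeFn_nonneg _).2 (h.integral_nonneg ht (hg n))] with x h1 h2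
  rw [h1]
  exact h2

/-- The dichotomy is known for each truncation `g n` of `f`. If one of them has divergent integrals
at `x`, so has `f` by monotonicity; if all of them vanish at `x`, then so does each `S N f`, an
almost everywhere limit of `S N (g n)` along a subsequence. -/
theorem IsConservativeSemigroup.green_null {T : ℝ → Lp ℝ 2 μ →L[ℝ] Lp ℝ 2 μ}
    (h : IsConservativeSemigroup T) {S : ℝ → Lp ℝ 1 μ →L[ℝ] Lp ℝ 1 μ}
    (hS : ∀ t, 0 ≤ t → ∀ f, S t (toL1 μ f) = toL1 μ (∫ s in (0 : ℝ)..t, T s f))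
    {f : Lp ℝ 1 μ} (hf : 0 ≤ f) : μ {x | 0 < green S f x ∧ green S f x < ⊤} = 0 := by
  obtain ⟨g, hg, hgf, hlim⟩ := exists_truncation hf
  have hU : ∀ᵐ x ∂μ, ∀ n N : ℕ,
      S N (toL1 μ (g n)) x = (∫ s in (0 : ℝ)..N, T s (g n) : Lp ℝ 2 μ) x := by
    rw [ae_all_iff]; intro n; rw [ae_all_iff]; intro N
    rw [hS N (Nat.cast_nonneg N)]
    exact coeFn_toL1 _
  have hle : ∀ᵐ x ∂μ, ∀ n N : ℕ, S N (toL1 μ (g n)) x ≤ S N f x := by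
    rw [ae_all_iff]; intro n; rw [ae_all_iff]; intro N
    refine (Lp.coeFn_le _ _).2 ?_
    rw [← sub_nonneg, ← map_sub]
    exact h.extension_nonneg hS (Nat.cast_nonneg N) (sub_nonneg.2 (hgf n))
  have hsub : ∀ᵐ x ∂μ, ∀ N : ℕ, ∃ ns : ℕ → ℕ,
      Tendsto (fun i => S N (toL1 μ (g (ns i))) x) atTop (𝓝 (S N f x)) := by
    rw [ae_all_iff]
    intro N
    obtain ⟨ns, -, hae⟩ := (tendstoInMeasure_of_tendsto_Lp
      (((S N).continuous.tendsto f).comp hlim)).exists_seq_tendsto_ae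
    filter_upwards [hae] with x hx
    exact ⟨ns, hx⟩
  have hdich := ae_all_iff.2 fun n => h.integral_tendsto_or_eq_zero (hg n)
  have hmain : ∀ᵐ x ∂μ, ¬ (0 < green S f x ∧ green S f x < ⊤) := by
    filter_upwards [hU, hle, hsub, hdich] with x hUx hlex hsubx hdx
    by_cases hex : ∃ n, Tendsto (fun N : ℕ => (∫ s in (0 : ℝ)..N, T s (g n) : Lp ℝ 2 μ) x)
        atTop atTop
    · obtain ⟨n, hn⟩ := hex
      have h1 : Tendsto (fun N : ℕ => S N f x) atTop atTop :=
        tendsto_atTop_mono (fun N => by rw [← hUx n N]; exact hlex n N) hn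
      have h2 : green S f x = ⊤ := (ENNReal.tendsto_ofReal_atTop.comp h1).limsup_eq
      simp [h2]
    · push Not at hex
      have h0 : ∀ N : ℕ, S N f x = 0 := fun N => by
        obtain ⟨ns, hns⟩ := hsubx N
        refine tendsto_nhds_unique hns (tendsto_const_nhds.congr fun i => ?_)
        rw [hUx, (hdx (ns i)).resolve_left (hex _) N]
      have h2 : green S f x = 0 := by simp [green, h0]
      simp [h2]
  exact measure_eq_zero_iff_ae_notMem.2 hmain

theorem IsDirichletForm.isRecurrent {F : Set (Lp ℝ 2 μ)} {E : Lp ℝ 2 μ → Lp ℝ 2 μ → ℝ}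
    (h : IsDirichletForm μ F E)
    (hpos : ∀ u ∈ F, u ⊔ 0 ∈ F ∧ E (u ⊔ 0) (u ⊔ 0) ≤ E u u)
    (hone : oneL2 μ ∈ F) (hone' : ∀ v ∈ F, E (oneL2 μ) v = 0) : IsRecurrent μ F E := by
  obtain ⟨T, hT, hT0, hTpos, hTfix⟩ := h.exists_semigroup
  have hC : IsConservativeSemigroup T :=
    { zero := hT0
      add := fun s t hs ht => by
        -- `IsSemigroupOf` concerns only positive times; the value `T 0 = 1` settles the endpoint.
        rcases hs.eq_or_lt with rfl | hs
        · rw [zero_add, hT0]; rfl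
        rcases ht.eq_or_lt with rfl | ht
        · rw [add_zero, hT0]; rfl
        exact hT.add s t hs ht
      contraction := fun t ht => by
        rcases ht.eq_or_lt with rfl | ht
        · rw [hT0]; exact ContinuousLinearMap.norm_id_le
        exact hT.contraction t ht
      symm := fun t ht f g => by
        rcases ht.eq_or_lt with rfl | ht
        · rw [hT0]; rfl
        exact hT.symm t ht f g
      continuous := hT.continuous
      nonneg := hTpos hpos
      map_one := hTfix _ hone hone' }
  obtain ⟨S, hS⟩ := hC.exists_extension
  refine ⟨T, S, hT, fun t ht f g hfg => ?_, fun f hf => hC.green_null hS hf⟩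
  have e : f = toL1 μ g := by
    ext1
    filter_upwards [hfg, coeFn_toL1 g] with x h1 h2
    rw [h1, h2]
  rw [e, hS t ht]
  exact coeFn_toL1 _

end Recurrence

/-! ### Weak directional derivatives -/

section WeakDerivative

variable {V : Type*} [NormedAddCommGroup V] [InnerProductSpace ℝ V] [FiniteDimensional ℝ V]
  [MeasurableSpace V] [BorelSpace V] {D U : Set V} {u v φ ψ : V → ℝ}

/-- Local square integrability on `D`. -/
def LocL2 (D : Set V) (u : V → ℝ) : Prop :=
  ∀ K ⊆ D, IsCompact K → MemLp u 2 (volume.restrict K)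

/-- Smooth functions with compact support in `D`. -/
structure IsTest (D : Set V) (φ : V → ℝ) : Prop where
  smooth : ContDiff ℝ ∞ φ
  compact : HasCompactSupport φ
  subset : tsupport φ ⊆ D

theorem IsTest.add (hφ : IsTest D φ) (hψ : IsTest D ψ) : IsTest D (φ + ψ) :=
  ⟨hφ.smooth.add hψ.smooth, hφ.compact.add hψ.compact,
    (tsupport_add φ ψ).trans (Set.union_subset hφ.subset hψ.subset)⟩

theorem IsTest.smul (c : ℝ) (hφ : IsTest D φ) : IsTest D (c • φ) :=
  ⟨hφ.smooth.const_smul c, hφ.compact.smul_left (f := fun _ => c),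
    (tsupport_smul_subset_right (fun _ => c) φ).trans hφ.subset⟩

theorem IsTest.zero : IsTest D (0 : V → ℝ) :=
  ⟨contDiff_const, HasCompactSupport.zero, by simp [tsupport]⟩

theorem IsTest.continuous (hφ : IsTest D φ) : Continuous φ := hφ.smooth.continuous

theorem IsTest.eq_zero (hφ : IsTest D φ) {x : V} (hx : x ∉ D) : φ x = 0 :=
  image_eq_zero_of_notMem_tsupport fun h => hx (hφ.subset h)

theorem IsTest.translate (hφ : IsTest U φ) {a : V} (ha : ∀ x ∈ U, x + a ∈ D) :
    IsTest D (fun x => φ (x - a)) where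
  smooth := hφ.smooth.comp (contDiff_id.sub contDiff_const)
  compact := hφ.compact.comp_homeomorph (Homeomorph.subRight a)
  subset x hx := by
    have h1 : x - a ∈ tsupport φ :=
      tsupport_comp_subset_preimage φ (continuous_id.sub continuous_const) hx
    simpa using ha _ (hφ.subset h1)

theorem IsTest.memLp (hφ : IsTest D φ) (p : ℝ≥0∞) (μ : Measure V) [IsFiniteMeasureOnCompacts μ] :
    MemLp φ p μ :=
  hφ.continuous.memLp_of_hasCompactSupport hφ.compact

theorem IsTest.continuous_fderiv (hφ : IsTest D φ) (h : V) :
    Continuous fun x => fderiv ℝ φ x h :=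
  (hφ.smooth.continuous_fderiv (by simp)).clm_apply continuous_const

theorem LocL2.mono (hu : LocL2 D u) (hUD : U ⊆ D) : LocL2 U u :=
  fun K hK hc => hu K (hK.trans hUD) hc

theorem LocL2.add (hu : LocL2 D u) (hv : LocL2 D v) : LocL2 D (u + v) :=
  fun K hK hc => (hu K hK hc).add (hv K hK hc)

theorem LocL2.sub (hu : LocL2 D u) (hv : LocL2 D v) : LocL2 D (u - v) :=
  fun K hK hc => (hu K hK hc).sub (hv K hK hc)

theorem LocL2.smul (c : ℝ) (hu : LocL2 D u) : LocL2 D (c • u) :=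
  fun K hK hc => (hu K hK hc).const_smul c

theorem LocL2.of_memLp (hu : MemLp u 2 (volume.restrict D)) : LocL2 D u :=
  fun _ hK _ => hu.mono_measure (Measure.restrict_mono hK le_rfl)

theorem LocL2.congr (hu : LocL2 D u) (h : u =ᵐ[volume.restrict D] v) : LocL2 D v :=
  fun K hK hc => (memLp_congr_ae (ae_mono (Measure.restrict_mono hK le_rfl) h)).1 (hu K hK hc)

theorem LocL2.comp_lipschitz (hu : LocL2 D u) {Φ : ℝ → ℝ} (hΦ : LipschitzWith 1 Φ)
    (h0 : Φ 0 = 0) : LocL2 D (Φ ∘ u) :=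
  fun K hK hc => hΦ.comp_memLp h0 (hu K hK hc)

theorem LocL2.translate (hu : LocL2 D u) {a : V} (ha : ∀ x ∈ U, x + a ∈ D) :
    LocL2 U (fun x => u (x + a)) := by
  intro K hK hc
  have hc' : IsCompact ((fun x => x + a) '' K) := hc.image (continuous_id.add continuous_const)
  have h1 := (measurePreserving_add_right (volume : Measure V) a).restrict_preimage
    hc'.measurableSet
  rw [Set.preimage_image_eq _ (add_left_injective a)] at h1
  refine (hu _ ?_ hc').comp_measurePreserving h1
  rintro _ ⟨x, hx, rfl⟩
  exact ha x (hK hx)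

theorem LocL2.locallyIntegrableOn (hD : IsOpen D) (hu : LocL2 D u) :
    LocallyIntegrableOn u D volume := by
  rw [locallyIntegrableOn_iff hD.isLocallyClosed]
  intro K hK hc
  have : IsFiniteMeasure (volume.restrict K) := ⟨by simpa using hc.measure_lt_top⟩
  exact (hu K hK hc).integrable one_le_two

theorem LocL2.integrable_mul (hu : LocL2 D u) (hc : Continuous ψ) (hψ : HasCompactSupport ψ)
    (hs : tsupport ψ ⊆ D) : Integrable (fun x => u x * ψ x) := by
  rw [← integrableOn_iff_integrable_of_support_subset (s := tsupport ψ)]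
  · exact (hu _ hs hψ).integrable_mul (q := 2)
      ((hc.memLp_of_hasCompactSupport hψ).mono_measure Measure.restrict_le_self)
  · intro x hx
    refine subset_tsupport _ fun h0 => hx ?_
    simp [h0]

theorem LocL2.integrable_mul_test (hu : LocL2 D u) (hφ : IsTest D φ) :
    Integrable (fun x => u x * φ x) :=
  hu.integrable_mul hφ.continuous hφ.compact hφ.subset

theorem LocL2.integrable_mul_fderiv (hu : LocL2 D u) (hφ : IsTest D φ) (h : V) :
    Integrable (fun x => u x * fderiv ℝ φ x h) :=
  hu.integrable_mul (hφ.continuous_fderiv h) (hφ.compact.fderiv_apply ℝ h)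
    ((tsupport_fderiv_apply_subset ℝ h).trans hφ.subset)

theorem setIntegral_mul_test (hφ : IsTest D φ) (u : V → ℝ) :
    ∫ x in D, u x * φ x = ∫ x, u x * φ x :=
  setIntegral_eq_integral_of_forall_compl_eq_zero fun x hx => by rw [hφ.eq_zero hx, mul_zero]

theorem setIntegral_mul_fderiv (hφ : IsTest D φ) (u : V → ℝ) (h : V) :
    ∫ x in D, u x * fderiv ℝ φ x h = ∫ x, u x * fderiv ℝ φ x h :=
  setIntegral_eq_integral_of_forall_compl_eq_zero fun x hx => by
    have : fderiv ℝ φ x h = 0 := image_eq_zero_of_notMem_tsupport (f := fun x => fderiv ℝ φ x h)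
      fun h' => hx (hφ.subset (tsupport_fderiv_apply_subset ℝ h h'))
    rw [this, mul_zero]

variable (D) in
/-- The space of test functions on `D`. -/
def testFunctions : Submodule ℝ (V → ℝ) where
  carrier := {φ | IsTest D φ}
  zero_mem' := IsTest.zero
  add_mem' := IsTest.add
  smul_mem' c _ := IsTest.smul c

variable (D) in
/-- The classes in `L²` of the test functions on `D`. -/
def testToLp (μ : Measure V) [IsFiniteMeasureOnCompacts μ] : testFunctions D →ₗ[ℝ] Lp ℝ 2 μ where
  toFun φ := (IsTest.memLp φ.2 2 μ).toLp φ
  map_add' _ _ := rfl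
  map_smul' _ _ := rfl

theorem norm_testToLp (μ : Measure V) [IsFiniteMeasureOnCompacts μ] (φ : testFunctions D) :
    ‖testToLp D μ φ‖ = (eLpNorm (φ : V → ℝ) 2 μ).toReal :=
  Lp.norm_toLp _ (IsTest.memLp φ.2 2 μ)

theorem inner_testToLp (μ : Measure V) [IsFiniteMeasureOnCompacts μ] (w : Lp ℝ 2 μ)
    (φ : testFunctions D) : inner ℝ w (testToLp D μ φ) = ∫ x, w x * (φ : V → ℝ) x ∂μ := by
  rw [L2.inner_def]
  refine integral_congr_ae ?_
  filter_upwards [(IsTest.memLp φ.2 2 μ).coeFn_toLp] with x hx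
  rw [show (testToLp D μ φ : V → ℝ) x = (φ : V → ℝ) x from hx]
  simp [mul_comm]

theorem IsTest.toReal_eLpNorm_restrict (hφ : IsTest D φ) :
    eLpNorm φ 2 (volume.restrict D) = eLpNorm φ 2 volume :=
  eLpNorm_restrict_eq_of_support_subset ((subset_tsupport φ).trans hφ.subset)

theorem eq_of_integral_test_eq (hD : IsOpen D) (hu : LocL2 D u) (hv : LocL2 D v)
    (h : ∀ φ, IsTest D φ → ∫ x, u x * φ x = ∫ x, v x * φ x) : u =ᵐ[volume.restrict D] v := by
  have h1 := hD.ae_eq_zero_of_integral_contDiff_smul_eq_zero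
    ((hu.sub hv).locallyIntegrableOn hD) (fun φ h1 h2 h3 => by
      have hφ : IsTest D φ := ⟨h1, h2, h3⟩
      rw [← sub_eq_zero.2 (h φ hφ),
        ← integral_sub (hu.integrable_mul_test hφ) (hv.integrable_mul_test hφ)]
      refine integral_congr_ae (.of_forall fun x => ?_)
      simp only [Pi.sub_apply, smul_eq_mul]
      ring)
  rw [Filter.EventuallyEq, ae_restrict_iff' hD.measurableSet]
  filter_upwards [h1] with x hx hxD
  exact sub_eq_zero.1 (hx hxD)

theorem denseRange_testToLp (hD : IsOpen D) : DenseRange (testToLp D (volume.restrict D)) := by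
  have : (LinearMap.range (testToLp D (volume.restrict D))).topologicalClosure = ⊤ := by
    rw [Submodule.topologicalClosure_eq_top_iff, Submodule.eq_bot_iff]
    intro w hw
    have h1 : w =ᵐ[volume.restrict D] (0 : V → ℝ) := by
      refine eq_of_integral_test_eq hD (LocL2.of_memLp (Lp.memLp w))
        (LocL2.of_memLp MemLp.zero) fun φ hφ => ?_
      have h2 := (Submodule.mem_orthogonal' _ _).1 hw _ ⟨⟨φ, hφ⟩, rfl⟩
      rw [inner_testToLp, setIntegral_mul_test hφ] at h2
      simpa using h2
    exact (Lp.eq_zero_iff_ae_eq_zero).2 h1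
  rw [DenseRange, dense_iff_closure_eq]
  exact congrArg (fun S : Submodule ℝ (Lp ℝ 2 (volume.restrict D)) => (S : Set (Lp ℝ 2 (volume.restrict D)))) this

/-- A functional on test functions that is bounded for the `L²` norm is given by an `L²` function. -/
theorem exists_representer (hD : IsOpen D) (ℓ : testFunctions D →ₗ[ℝ] ℝ) {C : ℝ} (hC : 0 ≤ C)
    (hℓ : ∀ φ : testFunctions D, |ℓ φ| ≤ C * (eLpNorm (φ : V → ℝ) 2 volume).toReal) :
    ∃ w : Lp ℝ 2 (volume.restrict D), ‖w‖ ≤ C ∧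
      ∀ φ : testFunctions D, ℓ φ = ∫ x in D, w x * (φ : V → ℝ) x := by
  have hb : ∀ φ, ‖ℓ φ‖ ≤ C * ‖testToLp D (volume.restrict D) φ‖ := fun φ => by
    rw [norm_testToLp, IsTest.toReal_eLpNorm_restrict φ.2]
    exact hℓ φ
  set L := ℓ.extendOfNorm (testToLp D (volume.restrict D))
  refine ⟨(InnerProductSpace.toDual ℝ _).symm L, ?_, fun φ => ?_⟩
  · rw [LinearIsometryEquiv.norm_map]
    exact LinearMap.opNorm_extendOfNorm_le (denseRange_testToLp hD) hC hb
  · rw [← inner_testToLp, InnerProductSpace.toDual_symm_apply,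
      LinearMap.extendOfNorm_eq (denseRange_testToLp hD) ⟨C, hb⟩]

/-- `g` is the derivative of `u` in the direction `h`, in the sense of distributions on `D`. -/
def HasWeakDir (D : Set V) (h : V) (u g : V → ℝ) : Prop :=
  ∀ φ, IsTest D φ → ∫ x, u x * fderiv ℝ φ x h = -∫ x, g x * φ x

theorem HasWeakDir.unique (hD : IsOpen D) {h : V} {g g' : V → ℝ} (hg : LocL2 D g)
    (hg' : LocL2 D g') (H : HasWeakDir D h u g) (H' : HasWeakDir D h u g') :
    g =ᵐ[volume.restrict D] g' :=
  eq_of_integral_test_eq hD hg hg' fun φ hφ => by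
    have := H φ hφ
    rw [H' φ hφ] at this
    linarith

theorem HasWeakDir.congr {h : V} {u' g g' : V → ℝ} (H : HasWeakDir D h u g)
    (hu : u =ᵐ[volume.restrict D] u') (hg : g =ᵐ[volume.restrict D] g') :
    HasWeakDir D h u' g' := by
  intro φ hφ
  have := H φ hφ
  rw [← setIntegral_mul_fderiv hφ, ← setIntegral_mul_test hφ] at this ⊢
  have h1 := integral_congr_ae (hu.mul (ae_eq_refl fun x => fderiv ℝ φ x h))
  have h2 := integral_congr_ae (hg.mul (ae_eq_refl φ))
  simp only [Pi.mul_apply] at h1 h2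
  rw [← h1, ← h2, this]

theorem HasWeakDir.add {h : V} {g g' : V → ℝ} (hu : LocL2 D u) (hv : LocL2 D v) (hg : LocL2 D g)
    (hg' : LocL2 D g') (H : HasWeakDir D h u g) (H' : HasWeakDir D h v g') :
    HasWeakDir D h (u + v) (g + g') := by
  intro φ hφ
  simp only [Pi.add_apply, add_mul]
  rw [integral_add (hu.integrable_mul_fderiv hφ h) (hv.integrable_mul_fderiv hφ h),
    integral_add (hg.integrable_mul_test hφ) (hg'.integrable_mul_test hφ), H φ hφ, H' φ hφ]
  ring

theorem HasWeakDir.smul {h : V} {g : V → ℝ} (c : ℝ) (H : HasWeakDir D h u g) :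
    HasWeakDir D h (c • u) (c • g) := by
  intro φ hφ
  simp only [Pi.smul_apply, smul_eq_mul, mul_assoc]
  rw [integral_const_mul, integral_const_mul, H φ hφ]
  ring

theorem HasWeakDir.add_dir {h h' : V} {g g' : V → ℝ} (hu : LocL2 D u) (hg : LocL2 D g)
    (hg' : LocL2 D g') (H : HasWeakDir D h u g) (H' : HasWeakDir D h' u g') :
    HasWeakDir D (h + h') u (g + g') := by
  intro φ hφ
  simp only [map_add, mul_add, Pi.add_apply, add_mul]
  rw [integral_add (hu.integrable_mul_fderiv hφ h) (hu.integrable_mul_fderiv hφ h'),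
    integral_add (hg.integrable_mul_test hφ) (hg'.integrable_mul_test hφ), H φ hφ, H' φ hφ]
  ring

theorem HasWeakDir.smul_dir {h : V} {g : V → ℝ} (c : ℝ) (H : HasWeakDir D h u g) :
    HasWeakDir D (c • h) u (c • g) := by
  intro φ hφ
  simp only [map_smul, Pi.smul_apply, smul_eq_mul, mul_left_comm _ c, mul_assoc]
  rw [integral_const_mul, integral_const_mul, H φ hφ]
  ring

/-- Weak derivatives are found by duality. -/
theorem exists_hasWeakDir_of_bound (hD : IsOpen D) (hu : LocL2 D u) (h : V) {C : ℝ} (hC : 0 ≤ C)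
    (H : ∀ φ, IsTest D φ →
      |∫ x, u x * fderiv ℝ φ x h| ≤ C * (eLpNorm φ 2 volume).toReal) :
    ∃ w : Lp ℝ 2 (volume.restrict D), ‖w‖ ≤ C ∧ HasWeakDir D h u w := by
  let ℓ : testFunctions D →ₗ[ℝ] ℝ :=
    { toFun := fun φ => -∫ x, u x * fderiv ℝ (φ : V → ℝ) x h
      map_add' := fun φ ψ => by
        have hφ : IsTest D φ := φ.2
        have hψ : IsTest D ψ := ψ.2
        rw [← neg_add, ← integral_add (hu.integrable_mul_fderiv hφ h)
          (hu.integrable_mul_fderiv hψ h)]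
        congr 1
        refine integral_congr_ae (.of_forall fun x => ?_)
        simp only [Submodule.coe_add]
        rw [fderiv_add (hφ.smooth.differentiable (by simp) x)
          (hψ.smooth.differentiable (by simp) x), add_apply, mul_add]
      map_smul' := fun c φ => by
        have hφ : IsTest D φ := φ.2
        rw [RingHom.id_apply, smul_eq_mul, mul_neg, ← integral_const_mul]
        congr 1
        refine integral_congr_ae (.of_forall fun x => ?_)
        simp only [Submodule.coe_smul]
        rw [fderiv_const_smul (hφ.smooth.differentiable (by simp) x), smul_apply, smul_eq_mul]
        ring }
  obtain ⟨w, hw, hℓ⟩ := exists_representer hD ℓ hC fun φ => by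
    simpa [ℓ] using H φ φ.2
  refine ⟨w, hw, fun φ hφ => ?_⟩
  rw [← setIntegral_mul_test hφ, ← hℓ ⟨φ, hφ⟩]
  simp [ℓ]

/-- The integrals run over the whole space although `v` is controlled only in `D`: for small `s` the
translated test function lives in a compact thickening `K ⊆ D` of its support, where `v` is
integrable and the derivative is dominated by `M ‖h‖ |v|`. -/
theorem hasDerivAt_integral_translate (hD : IsOpen D) (hv : LocL2 D v) (hφ : IsTest D φ) (h : V) :
    HasDerivAt (fun s : ℝ => ∫ x, v x * φ (x - s • h)) (-∫ x, v x * fderiv ℝ φ x h) 0 := by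
  obtain ⟨δ, hδ, hsub⟩ := hφ.compact.isCompact.exists_cthickening_subset_open hD hφ.subset
  set K := Metric.cthickening δ (tsupport φ)
  have hK : IsCompact K := hφ.compact.isCompact.cthickening
  have hvK : MemLp v 2 (volume.restrict K) := hv K hsub hK
  have : IsFiniteMeasure (volume.restrict K) := ⟨by simpa using hK.measure_lt_top⟩
  obtain ⟨M, hM⟩ := (hφ.compact.fderiv (𝕜 := ℝ)).exists_bound_of_continuous
    (hφ.smooth.continuous_fderiv (by simp))
  have hd := (hasDerivAt_integral_of_dominated_loc_of_deriv_le (μ := volume.restrict K)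
    (F := fun (s : ℝ) x => v x * φ (x - s • h)) (x₀ := (0 : ℝ)) (s := Set.univ)
    (F' := fun s x => v x * -(fderiv ℝ φ (x - s • h) h)) (bound := fun x => ‖v x‖ * (M * ‖h‖))
    univ_mem ?_ ?_ ?_ ?_ ?_ ?_).2
  · have e1 : ∫ x in K, v x * -(fderiv ℝ φ (x - (0 : ℝ) • h) h) =
        -∫ x, v x * fderiv ℝ φ x h := by
      have hφK : IsTest K φ := ⟨hφ.smooth, hφ.compact, Metric.self_subset_cthickening _⟩
      simp only [zero_smul, sub_zero, mul_neg]
      rw [integral_neg, setIntegral_mul_fderiv hφK]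
    rw [e1] at hd
    refine hd.congr_of_eventuallyEq ?_
    have hs : ∀ᶠ s : ℝ in 𝓝 0, ‖s • h‖ < δ := by
      have : Tendsto (fun s : ℝ => ‖s • h‖) (𝓝 0) (𝓝 ‖(0 : ℝ) • h‖) :=
        (continuous_id.smul continuous_const).norm.tendsto 0
      rw [zero_smul, norm_zero] at this
      exact this.eventually (gt_mem_nhds hδ)
    filter_upwards [hs] with s hs
    refine (setIntegral_eq_integral_of_forall_compl_eq_zero fun x hx => ?_).symm
    rw [image_eq_zero_of_notMem_tsupport (f := φ) (x := x - s • h), mul_zero]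
    intro hx'
    refine hx (Metric.mem_cthickening_of_dist_le x (x - s • h) δ _ hx' ?_)
    rw [dist_eq_norm, sub_sub_cancel]
    exact hs.le
  · refine .of_forall fun s => hvK.1.mul ?_
    exact (hφ.continuous.comp (continuous_id.sub continuous_const)).aestronglyMeasurable
  · simp only [zero_smul, sub_zero]
    exact (hv.integrable_mul_test hφ).mono_measure Measure.restrict_le_self
  · refine hvK.1.mul ?_
    exact ((hφ.continuous_fderiv h).comp
      (continuous_id.sub continuous_const)).neg.aestronglyMeasurable
  · refine .of_forall fun x s _ => ?_
    rw [norm_mul, norm_neg]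
    gcongr
    exact (ContinuousLinearMap.le_opNorm _ _).trans (by gcongr; exact hM _)
  · exact (hvK.integrable one_le_two).norm.mul_const _
  · refine .of_forall fun x s _ => HasDerivAt.const_mul _ ?_
    have h1 : HasDerivAt (fun s : ℝ => x - s • h) (-h) s := by
      simpa using ((hasDerivAt_id s).smul_const h).const_sub x
    have h2 := (hφ.smooth.differentiable (by simp) (x - s • h)).hasFDerivAt.comp_hasDerivAt s h1
    simpa [Function.comp_def] using h2

theorem abs_integral_mul_le {μ : Measure V} (w : Lp ℝ 2 μ) (hφ : MemLp φ 2 μ) :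
    ∫ x, |w x| * |φ x| ∂μ ≤ ‖w‖ * (eLpNorm φ 2 μ).toReal := by
  have h1 := real_inner_le_norm |w| |hφ.toLp φ|
  rw [norm_abs_eq_norm, norm_abs_eq_norm, Lp.norm_toLp, L2.inner_def] at h1
  refine le_of_eq_of_le (integral_congr_ae ?_) h1
  filter_upwards [Lp.coeFn_abs w, Lp.coeFn_abs (hφ.toLp φ), hφ.coeFn_toLp] with x h1 h2 h3
  simp [h1, h2, h3, mul_comm]

theorem abs_integral_mul_test_le (w : Lp ℝ 2 (volume.restrict D)) (hφ : IsTest D φ) :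
    |∫ x, w x * φ x| ≤ ‖w‖ * (eLpNorm φ 2 volume).toReal := by
  rw [← setIntegral_mul_test hφ, ← hφ.toReal_eLpNorm_restrict]
  refine (abs_integral_le_integral_abs).trans ?_
  simp_rw [abs_mul]
  exact abs_integral_mul_le w (hφ.memLp 2 _)

theorem eLpNorm_translate (hφ : Continuous φ) (a : V) :
    eLpNorm (fun x => φ (x - a)) 2 volume = eLpNorm φ 2 volume :=
  eLpNorm_comp_measurePreserving hφ.aestronglyMeasurable (measurePreserving_sub_right volume a)

/-- The derivative of `s ↦ ∫ u(x) φ(x - s h) dx` is `∫ g(x) φ(x - s h) dx`, at most `‖g‖ ‖φ‖` by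
translation invariance. The mean value inequality on `[0, 1]` needs the whole segment from `x` to `x
+ h` in `D`. -/
theorem abs_integral_translate_sub_le (hD : IsOpen D) (hu : LocL2 D u) {h : V}
    {g : Lp ℝ 2 (volume.restrict D)} (H : HasWeakDir D h u g) (hφ : IsTest U φ)
    (hU : ∀ x ∈ U, ∀ s ∈ Set.Icc (0 : ℝ) 1, x + s • h ∈ D) :
    |(∫ x, u x * φ (x - h)) - ∫ x, u x * φ x| ≤ ‖g‖ * (eLpNorm φ 2 volume).toReal := by
  let F : ℝ → ℝ := fun s => ∫ x, u x * φ (x - s • h)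
  have hd : ∀ s ∈ Set.Icc (0 : ℝ) 1,
      HasDerivAt F (∫ x, g x * φ (x - s • h)) s := fun s hs => by
    have hφs : IsTest D (fun x => φ (x - s • h)) := hφ.translate fun x hx => hU x hx s hs
    have h1 := hasDerivAt_integral_translate hD hu hφs h
    rw [H _ hφs, neg_neg, ← sub_self s] at h1
    have h2 := h1.comp_sub_const s s
    refine h2.congr_of_eventuallyEq (.of_forall fun t => ?_)
    refine integral_congr_ae (.of_forall fun x => ?_)
    simp only
    congr 2
    module
  have h1 := norm_image_sub_le_of_norm_deriv_le_segment_01' (f := F)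
    (f' := fun s => ∫ x, g x * φ (x - s • h)) (C := ‖g‖ * (eLpNorm φ 2 volume).toReal)
    (fun s hs => (hd s hs).hasDerivWithinAt) fun s hs => by
      have hφs : IsTest D (fun x => φ (x - s • h)) :=
        hφ.translate fun x hx => hU x hx s (Set.Ico_subset_Icc_self hs)
      rw [← eLpNorm_translate hφ.continuous (s • h)]
      exact abs_integral_mul_test_le g hφs
  simpa [F] using h1

theorem integral_translate_sub_eq {a : V} (hu : LocL2 D u) (hφ : IsTest U φ) (hUD : U ⊆ D)
    (ha : ∀ x ∈ U, x + a ∈ D) :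
    (∫ x, u x * φ (x - a)) - ∫ x, u x * φ x = ∫ x, (u (x + a) - u x) * φ x := by
  have h1 : ∫ x, u x * φ (x - a) = ∫ x, u (x + a) * φ x := by
    rw [← integral_add_right_eq_self (fun x => u x * φ (x - a)) a]
    simp
  simp_rw [sub_mul]
  rw [h1, integral_sub ((hu.translate ha).integrable_mul_test hφ)
    ((hu.mono hUD).integrable_mul_test hφ)]

/-- The `L²` modulus of continuity of a function with square integrable weak derivative. -/
theorem exists_translate_sub_eq (hD : IsOpen D) (hU : IsOpen U) (hu : LocL2 D u) {h : V}
    {g : Lp ℝ 2 (volume.restrict D)} (H : HasWeakDir D h u g)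
    (hUD : ∀ x ∈ U, ∀ s ∈ Set.Icc (0 : ℝ) 1, x + s • h ∈ D) :
    ∃ w : Lp ℝ 2 (volume.restrict U), ‖w‖ ≤ ‖g‖ ∧
      (fun x => u (x + h) - u x) =ᵐ[volume.restrict U] w := by
  have h0 : U ⊆ D := fun x hx => by simpa using hUD x hx 0 (by simp)
  have h1 : ∀ x ∈ U, x + h ∈ D := fun x hx => by simpa using hUD x hx 1 (by simp)
  have hdiff : LocL2 U (fun x => u (x + h) - u x) := (hu.translate h1).sub (hu.mono h0)
  -- The bound on pairings with test functions becomes an `L²(U)` bound on the difference by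
  -- duality.
  let ℓ : testFunctions U →ₗ[ℝ] ℝ :=
    { toFun := fun φ => ∫ x, (u (x + h) - u x) * (φ : V → ℝ) x
      map_add' := fun φ ψ => by
        rw [← integral_add (hdiff.integrable_mul_test φ.2) (hdiff.integrable_mul_test ψ.2)]
        simp [mul_add]
      map_smul' := fun c φ => by
        rw [RingHom.id_apply, smul_eq_mul, ← integral_const_mul]
        simp [mul_left_comm] }
  obtain ⟨w, hw, hℓ⟩ := exists_representer hU ℓ (norm_nonneg g) fun φ => by
    have := abs_integral_translate_sub_le hD hu H φ.2 hUD
    rw [integral_translate_sub_eq hu φ.2 h0 h1] at this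
    exact this
  refine ⟨w, hw, eq_of_integral_test_eq hU hdiff (LocL2.of_memLp (Lp.memLp w)) fun φ hφ => ?_⟩
  rw [← setIntegral_mul_test hφ w]
  exact hℓ ⟨φ, hφ⟩

/-- Normal contractions operate on weak derivatives. -/
theorem exists_hasWeakDir_comp (hD : IsOpen D) (hu : LocL2 D u) {e : V}
    {g : Lp ℝ 2 (volume.restrict D)} (H : HasWeakDir D e u g) {Φ : ℝ → ℝ}
    (hΦ : LipschitzWith 1 Φ) (h0 : Φ 0 = 0) :
    ∃ w : Lp ℝ 2 (volume.restrict D), ‖w‖ ≤ ‖g‖ ∧ HasWeakDir D e (Φ ∘ u) w := by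
  have hv : LocL2 D (Φ ∘ u) := hu.comp_lipschitz hΦ h0
  refine exists_hasWeakDir_of_bound hD hv e (norm_nonneg g) fun φ hφ => ?_
  obtain ⟨δ, hδ, hsub⟩ := hφ.compact.isCompact.exists_thickening_subset_open hD hφ.subset
  -- Half of the available radius is kept for the translations by `t • e` with `‖t • e‖ < δ / 2`.
  set U := Metric.thickening (δ / 2) (tsupport φ)
  have hU : IsOpen U := Metric.isOpen_thickening
  have hφU : IsTest U φ :=
    ⟨hφ.smooth, hφ.compact, Metric.self_subset_thickening (half_pos hδ) _⟩
  have hd := (hasDerivAt_integral_translate hD hv hφ e).tendsto_slope_zero_right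
  have hsmall : ∀ᶠ t : ℝ in 𝓝[>] 0, ‖t • e‖ < δ / 2 := by
    have : Tendsto (fun s : ℝ => ‖s • e‖) (𝓝 0) (𝓝 ‖(0 : ℝ) • e‖) :=
      (continuous_id.smul continuous_const).norm.tendsto 0
    rw [zero_smul, norm_zero] at this
    exact (this.eventually (gt_mem_nhds (half_pos hδ))).filter_mono nhdsWithin_le_nhds
  rw [← abs_neg]
  refine le_of_tendsto hd.abs ?_
  filter_upwards [hsmall, self_mem_nhdsWithin] with t ht ht0
  have ht0 : 0 < t := ht0
  have hUD : ∀ x ∈ U, ∀ s ∈ Set.Icc (0 : ℝ) 1, x + s • (t • e) ∈ D := fun x hx s hs => by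
    refine hsub ?_
    rw [Metric.mem_thickening_iff] at hx ⊢
    obtain ⟨z, hz, hxz⟩ := hx
    refine ⟨z, hz, ?_⟩
    have h1 : dist (x + s • (t • e)) x ≤ ‖t • e‖ := by
      rw [dist_eq_norm, add_sub_cancel_left, norm_smul, Real.norm_of_nonneg hs.1]
      exact mul_le_of_le_one_left (norm_nonneg _) hs.2
    linarith [dist_triangle (x + s • (t • e)) x z]
  have hUD0 : U ⊆ D := fun x hx => by simpa using hUD x hx 0 (by simp)
  have hUD1 : ∀ x ∈ U, x + t • e ∈ D := fun x hx => by simpa using hUD x hx 1 (by simp)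
  -- The weak derivative in the direction `t • e` is `t • g`; its factor `t` cancels the denominator
  -- of the difference quotient.
  obtain ⟨w, hw, hwe⟩ := exists_translate_sub_eq (g := t • g) hD hU hu
    ((H.smul_dir t).congr (ae_eq_refl u) (Lp.coeFn_smul t g).symm) hUD
  rw [norm_smul, Real.norm_of_nonneg ht0.le] at hw
  simp only [zero_add, zero_smul, sub_zero, smul_eq_mul]
  rw [integral_translate_sub_eq hv hφU hUD0 hUD1, abs_mul, abs_inv, abs_of_pos ht0,
    inv_mul_le_iff₀ ht0]
  calc |∫ x, ((Φ ∘ u) (x + t • e) - (Φ ∘ u) x) * φ x|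
      = |∫ x in U, ((Φ ∘ u) (x + t • e) - (Φ ∘ u) x) * φ x| := by
        rw [setIntegral_mul_test hφU fun x => (Φ ∘ u) (x + t • e) - (Φ ∘ u) x]
    _ ≤ ∫ x in U, |((Φ ∘ u) (x + t • e) - (Φ ∘ u) x) * φ x| := abs_integral_le_integral_abs
    _ ≤ ∫ x in U, |w x| * |φ x| := by
        refine integral_mono_of_nonneg (.of_forall fun x => abs_nonneg _) ?_ ?_
        · have := (Lp.memLp w).integrable_mul (q := 2) (hφ.memLp 2 (volume.restrict U))
          simpa [abs_mul] using this.abs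
        · filter_upwards [hwe] with x hx
          rw [abs_mul, ← hx]
          -- No chain rule is needed: `Φ` contracts the increments of `u` pointwise.
          refine mul_le_mul_of_nonneg_right ?_ (abs_nonneg _)
          have := hΦ.dist_le_mul (u (x + t • e)) (u x)
          simpa [Real.dist_eq] using this
    _ ≤ ‖w‖ * (eLpNorm φ 2 (volume.restrict U)).toReal := abs_integral_mul_le w (hφ.memLp 2 _)
    _ ≤ t * ‖g‖ * (eLpNorm φ 2 volume).toReal := by
        rw [hφU.toReal_eLpNorm_restrict]
        gcongr
    _ = t * (‖g‖ * (eLpNorm φ 2 volume).toReal) := by ring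

end WeakDerivative

/-! ### A Poincaré inequality and closability -/

section SquareIntegrals

variable {X : Type*} [MeasurableSpace X] {ν : Measure X}

theorem eLpNorm_two_sq (f : X → ℝ) : eLpNorm f 2 ν ^ 2 = ∫⁻ x, ‖f x‖ₑ ^ 2 ∂ν := by
  have := eLpNorm_nnreal_pow_eq_lintegral (f := f) (μ := ν) (p := 2) two_ne_zero
  simpa using this

theorem tendsto_eLpNorm_two_iff {f : ℕ → X → ℝ} :
    Tendsto (fun n => eLpNorm (f n) 2 ν) atTop (𝓝 0) ↔
      Tendsto (fun n => ∫⁻ x, ‖f n x‖ₑ ^ 2 ∂ν) atTop (𝓝 0) := by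
  simp_rw [← eLpNorm_two_sq]
  constructor
  · intro h
    simpa using ENNReal.Tendsto.pow (n := 2) h
  · intro h
    have h1 := (ENNReal.continuous_rpow_const (y := (2 : ℝ)⁻¹)).tendsto 0 |>.comp h
    have h2 : ∀ a : ℝ≥0∞, (a ^ 2) ^ (2 : ℝ)⁻¹ = a := fun a => by
      rw [← ENNReal.rpow_natCast, ← ENNReal.rpow_mul]
      simp
    simpa [Function.comp_def, h2] using h1

theorem enorm_add_sq_le (a b : ℝ≥0∞) : (a + b) ^ 2 ≤ 4 * (a ^ 2 + b ^ 2) := by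
  wlog hab : a ≤ b generalizing a b
  · rw [add_comm a, add_comm (a ^ 2)]
    exact this b a (le_of_not_ge hab)
  calc (a + b) ^ 2 ≤ (b + b) ^ 2 := by gcongr
    _ = 4 * (0 + b ^ 2) := by ring
    _ ≤ 4 * (a ^ 2 + b ^ 2) := by gcongr; exact zero_le

/-- For `y` with `|w(y)| ≤ η`, `|w(x)|² ≤ 4 (|w(x) - w(y)|² + η²)`; integrate over `x` and over such
`y`. Points where `w` is small thus play the role of a mean value in a Poincaré inequality. -/
theorem measure_mul_lintegral_sq_le {w : X → ℝ} (hw : Measurable w) (η : ℝ≥0∞) :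
    ν {y | ‖w y‖ₑ ≤ η} * ∫⁻ x, ‖w x‖ₑ ^ 2 ∂ν ≤
      4 * ((∫⁻ y, ∫⁻ x, ‖w x - w y‖ₑ ^ 2 ∂ν ∂ν) + η ^ 2 * ν Set.univ * ν Set.univ) := by
  have hS : MeasurableSet {y | ‖w y‖ₑ ≤ η} := measurableSet_le hw.enorm measurable_const
  calc ν {y | ‖w y‖ₑ ≤ η} * ∫⁻ x, ‖w x‖ₑ ^ 2 ∂ν
      = ∫⁻ _ in {y | ‖w y‖ₑ ≤ η}, ∫⁻ x, ‖w x‖ₑ ^ 2 ∂ν ∂ν := by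
        rw [setLIntegral_const, mul_comm]
    _ ≤ ∫⁻ y in {y | ‖w y‖ₑ ≤ η}, 4 * ((∫⁻ x, ‖w x - w y‖ₑ ^ 2 ∂ν) + η ^ 2 * ν Set.univ) ∂ν := by
        refine setLIntegral_mono' hS fun y hy => ?_
        rw [← lintegral_const, ← lintegral_add_right _ measurable_const, ← lintegral_const_mul']
        · refine lintegral_mono fun x => ?_
          refine le_trans ?_ (enorm_add_sq_le _ _)
          gcongr
          calc ‖w x‖ₑ = ‖(w x - w y) + w y‖ₑ := by rw [sub_add_cancel]
            _ ≤ ‖w x - w y‖ₑ + ‖w y‖ₑ := enorm_add_le _ _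
            _ ≤ ‖w x - w y‖ₑ + η := by gcongr; exact hy
        · simp
    _ ≤ ∫⁻ y, 4 * ((∫⁻ x, ‖w x - w y‖ₑ ^ 2 ∂ν) + η ^ 2 * ν Set.univ) ∂ν :=
        setLIntegral_le_lintegral _ _
    _ = _ := by
        rw [lintegral_const_mul' _ _ (by simp), lintegral_add_right _ measurable_const,
          lintegral_const]

/-- Small oscillation determines `w n` only up to a constant, and almost everywhere convergence
fixes the constant: eventually `|w n| ≤ η` off a set of at most half the total mass, so the
preceding bound applies with a constant independent of `η`. -/
theorem tendsto_lintegral_sq_of_ae [IsFiniteMeasure ν] {w : ℕ → X → ℝ}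
    (hw : ∀ n, Measurable (w n)) (hae : ∀ᵐ x ∂ν, Tendsto (fun n => w n x) atTop (𝓝 0))
    (hd : Tendsto (fun n => ∫⁻ y, ∫⁻ x, ‖w n x - w n y‖ₑ ^ 2 ∂ν ∂ν) atTop (𝓝 0)) :
    Tendsto (fun n => ∫⁻ x, ‖w n x‖ₑ ^ 2 ∂ν) atTop (𝓝 0) := by
  rcases eq_or_ne ν 0 with rfl | hν
  · simp
  set c := ν Set.univ
  have hc0 : c ≠ 0 := by simpa [c] using hν
  have hct : c ≠ ⊤ := measure_ne_top _ _
  have hm : TendstoInMeasure ν w atTop (fun _ => 0) :=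
    tendstoInMeasure_of_tendsto_ae (fun n => (hw n).aestronglyMeasurable) hae
  set K : ℝ≥0∞ := (c / 2)⁻¹ * (4 * (1 + c * c))
  have hK : K ≠ ⊤ := by
    refine ENNReal.mul_ne_top ?_ (by finiteness)
    simp [hc0]
  have hc2 : c / 2 ≠ 0 := by simp [hc0]
  have hc2' : c / 2 ≠ ⊤ := (ENNReal.div_lt_top hct two_ne_zero).ne
  have key : ∀ η : ℝ≥0∞, 0 < η → ∀ᶠ n in atTop, ∫⁻ x, ‖w n x‖ₑ ^ 2 ∂ν ≤ K * η ^ 2 := by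
    intro η hη
    have h1 := ENNReal.tendsto_nhds_zero.1 (hm η hη) (c / 2) (pos_iff_ne_zero.2 hc2)
    have h2 := ENNReal.tendsto_nhds_zero.1 hd (η ^ 2) (by positivity)
    filter_upwards [h1, h2] with n h1 h2
    simp only [edist_zero_right] at h1
    have hS : c / 2 ≤ ν {y | ‖w n y‖ₑ ≤ η} := by
      have h3 : c ≤ ν {y | η ≤ ‖w n y‖ₑ} + ν {y | ‖w n y‖ₑ ≤ η} := by
        refine (measure_mono fun y _ => ?_).trans (measure_union_le _ _)
        exact le_total η _
      have h4 : c ≤ c / 2 + ν {y | ‖w n y‖ₑ ≤ η} := h3.trans (by gcongr)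
      nth_rewrite 1 [← ENNReal.add_halves c] at h4
      exact (ENNReal.add_le_add_iff_left hc2').1 h4
    have h5 := measure_mul_lintegral_sq_le (ν := ν) (hw n) η
    have h6 : c / 2 * ∫⁻ x, ‖w n x‖ₑ ^ 2 ∂ν ≤ 4 * (1 + c * c) * η ^ 2 := by
      calc _ ≤ ν {y | ‖w n y‖ₑ ≤ η} * ∫⁻ x, ‖w n x‖ₑ ^ 2 ∂ν := by gcongr
        _ ≤ _ := h5
        _ ≤ 4 * (η ^ 2 + η ^ 2 * c * c) := by gcongr
        _ = _ := by ring
    calc ∫⁻ x, ‖w n x‖ₑ ^ 2 ∂ν = (c / 2)⁻¹ * (c / 2 * ∫⁻ x, ‖w n x‖ₑ ^ 2 ∂ν) := by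
          rw [← mul_assoc, ENNReal.inv_mul_cancel hc2 hc2', one_mul]
      _ ≤ (c / 2)⁻¹ * (4 * (1 + c * c) * η ^ 2) := by gcongr
      _ = K * η ^ 2 := by ring
  rw [ENNReal.tendsto_nhds_zero]
  intro ε hε
  have h1 : Tendsto (fun η : ℝ≥0∞ => K * η ^ 2) (𝓝[>] 0) (𝓝 0) := by
    have h2 : Tendsto (fun η : ℝ≥0∞ => η ^ 2) (𝓝 0) (𝓝 0) := by
      simpa using ENNReal.Tendsto.pow (n := 2) (tendsto_id (α := ℝ≥0∞) (x := 𝓝 0))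
    simpa using (ENNReal.Tendsto.const_mul h2 (.inr hK)).mono_left nhdsWithin_le_nhds
  obtain ⟨η, hη, hη0⟩ := ((ENNReal.tendsto_nhds_zero.1 h1 ε hε).and self_mem_nhdsWithin).exists
  filter_upwards [key η hη0] with n hn
  exact hn.trans hη

end SquareIntegrals

section Poincare

variable {V : Type*} [NormedAddCommGroup V] [InnerProductSpace ℝ V] [FiniteDimensional ℝ V]
  [MeasurableSpace V] [BorelSpace V] {D : Set V} {u : V → ℝ}

/-- The oscillation of `u` on a ball is controlled by the weak derivatives of `u`. -/
theorem lintegral_lintegral_sub_sq_le (hD : IsOpen D) (hum : Measurable u) (hu : LocL2 D u)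
    {C : ℝ} (hC : 0 ≤ C)
    (H : ∀ h : V, ∃ g : Lp ℝ 2 (volume.restrict D), ‖g‖ ≤ ‖h‖ * C ∧ HasWeakDir D h u g)
    {c : V} {r : ℝ} (hr : Metric.ball c (3 * r) ⊆ D) :
    ∫⁻ y in Metric.ball c r, ∫⁻ x in Metric.ball c r, ‖u x - u y‖ₑ ^ 2 ≤
      ENNReal.ofReal (2 * r * C) ^ 2 * volume (Metric.ball (0 : V) (2 * r)) := by
  set B := Metric.ball c r
  set B' := Metric.ball (0 : V) (2 * r)
  have hmeas : Measurable (fun z : V × V => ‖u (z.1 + z.2) - u z.1‖ₑ ^ 2) :=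
    (((hum.comp (measurable_fst.add measurable_snd)).sub (hum.comp measurable_fst)).enorm).pow_const 2
  -- Substitute `x = y + h`; two points of `B` differ by less than `2r`.
  have h1 : ∀ y ∈ B, ∫⁻ x in B, ‖u x - u y‖ₑ ^ 2 ≤ ∫⁻ h in B', ‖u (y + h) - u y‖ₑ ^ 2 := by
    intro y hy
    rw [← lintegral_indicator measurableSet_ball, ← lintegral_indicator measurableSet_ball,
      ← lintegral_add_left_eq_self (fun x => B.indicator (fun x => ‖u x - u y‖ₑ ^ 2) x) y]
    refine lintegral_mono fun h => ?_
    by_cases hh : y + h ∈ B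
    · have hB' : h ∈ B' := by
        rw [mem_ball_zero_iff]
        have h2 := Metric.mem_ball.1 hh
        have h3 := Metric.mem_ball.1 hy
        have h4 := dist_triangle_right (y + h) y c
        rw [dist_eq_norm, add_sub_cancel_left] at h4
        linarith
      rw [Set.indicator_of_mem hh, Set.indicator_of_mem hB']
    · rw [Set.indicator_of_notMem hh]
      exact zero_le
  have h2 : ∀ h ∈ B', ∫⁻ y in B, ‖u (y + h) - u y‖ₑ ^ 2 ≤ ENNReal.ofReal (2 * r * C) ^ 2 := by
    intro h hh
    have hh' : ‖h‖ < 2 * r := mem_ball_zero_iff.1 hh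
    obtain ⟨g, hg, hw⟩ := H h
    -- Points of `B` moved by less than `2r` stay in the ball of radius `3r`, hence in `D`.
    obtain ⟨w, hwn, hwe⟩ := exists_translate_sub_eq hD Metric.isOpen_ball hu hw (U := B)
      fun x hx s hs => by
        refine hr ?_
        have hx' := Metric.mem_ball.1 hx
        have h3 : dist (x + s • h) x ≤ ‖h‖ := by
          rw [dist_eq_norm, add_sub_cancel_left, norm_smul, Real.norm_of_nonneg hs.1]
          exact mul_le_of_le_one_left (norm_nonneg _) hs.2
        have h4 := dist_triangle (x + s • h) x c
        rw [Metric.mem_ball]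
        linarith
    rw [← eLpNorm_two_sq, eLpNorm_congr_ae hwe, ← Lp.enorm_def, ← ofReal_norm]
    gcongr
    exact hwn.trans (hg.trans (by gcongr))
  calc _ ≤ ∫⁻ y in B, ∫⁻ h in B', ‖u (y + h) - u y‖ₑ ^ 2 :=
        setLIntegral_mono' measurableSet_ball h1
    _ = ∫⁻ h in B', ∫⁻ y in B, ‖u (y + h) - u y‖ₑ ^ 2 :=
        lintegral_lintegral_swap (f := fun y h => ‖u (y + h) - u y‖ₑ ^ 2) hmeas.aemeasurable
    _ ≤ ∫⁻ _ in B', ENNReal.ofReal (2 * r * C) ^ 2 := setLIntegral_mono' measurableSet_ball h2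
    _ = _ := setLIntegral_const _ _

theorem tendsto_integral_mul_of_local {a : ℕ → V → ℝ} (ha : ∀ n, LocL2 D (a n)) (hu : LocL2 D u)
    (hlim : ∀ K ⊆ D, IsCompact K →
      Tendsto (fun n => ∫⁻ x in K, ‖a n x - u x‖ₑ ^ 2) atTop (𝓝 0))
    {ψ : V → ℝ} (hc : Continuous ψ) (hψ : HasCompactSupport ψ) (hs : tsupport ψ ⊆ D) :
    Tendsto (fun n => ∫ x, a n x * ψ x) atTop (𝓝 (∫ x, u x * ψ x)) := by
  set K := tsupport ψ
  have hK : IsCompact K := hψ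
  have hψK : MemLp ψ 2 (volume.restrict K) := hc.memLp_of_hasCompactSupport hψ
  have hm : ∀ n, MemLp (fun x => a n x - u x) 2 (volume.restrict K) :=
    fun n => (ha n K hs hK).sub (hu K hs hK)
  have h1 : Tendsto (fun n => eLpNorm (fun x => a n x - u x) 2 (volume.restrict K)) atTop (𝓝 0) :=
    tendsto_eLpNorm_two_iff.2 (hlim K hs hK)
  have h2 := ((ENNReal.tendsto_toReal ENNReal.zero_ne_top).comp h1).mul_const
    (eLpNorm ψ 2 (volume.restrict K)).toReal
  rw [ENNReal.toReal_zero, zero_mul] at h2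
  rw [tendsto_iff_norm_sub_tendsto_zero]
  refine squeeze_zero (fun _ => norm_nonneg _) (fun n => ?_) h2
  rw [← integral_sub ((ha n).integrable_mul hc hψ hs) (hu.integrable_mul hc hψ hs)]
  have e : ∫ x, (a n x * ψ x - u x * ψ x) = ∫ x in K, (a n x - u x) * ψ x := by
    simp_rw [← sub_mul]
    refine (setIntegral_eq_integral_of_forall_compl_eq_zero fun x hx => ?_).symm
    rw [image_eq_zero_of_notMem_tsupport hx, mul_zero]
  rw [e]
  have h3 := abs_integral_mul_le ((hm n).toLp _) hψK
  rw [Lp.norm_toLp] at h3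
  refine (abs_integral_le_integral_abs).trans (le_of_eq_of_le (integral_congr_ae ?_) h3)
  filter_upwards [(hm n).coeFn_toLp] with x hx
  rw [abs_mul, hx]

theorem HasWeakDir.of_tendsto {a : ℕ → V → ℝ} (ha : ∀ n, LocL2 D (a n)) (hu : LocL2 D u)
    (hlim : ∀ K ⊆ D, IsCompact K →
      Tendsto (fun n => ∫⁻ x in K, ‖a n x - u x‖ₑ ^ 2) atTop (𝓝 0))
    {h : V} {G : ℕ → Lp ℝ 2 (volume.restrict D)} {g : Lp ℝ 2 (volume.restrict D)}
    (hG : ∀ n, HasWeakDir D h (a n) (G n)) (hGg : Tendsto G atTop (𝓝 g)) :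
    HasWeakDir D h u g := by
  intro φ hφ
  have h1 := tendsto_integral_mul_of_local ha hu hlim (hφ.continuous_fderiv h)
    (hφ.compact.fderiv_apply ℝ h) ((tsupport_fderiv_apply_subset ℝ h).trans hφ.subset)
  refine tendsto_nhds_unique h1 ?_
  have h2 : Tendsto (fun n => -inner ℝ (G n) (testToLp D (volume.restrict D) ⟨φ, hφ⟩)) atTop
      (𝓝 (-inner ℝ g (testToLp D (volume.restrict D) ⟨φ, hφ⟩))) :=
    (hGg.inner tendsto_const_nhds).neg
  simp only [inner_testToLp] at h2
  rw [setIntegral_mul_test hφ] at h2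
  refine h2.congr fun n => ?_
  rw [setIntegral_mul_test hφ, hG n φ hφ]

theorem lintegral_sq_local_of_ball {a : ℕ → V → ℝ}
    (hD : IsOpen D) (h : ∀ c : V, ∀ r > 0, Metric.ball c (3 * r) ⊆ D →
      Tendsto (fun n => ∫⁻ x in Metric.ball c r, ‖a n x‖ₑ ^ 2) atTop (𝓝 0))
    {K : Set V} (hKD : K ⊆ D) (hK : IsCompact K) :
    Tendsto (fun n => ∫⁻ x in K, ‖a n x‖ₑ ^ 2) atTop (𝓝 0) := by
  refine hK.induction_on (p := fun K =>
    Tendsto (fun n => ∫⁻ x in K, ‖a n x‖ₑ ^ 2) atTop (𝓝 0)) (by simp) (fun s t hst ht => ?_)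
    (fun s t hs ht => ?_) fun x hx => ?_
  · exact tendsto_of_tendsto_of_tendsto_of_le_of_le tendsto_const_nhds ht (fun _ => zero_le)
      fun n => lintegral_mono_set hst
  · refine tendsto_of_tendsto_of_tendsto_of_le_of_le tendsto_const_nhds
      (by simpa using hs.add ht) (fun _ => zero_le) fun n => lintegral_union_le _ _ _
  · obtain ⟨ε, hε, hb⟩ := Metric.isOpen_iff.1 hD x (hKD hx)
    refine ⟨Metric.ball x (ε / 3), mem_nhdsWithin_of_mem_nhds
      (Metric.ball_mem_nhds x (by positivity)), h x (ε / 3) (by positivity) ?_⟩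
    rwa [mul_div_cancel₀ _ (three_ne_zero)]

end Poincare

/-! ### Closedness of the gradient under almost everywhere convergence. -/

section Closability

variable {d : ℕ} {D : Set (EuclideanSpace ℝ (Fin d))}

theorem exists_hasWeakDir_of_partial {u : EuclideanSpace ℝ (Fin d) → ℝ} (hu : LocL2 D u)
    {G : Fin d → Lp ℝ 2 (volume.restrict D)}
    (hG : ∀ i, HasWeakDir D (EuclideanSpace.single i 1) u (G i)) (h : EuclideanSpace ℝ (Fin d)) :
    ∃ g : Lp ℝ 2 (volume.restrict D), ‖g‖ ≤ ‖h‖ * ∑ i, ‖G i‖ ∧ HasWeakDir D h u g := by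
  have key : ∀ s : Finset (Fin d), HasWeakDir D (∑ i ∈ s, h i • EuclideanSpace.single i (1 : ℝ)) u
      (∑ i ∈ s, h i • G i : Lp ℝ 2 (volume.restrict D)) := by
    intro s
    induction s using Finset.induction_on with
    | empty =>
      intro φ hφ
      rw [← setIntegral_mul_test hφ]
      have h0 : ∫ x in D, (∑ i ∈ (∅ : Finset (Fin d)), h i • G i :
          Lp ℝ 2 (volume.restrict D)) x * φ x = ∫ _ in D, (0 : ℝ) := by
        refine integral_congr_ae ?_
        filter_upwards [Lp.coeFn_zero ℝ 2 (volume.restrict D)] with x hx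
        rw [Finset.sum_empty, hx, Pi.zero_apply, zero_mul]
      rw [h0]
      simp
    | insert i s hi ih =>
      rw [Finset.sum_insert hi, Finset.sum_insert hi]
      have h1 : HasWeakDir D (h i • EuclideanSpace.single i (1 : ℝ)) u
          (h i • G i : Lp ℝ 2 (volume.restrict D)) :=
        ((hG i).smul_dir (h i)).congr (ae_eq_refl u) (Lp.coeFn_smul _ _).symm
      exact (h1.add_dir hu (.of_memLp (Lp.memLp _)) (.of_memLp (Lp.memLp _)) ih).congr
        (ae_eq_refl u) (Lp.coeFn_add _ _).symm
  refine ⟨∑ i, h i • G i, ?_, ?_⟩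
  · rw [Finset.mul_sum]
    refine (norm_sum_le _ _).trans (Finset.sum_le_sum fun i _ => ?_)
    rw [norm_smul]
    gcongr
    exact PiLp.norm_apply_le h i
  · have e : h = ∑ i, h i • EuclideanSpace.single i (1 : ℝ) := by
      ext j
      simp [Finset.sum_apply, Pi.single_apply]
    have := key Finset.univ
    rwa [← e] at this

/-- If the weak gradients of `aₙ` converge in `L²(D)` and `aₙ → u` almost everywhere, then `u` is
weakly differentiable, and its gradient is the limit. -/
theorem hasWeakDir_of_ae_tendsto (hD : IsOpen D) {a : ℕ → EuclideanSpace ℝ (Fin d) → ℝ}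
    {u : EuclideanSpace ℝ (Fin d) → ℝ} (ham : ∀ n, Measurable (a n)) (ha : ∀ n, LocL2 D (a n))
    {G : ℕ → Fin d → Lp ℝ 2 (volume.restrict D)} {g : Fin d → Lp ℝ 2 (volume.restrict D)}
    (hG : ∀ n i, HasWeakDir D (EuclideanSpace.single i 1) (a n) (G n i))
    (hGg : ∀ i, Tendsto (fun n => G n i) atTop (𝓝 (g i)))
    (hae : ∀ᵐ x ∂(volume.restrict D), Tendsto (fun n => a n x) atTop (𝓝 (u x))) :
    LocL2 D u ∧ ∀ i, HasWeakDir D (EuclideanSpace.single i 1) u (g i) := by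
  -- As an almost everywhere limit, `u` has a measurable modification on `D`, to which Tonelli's
  -- theorem applies.
  wlog hum : Measurable u generalizing u
  · have h1 : AEMeasurable u (volume.restrict D) :=
      aemeasurable_of_tendsto_metrizable_ae' (fun n => (ham n).aemeasurable) hae
    obtain ⟨h2, h3⟩ := this (u := h1.mk u) (by
      filter_upwards [hae, h1.ae_eq_mk] with x hx hx'
      rwa [← hx']) h1.measurable_mk
    exact ⟨h2.congr h1.ae_eq_mk.symm, fun i => (h3 i).congr h1.ae_eq_mk.symm (ae_eq_refl _)⟩
  have hball : ∀ c : EuclideanSpace ℝ (Fin d), ∀ r > 0, Metric.ball c (3 * r) ⊆ D →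
      Tendsto (fun n => ∫⁻ x in Metric.ball c r, ‖a n x - u x‖ₑ ^ 2) atTop (𝓝 0) := by
    intro c r hr hsub
    have hBD : Metric.ball c r ⊆ D := (Metric.ball_subset_ball (by linarith)).trans hsub
    set ν := (volume : Measure (EuclideanSpace ℝ (Fin d))).restrict (Metric.ball c r)
    have hfin : IsFiniteMeasure ν := ⟨by simpa [ν] using measure_ball_lt_top⟩
    have haeν : ∀ᵐ x ∂ν, Tendsto (fun n => a n x) atTop (𝓝 (u x)) :=
      ae_mono (Measure.restrict_mono hBD le_rfl) hae
    set A := volume (Metric.ball (0 : EuclideanSpace ℝ (Fin d)) (2 * r))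
    have hA : A ≠ ⊤ := measure_ball_lt_top.ne
    -- Nothing is known yet about the weak derivatives of `u`, so the Poincaré inequality is applied
    -- to `a n - a k` and Fatou's lemma sends `k` to infinity.
    have hbound : ∀ n, ∫⁻ y, ∫⁻ x, ‖(a n x - u x) - (a n y - u y)‖ₑ ^ 2 ∂ν ∂ν ≤
        ENNReal.ofReal (2 * r * ∑ i, ‖G n i - g i‖) ^ 2 * A := by
      intro n
      have hk : ∀ k, ∫⁻ y, ∫⁻ x, ‖(a n x - a k x) - (a n y - a k y)‖ₑ ^ 2 ∂ν ∂ν ≤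
          ENNReal.ofReal (2 * r * ∑ i, ‖G n i - G k i‖) ^ 2 * A := fun k => by
        refine lintegral_lintegral_sub_sq_le (u := fun x => a n x - a k x) hD
          ((ham n).sub (ham k)) ((ha n).sub (ha k)) (by positivity) ?_ hsub
        refine exists_hasWeakDir_of_partial ((ha n).sub (ha k)) fun i => ?_
        have h1 := (hG n i).add (ha n) ((ha k).smul (-1)) (.of_memLp (Lp.memLp _))
          ((LocL2.of_memLp (Lp.memLp _)).smul (-1)) ((hG k i).smul (-1))
        refine h1.congr (.of_forall fun x => ?_) ?_
        · simp [sub_eq_add_neg]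
        · filter_upwards [Lp.coeFn_sub (G n i) (G k i)] with x hx
          rw [hx]
          simp [sub_eq_add_neg]
      have hm1 : ∀ k, Measurable fun z : EuclideanSpace ℝ (Fin d) × EuclideanSpace ℝ (Fin d) =>
          ‖(a n z.2 - a k z.2) - (a n z.1 - a k z.1)‖ₑ ^ 2 := fun k =>
        ((((ham n).comp measurable_snd).sub ((ham k).comp measurable_snd)).sub
          (((ham n).comp measurable_fst).sub ((ham k).comp measurable_fst))).enorm.pow_const 2
      have hm2 : Measurable fun z : EuclideanSpace ℝ (Fin d) × EuclideanSpace ℝ (Fin d) =>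
          ‖(a n z.2 - u z.2) - (a n z.1 - u z.1)‖ₑ ^ 2 :=
        ((((ham n).comp measurable_snd).sub (hum.comp measurable_snd)).sub
          (((ham n).comp measurable_fst).sub (hum.comp measurable_fst))).enorm.pow_const 2
      calc ∫⁻ y, ∫⁻ x, ‖(a n x - u x) - (a n y - u y)‖ₑ ^ 2 ∂ν ∂ν
          = ∫⁻ z, ‖(a n z.2 - u z.2) - (a n z.1 - u z.1)‖ₑ ^ 2 ∂(ν.prod ν) :=
            (lintegral_prod _ hm2.aemeasurable).symm
        _ = ∫⁻ z, liminf (fun k => ‖(a n z.2 - a k z.2) - (a n z.1 - a k z.1)‖ₑ ^ 2) atTop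
              ∂(ν.prod ν) := by
            refine lintegral_congr_ae ?_
            filter_upwards [Measure.quasiMeasurePreserving_fst.ae haeν,
              Measure.quasiMeasurePreserving_snd.ae haeν] with z h1 h2
            refine (Tendsto.liminf_eq ?_).symm
            refine ENNReal.Tendsto.pow (Tendsto.enorm ?_)
            exact (tendsto_const_nhds.sub h2).sub (tendsto_const_nhds.sub h1)
        _ ≤ liminf (fun k => ∫⁻ z, ‖(a n z.2 - a k z.2) - (a n z.1 - a k z.1)‖ₑ ^ 2 ∂(ν.prod ν))
              atTop := lintegral_liminf_le' fun k => (hm1 k).aemeasurable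
        _ ≤ liminf (fun k => ENNReal.ofReal (2 * r * ∑ i, ‖G n i - G k i‖) ^ 2 * A) atTop := by
            refine liminf_le_liminf (.of_forall fun k => ?_)
            rw [lintegral_prod _ (hm1 k).aemeasurable]
            exact hk k
        _ = _ := by
            refine Tendsto.liminf_eq ?_
            refine ENNReal.Tendsto.mul_const (ENNReal.Tendsto.pow (ENNReal.tendsto_ofReal ?_))
              (.inr hA)
            exact (tendsto_finsetSum _ fun i _ => ((hGg i).const_sub _).norm).const_mul _
    refine tendsto_lintegral_sq_of_ae (fun n => (ham n).sub hum) ?_ ?_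
    · filter_upwards [haeν] with x hx
      simpa using hx.sub_const (u x)
    · refine tendsto_of_tendsto_of_tendsto_of_le_of_le tendsto_const_nhds ?_ (fun _ => zero_le)
        hbound
      have h1 : Tendsto (fun n => 2 * r * ∑ i, ‖G n i - g i‖) atTop (𝓝 (2 * r * ∑ _i : Fin d, 0)) :=
        (tendsto_finsetSum _ fun i _ =>
          tendsto_iff_norm_sub_tendsto_zero.1 (hGg i)).const_mul _
      have h2 := ENNReal.Tendsto.mul_const (b := A)
        (ENNReal.Tendsto.pow (n := 2) (ENNReal.tendsto_ofReal h1)) (.inr hA)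
      simpa using h2
  have hloc : ∀ K ⊆ D, IsCompact K →
      Tendsto (fun n => ∫⁻ x in K, ‖a n x - u x‖ₑ ^ 2) atTop (𝓝 0) :=
    fun K hKD hK => lintegral_sq_local_of_ball (a := fun n x => a n x - u x) hD hball hKD hK
  have hu : LocL2 D u := fun K hKD hK => by
    have h1 := tendsto_eLpNorm_two_iff.2 (hloc K hKD hK)
    obtain ⟨n, hn⟩ := (h1.eventually (gt_mem_nhds ENNReal.zero_lt_top)).exists
    have h2 : MemLp (fun x => a n x - u x) 2 (volume.restrict K) :=
      ⟨((ham n).sub hum).aestronglyMeasurable, hn⟩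
    have h3 := (ha n K hKD hK).sub h2
    refine (memLp_congr_ae (.of_forall fun x => ?_)).1 h3
    simp
  exact ⟨hu, fun i => HasWeakDir.of_tendsto ha hu hloc (fun n => hG n i) (hGg i)⟩

end Closability

/-! ### Beppo Levi functions and their gradients -/

section Gradient

variable {d : ℕ} {D : Set (EuclideanSpace ℝ (Fin d))} {u v : EuclideanSpace ℝ (Fin d) → ℝ}

theorem hasWeakPartial_iff {i : Fin d} {g : EuclideanSpace ℝ (Fin d) → ℝ} :
    HasWeakPartial D i u g ↔ HasWeakDir D (EuclideanSpace.single i 1) u g := by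
  constructor
  · intro h φ hφ
    rw [← setIntegral_mul_fderiv hφ, ← setIntegral_mul_test hφ]
    exact h φ hφ.smooth hφ.compact hφ.subset
  · intro h φ h1 h2 h3
    have hφ : IsTest D φ := ⟨h1, h2, h3⟩
    rw [setIntegral_mul_fderiv hφ, setIntegral_mul_test hφ]
    exact h φ hφ

theorem mem_BL_iff : u ∈ BL D ↔ LocL2 D u ∧ ∀ i, ∃ g : Lp ℝ 2 (volume.restrict D),
    HasWeakDir D (EuclideanSpace.single i 1) u g := by
  refine and_congr Iff.rfl (forall_congr' fun i => ⟨?_, ?_⟩)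
  · rintro ⟨g, hg, H⟩
    exact ⟨hg.toLp g, (hasWeakPartial_iff.1 H).congr (ae_eq_refl u) hg.coeFn_toLp.symm⟩
  · rintro ⟨g, H⟩
    exact ⟨g, Lp.memLp g, hasWeakPartial_iff.2 H⟩

theorem memLp_weakPartial (i : Fin d) (u : EuclideanSpace ℝ (Fin d) → ℝ) :
    MemLp (weakPartial D i u) 2 (volume.restrict D) := by
  unfold weakPartial
  split_ifs with h
  · exact h.choose_spec.1
  · exact MemLp.zero

variable (D) in
/-- The weak partial derivative as an element of `L²(D)`. -/
def grad (i : Fin d) (u : EuclideanSpace ℝ (Fin d) → ℝ) : Lp ℝ 2 (volume.restrict D) :=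
  (memLp_weakPartial i u).toLp _

theorem hasWeakDir_grad (hu : u ∈ BL D) (i : Fin d) :
    HasWeakDir D (EuclideanSpace.single i 1) u (grad D i u) := by
  have h := hu.2 i
  have h1 : HasWeakPartial D i u (weakPartial D i u) := by
    rw [weakPartial, dif_pos h]
    exact h.choose_spec.2
  exact (hasWeakPartial_iff.1 h1).congr (ae_eq_refl u)
    (memLp_weakPartial i u).coeFn_toLp.symm

/-- Uniqueness of weak derivatives removes the dependence on the choice made in `weakPartial`;
gradients are computed through this lemma. -/
theorem grad_eq (hD : IsOpen D) {i : Fin d} {g : Lp ℝ 2 (volume.restrict D)} (hu : u ∈ BL D)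
    (H : HasWeakDir D (EuclideanSpace.single i 1) u g) : grad D i u = g :=
  Lp.ext (HasWeakDir.unique hD (.of_memLp (Lp.memLp _)) (.of_memLp (Lp.memLp _))
    (hasWeakDir_grad hu i) H)

theorem dirichlet_eq (u v : EuclideanSpace ℝ (Fin d) → ℝ) :
    dirichlet D u v = ∑ i, inner ℝ (grad D i u) (grad D i v) := by
  refine Finset.sum_congr rfl fun i _ => ?_
  rw [L2.inner_def]
  refine integral_congr_ae ?_
  filter_upwards [(memLp_weakPartial (D := D) i u).coeFn_toLp,
    (memLp_weakPartial (D := D) i v).coeFn_toLp] with x h1 h2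
  simp only [grad, h1, h2]
  simp [mul_comm]

theorem BL_congr (hu : u ∈ BL D) (h : u =ᵐ[volume.restrict D] v) : v ∈ BL D :=
  mem_BL_iff.2 ⟨LocL2.congr hu.1 h, fun i =>
    ⟨grad D i u, (hasWeakDir_grad hu i).congr h (ae_eq_refl _)⟩⟩

theorem grad_congr (hD : IsOpen D) (hu : u ∈ BL D) (h : u =ᵐ[volume.restrict D] v) (i : Fin d) :
    grad D i v = grad D i u :=
  grad_eq hD (BL_congr hu h) ((hasWeakDir_grad hu i).congr h (ae_eq_refl _))

theorem hasWeakDir_grad_add (hu : u ∈ BL D) (hv : v ∈ BL D) (i : Fin d) :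
    HasWeakDir D (EuclideanSpace.single i 1) (u + v)
      (grad D i u + grad D i v : Lp ℝ 2 (volume.restrict D)) :=
  ((hasWeakDir_grad hu i).add hu.1 hv.1 (.of_memLp (Lp.memLp _)) (.of_memLp (Lp.memLp _))
    (hasWeakDir_grad hv i)).congr (ae_eq_refl _) (Lp.coeFn_add _ _).symm

theorem hasWeakDir_grad_smul (c : ℝ) (hu : u ∈ BL D) (i : Fin d) :
    HasWeakDir D (EuclideanSpace.single i 1) (c • u)
      (c • grad D i u : Lp ℝ 2 (volume.restrict D)) :=
  ((hasWeakDir_grad hu i).smul c).congr (ae_eq_refl _) (Lp.coeFn_smul _ _).symm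

theorem BL_add (hu : u ∈ BL D) (hv : v ∈ BL D) : u + v ∈ BL D :=
  mem_BL_iff.2 ⟨LocL2.add hu.1 hv.1, fun i => ⟨_, hasWeakDir_grad_add hu hv i⟩⟩

theorem BL_smul (c : ℝ) (hu : u ∈ BL D) : c • u ∈ BL D :=
  mem_BL_iff.2 ⟨LocL2.smul c hu.1, fun i => ⟨_, hasWeakDir_grad_smul c hu i⟩⟩

theorem grad_add (hD : IsOpen D) (hu : u ∈ BL D) (hv : v ∈ BL D) (i : Fin d) :
    grad D i (u + v) = grad D i u + grad D i v :=
  grad_eq hD (BL_add hu hv) (hasWeakDir_grad_add hu hv i)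

theorem grad_smul (hD : IsOpen D) (c : ℝ) (hu : u ∈ BL D) (i : Fin d) :
    grad D i (c • u) = c • grad D i u :=
  grad_eq hD (BL_smul c hu) (hasWeakDir_grad_smul c hu i)

/-- Normal contractions operate on `BL(D)`. -/
theorem BL_comp (hD : IsOpen D) (hu : u ∈ BL D) {Φ : ℝ → ℝ} (hΦ : LipschitzWith 1 Φ)
    (h0 : Φ 0 = 0) : Φ ∘ u ∈ BL D ∧ ∀ i, ‖grad D i (Φ ∘ u)‖ ≤ ‖grad D i u‖ := by
  choose w hw H using fun i => exists_hasWeakDir_comp hD hu.1 (hasWeakDir_grad hu i) hΦ h0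
  have hm : Φ ∘ u ∈ BL D := mem_BL_iff.2 ⟨LocL2.comp_lipschitz hu.1 hΦ h0, fun i => ⟨w i, H i⟩⟩
  exact ⟨hm, fun i => by rw [grad_eq hD hm (H i)]; exact hw i⟩

theorem IsTest.mem_BL {φ : EuclideanSpace ℝ (Fin d) → ℝ} (hφ : IsTest D φ) : φ ∈ BL D := by
  refine mem_BL_iff.2 ⟨fun K _ _ => hφ.memLp 2 _, fun i => ?_⟩
  set e : EuclideanSpace ℝ (Fin d) := EuclideanSpace.single i 1
  have hm : MemLp (fun x => fderiv ℝ φ x e) 2 (volume.restrict D) :=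
    (hφ.continuous_fderiv e).memLp_of_hasCompactSupport (hφ.compact.fderiv_apply ℝ e)
  refine ⟨hm.toLp _, HasWeakDir.congr (g := fun x => fderiv ℝ φ x e) (fun ψ hψ => ?_)
    (ae_eq_refl φ) hm.coeFn_toLp.symm⟩
  have hl : LocL2 D φ := fun K _ _ => hφ.memLp 2 _
  refine integral_mul_fderiv_eq_neg_fderiv_mul_of_integrable
    ((LocL2.of_memLp hm).integrable_mul_test hψ) (hl.integrable_mul_fderiv hψ e)
    (hl.integrable_mul_test hψ) (fun x _ => hφ.smooth.differentiable (by simp) x)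
    (fun x _ => hψ.smooth.differentiable (by simp) x)

end Gradient

/-- Weak convergence without increase of norm is strong convergence. -/
theorem tendsto_of_tendsto_inner_of_norm_le {H : Type*} [NormedAddCommGroup H]
    [InnerProductSpace ℝ H] {x : ℕ → H} {y : H} (hx : ∀ n, ‖x n‖ ≤ ‖y‖) {ι : Type*} {e : ι → H}
    (he : DenseRange e)
    (hw : ∀ i, Tendsto (fun n => inner ℝ (x n) (e i)) atTop (𝓝 (inner ℝ y (e i)))) :
    Tendsto x atTop (𝓝 y) := by
  have h1 : Tendsto (fun n => inner ℝ (x n) y) atTop (𝓝 (inner ℝ y y)) := by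
    rw [Metric.tendsto_atTop]
    intro ε hε
    -- Since `‖x n - y‖ ≤ 2 ‖y‖`, replacing `y` by `e i` in the second slot costs at most `ε / 2`;
    -- the `+ 1` keeps the denominator positive.
    obtain ⟨i, hi⟩ := he.exists_dist_lt y (ε := ε / (2 * (2 * ‖y‖ + 1))) (by positivity)
    obtain ⟨N, hN⟩ := Metric.tendsto_atTop.1 (hw i) (ε / 2) (by positivity)
    refine ⟨N, fun n hn => ?_⟩
    have h2 := hN n hn
    rw [Real.dist_eq, ← inner_sub_left] at h2 ⊢
    have h3 : |inner ℝ (x n - y) (y - e i)| ≤ 2 * ‖y‖ * ‖y - e i‖ := by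
      refine (abs_real_inner_le_norm _ _).trans ?_
      gcongr
      linarith [norm_sub_le (x n) y, hx n]
    rw [dist_eq_norm, lt_div_iff₀ (by positivity)] at hi
    have h4 : inner ℝ (x n - y) y = inner ℝ (x n - y) (e i) + inner ℝ (x n - y) (y - e i) := by
      rw [← inner_add_right, add_sub_cancel]
    rw [h4]
    refine (abs_add_le _ _).trans_lt ?_
    nlinarith [norm_nonneg (y - e i)]
  rw [tendsto_iff_norm_sub_tendsto_zero]
  have h2 : Tendsto (fun n => 2 * (inner ℝ y y - inner ℝ (x n) y)) atTop (𝓝 0) := by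
    simpa using (h1.const_sub (inner ℝ y y)).const_mul 2
  have h3 : Tendsto (fun n => ‖x n - y‖ ^ 2) atTop (𝓝 0) := by
    refine squeeze_zero (fun _ => sq_nonneg _) (fun n => ?_) h2
    rw [norm_sub_sq_real, real_inner_self_eq_norm_sq]
    have : ‖x n‖ ^ 2 ≤ ‖y‖ ^ 2 := by gcongr; exact hx n
    linarith
  simpa using h3.sqrt

/-! ### Approximation of Beppo Levi functions by truncations. -/

section Truncation

variable {d : ℕ} {D : Set (EuclideanSpace ℝ (Fin d))} {u : EuclideanSpace ℝ (Fin d) → ℝ}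

/-- Truncation at level `n`. -/
def trunc (n : ℕ) (t : ℝ) : ℝ := max (min t n) (-n)

theorem trunc_lipschitz (n : ℕ) : LipschitzWith 1 (trunc n) :=
  (LipschitzWith.id.min_const _).max_const _

theorem trunc_zero (n : ℕ) : trunc n 0 = 0 := by simp [trunc]

theorem abs_trunc_le (n : ℕ) (t : ℝ) : |trunc n t| ≤ n := by
  rw [abs_le]
  exact ⟨le_max_right _ _, max_le (min_le_right _ _) (by linarith [Nat.cast_nonneg (α := ℝ) n])⟩

theorem abs_trunc_le_abs (n : ℕ) (t : ℝ) : |trunc n t| ≤ |t| := by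
  have := (trunc_lipschitz n).dist_le_mul t 0
  simpa [Real.dist_eq, trunc_zero] using this

theorem tendsto_trunc (t : ℝ) : Tendsto (fun n => trunc n t) atTop (𝓝 t) := by
  refine tendsto_const_nhds.congr' ?_
  filter_upwards [eventually_ge_atTop ⌈|t|⌉₊] with n hn
  have h : |t| ≤ n := (Nat.le_ceil _).trans (Nat.cast_le.2 hn)
  rw [abs_le] at h
  rw [trunc, min_eq_left h.2, max_eq_left h.1]

/-- Truncation is a normal contraction, so the gradient norms do not exceed that of `u`. Against a
test function the derivative moves onto it and dominated convergence applies; weak convergence with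
this norm bound is strong. -/
theorem tendsto_grad_trunc (hD : IsOpen D) (hu : u ∈ BL D) (i : Fin d) :
    Tendsto (fun n => grad D i (trunc n ∘ u)) atTop (𝓝 (grad D i u)) := by
  have hb := fun n => BL_comp hD hu (trunc_lipschitz n) (trunc_zero n)
  refine tendsto_of_tendsto_inner_of_norm_le (fun n => (hb n).2 i) (denseRange_testToLp hD)
    fun φ => ?_
  have hφ : IsTest D φ := φ.2
  simp only [inner_testToLp, setIntegral_mul_test hφ]
  have h1 : ∀ v ∈ BL D, ∫ x, grad D i v x * (φ : EuclideanSpace ℝ (Fin d) → ℝ) x =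
      -∫ x, v x * fderiv ℝ φ x (EuclideanSpace.single i 1) := fun v hv => by
    rw [hasWeakDir_grad hv i φ hφ, neg_neg]
  rw [h1 u hu]
  refine Tendsto.congr (fun n => (h1 _ (hb n).1).symm) (Tendsto.neg ?_)
  have hui := LocL2.integrable_mul_fderiv hu.1 hφ (EuclideanSpace.single i 1)
  refine tendsto_integral_of_dominated_convergence
    (fun x => ‖u x * fderiv ℝ φ x (EuclideanSpace.single i 1)‖) (fun n => ?_) hui.norm
    (fun n => .of_forall fun x => ?_) (.of_forall fun x => ?_)
  · exact (LocL2.integrable_mul_fderiv (hb n).1.1 hφ _).aestronglyMeasurable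
  · rw [norm_mul, norm_mul]
    gcongr
    exact abs_trunc_le_abs n (u x)
  · exact (tendsto_trunc (u x)).mul_const _

end Truncation

/-! ### The form `½ 𝐃` on `L²(D; m)` -/

/-- A positive bounded continuous density on the closure of the open set `D`, with finite mass. -/
structure IsDensity {d : ℕ} (D : Set (EuclideanSpace ℝ (Fin d)))
    (m : EuclideanSpace ℝ (Fin d) → ℝ) : Prop where
  isOpen : IsOpen D
  pos : ∀ x ∈ closure D, 0 < m x
  continuousOn : ContinuousOn m (closure D)
  bdd : ∃ C : ℝ, ∀ x ∈ closure D, m x ≤ C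
  integrableOn : IntegrableOn m D volume

namespace IsDensity

variable {d : ℕ} {D : Set (EuclideanSpace ℝ (Fin d))} {m : EuclideanSpace ℝ (Fin d) → ℝ}
  (h : IsDensity D m)
include h

theorem isFiniteMeasure : IsFiniteMeasure (densityMeasure D m) :=
  isFiniteMeasure_withDensity_ofReal h.integrableOn.2

theorem aemeasurable : AEMeasurable (fun x => ENNReal.ofReal (m x)) (volume.restrict D) :=
  h.integrableOn.1.aemeasurable.ennreal_ofReal

theorem volume_absolutelyContinuous : volume.restrict D ≪ densityMeasure D m := by
  refine withDensity_absolutelyContinuous' h.aemeasurable ?_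
  filter_upwards [ae_restrict_mem h.isOpen.measurableSet] with x hx
  simpa using h.pos x (subset_closure hx)

theorem ae_volume {p : EuclideanSpace ℝ (Fin d) → Prop} (hp : ∀ᵐ x ∂densityMeasure D m, p x) :
    ∀ᵐ x ∂volume.restrict D, p x :=
  h.volume_absolutelyContinuous.ae_le hp

theorem ae_density {p : EuclideanSpace ℝ (Fin d) → Prop} (hp : ∀ᵐ x ∂volume.restrict D, p x) :
    ∀ᵐ x ∂densityMeasure D m, p x :=
  (withDensity_absolutelyContinuous _ _).ae_le hp

/-- The continuous function `m` attains a positive minimum on a nonempty compact `K`, and its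
inverse serves as `C`. This makes `L²(D; m)` convergence imply local `L²` convergence. -/
theorem exists_restrict_le {K : Set (EuclideanSpace ℝ (Fin d))} (hKD : K ⊆ D)
    (hK : IsCompact K) : ∃ C : ℝ≥0∞, C ≠ ⊤ ∧ volume.restrict K ≤ C • densityMeasure D m := by
  rcases K.eq_empty_or_nonempty with rfl | hne
  · exact ⟨0, by simp⟩
  obtain ⟨z, hz, hmin⟩ := hK.exists_isMinOn hne
    (h.continuousOn.mono (hKD.trans subset_closure))
  have hz0 : 0 < m z := h.pos z (subset_closure (hKD hz))
  refine ⟨(ENNReal.ofReal (m z))⁻¹, by simpa using hz0, Measure.le_iff.2 fun s hs => ?_⟩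
  rw [Measure.smul_apply, smul_eq_mul, Measure.restrict_apply hs, mul_comm,
    ← div_eq_mul_inv, ENNReal.le_div_iff_mul_le (by simp [hz0]) (by simp)]
  have hsK : MeasurableSet (s ∩ K) := hs.inter hK.measurableSet
  calc volume (s ∩ K) * ENNReal.ofReal (m z)
      = ∫⁻ _ in s ∩ K, ENNReal.ofReal (m z) := by rw [setLIntegral_const, mul_comm]
    _ ≤ ∫⁻ x in s ∩ K, ENNReal.ofReal (m x) :=
        setLIntegral_mono' hsK fun x hx => ENNReal.ofReal_le_ofReal (hmin hx.2)
    _ = ∫⁻ x in s ∩ K, ENNReal.ofReal (m x) ∂(volume.restrict D) := by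
        rw [Measure.restrict_restrict hsK, Set.inter_eq_left.2 (Set.inter_subset_right.trans hKD)]
    _ = densityMeasure D m (s ∩ K) := (withDensity_apply _ hsK).symm
    _ ≤ densityMeasure D m s := measure_mono Set.inter_subset_left

theorem locL2 {u : EuclideanSpace ℝ (Fin d) → ℝ} (hu : MemLp u 2 (densityMeasure D m)) :
    LocL2 D u := fun K hKD hK => by
  obtain ⟨C, hC, hle⟩ := h.exists_restrict_le hKD hK
  exact hu.of_measure_le_smul hC hle

theorem tendsto_local {u : ℕ → Lp ℝ 2 (densityMeasure D m)} {v : Lp ℝ 2 (densityMeasure D m)}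
    (huv : Tendsto u atTop (𝓝 v)) {K : Set (EuclideanSpace ℝ (Fin d))} (hKD : K ⊆ D)
    (hK : IsCompact K) : Tendsto (fun n => ∫⁻ x in K, ‖u n x - v x‖ₑ ^ 2) atTop (𝓝 0) := by
  obtain ⟨C, hC, hle⟩ := h.exists_restrict_le hKD hK
  have h1 := tendsto_eLpNorm_two_iff.1 ((Lp.tendsto_Lp_iff_tendsto_eLpNorm' u v).1 huv)
  have h2 := ENNReal.Tendsto.const_mul h1 (.inr hC)
  rw [mul_zero] at h2
  refine tendsto_of_tendsto_of_tendsto_of_le_of_le tendsto_const_nhds h2 (fun _ => zero_le)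
    fun n => ?_
  refine (lintegral_mono' hle le_rfl).trans_eq ?_
  rw [lintegral_smul_measure]
  rfl

/-- Operations on classes agree with pointwise operations only `m`-almost everywhere, which by
positivity of `m` means almost everywhere on `D`. Membership and gradients are carried across here.
-/
theorem mem_of_ae {u : Lp ℝ 2 (densityMeasure D m)} {v : EuclideanSpace ℝ (Fin d) → ℝ}
    (hv : v ∈ BL D) (huv : u =ᵐ[densityMeasure D m] v) :
    u ∈ domainStar D m ∧ ∀ i, grad D i u = grad D i v := by
  have h1 : v =ᵐ[volume.restrict D] u := h.ae_volume huv.symm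
  exact ⟨BL_congr hv h1, grad_congr h.isOpen hv h1⟩

theorem formStar_eq (u v : Lp ℝ 2 (densityMeasure D m)) :
    formStar D m u v = 1 / 2 * ∑ i, inner ℝ (grad D i u) (grad D i v) := by
  rw [formStar, dirichlet_eq]

theorem formStar_self (u : Lp ℝ 2 (densityMeasure D m)) :
    formStar D m u u = 1 / 2 * ∑ i, ‖grad D i u‖ ^ 2 := by
  simp_rw [h.formStar_eq, real_inner_self_eq_norm_sq]

theorem norm_grad_sq_le (u : Lp ℝ 2 (densityMeasure D m)) (i : Fin d) :
    ‖grad D i u‖ ^ 2 ≤ 2 * formStar D m u u := by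
  rw [h.formStar_self]
  have := Finset.single_le_sum (f := fun i => ‖grad D i u‖ ^ 2) (fun i _ => sq_nonneg _)
    (Finset.mem_univ i)
  linarith

theorem mem_add {u v : Lp ℝ 2 (densityMeasure D m)} (hu : u ∈ domainStar D m)
    (hv : v ∈ domainStar D m) :
    u + v ∈ domainStar D m ∧ ∀ i, grad D i (u + v : Lp ℝ 2 (densityMeasure D m)) =
      grad D i u + grad D i v := by
  obtain ⟨h1, h2⟩ := h.mem_of_ae (BL_add hu hv) (Lp.coeFn_add u v)
  exact ⟨h1, fun i => by rw [h2, grad_add h.isOpen hu hv]⟩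

theorem mem_smul (c : ℝ) {u : Lp ℝ 2 (densityMeasure D m)} (hu : u ∈ domainStar D m) :
    c • u ∈ domainStar D m ∧ ∀ i, grad D i (c • u : Lp ℝ 2 (densityMeasure D m)) =
      c • grad D i u := by
  obtain ⟨h1, h2⟩ := h.mem_of_ae (BL_smul c hu) (Lp.coeFn_smul c u)
  exact ⟨h1, fun i => by rw [h2, grad_smul h.isOpen c hu]⟩

theorem mem_sub {u v : Lp ℝ 2 (densityMeasure D m)} (hu : u ∈ domainStar D m)
    (hv : v ∈ domainStar D m) :
    u - v ∈ domainStar D m ∧ ∀ i, grad D i (u - v : Lp ℝ 2 (densityMeasure D m)) =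
      grad D i u - grad D i v := by
  obtain ⟨h1, h2⟩ := h.mem_smul (-1) hv
  obtain ⟨h3, h4⟩ := h.mem_add hu h1
  rw [show u - v = u + (-1 : ℝ) • v by module]
  exact ⟨h3, fun i => by rw [h4, h2]; module⟩

theorem mem_comp {u v : Lp ℝ 2 (densityMeasure D m)} (hu : u ∈ domainStar D m) {Φ : ℝ → ℝ}
    (hΦ : LipschitzWith 1 Φ) (h0 : Φ 0 = 0) (huv : v =ᵐ[densityMeasure D m] fun x => Φ (u x)) :
    v ∈ domainStar D m ∧ formStar D m v v ≤ formStar D m u u := by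
  obtain ⟨h1, h2⟩ := BL_comp h.isOpen hu hΦ h0
  obtain ⟨h3, h4⟩ := h.mem_of_ae h1 huv
  refine ⟨h3, ?_⟩
  rw [h.formStar_self, h.formStar_self]
  gcongr with i
  rw [h4]
  exact h2 i

theorem cauchySeq_grad {u : ℕ → Lp ℝ 2 (densityMeasure D m)} (hu : ∀ n, u n ∈ domainStar D m)
    (hc : Tendsto (fun p : ℕ × ℕ => formStar D m (u p.1 - u p.2) (u p.1 - u p.2)) atTop (𝓝 0))
    (i : Fin d) : CauchySeq fun n => grad D i (u n) := by
  rw [cauchySeq_iff_tendsto_dist_atTop_0]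
  have h1 : Tendsto (fun p : ℕ × ℕ => dist (grad D i (u p.1)) (grad D i (u p.2)) ^ 2) atTop
      (𝓝 0) := by
    refine squeeze_zero (fun _ => sq_nonneg _) (fun p => ?_) (by simpa using hc.const_mul 2)
    rw [dist_eq_norm, ← (h.mem_sub (hu p.1) (hu p.2)).2 i]
    exact h.norm_grad_sq_le _ i
  simpa using h1.sqrt

theorem formStar_nonneg (u : Lp ℝ 2 (densityMeasure D m)) : 0 ≤ formStar D m u u := by
  rw [h.formStar_self]
  positivity

/-- Test functions already suffice: if `w` is orthogonal to all of them, then `m w`, locally square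
integrable because `m` is bounded, is orthogonal to them for Lebesgue measure and vanishes, and `m >
0`. -/
theorem dense_domainStar : Dense (domainStar D m) := by
  have hfin := h.isFiniteMeasure
  have hsub : Set.range (testToLp D (densityMeasure D m)) ⊆ domainStar D m := by
    rintro _ ⟨φ, rfl⟩
    exact (h.mem_of_ae (IsTest.mem_BL φ.2)
      (IsTest.memLp φ.2 2 (densityMeasure D m)).coeFn_toLp).1
  refine Dense.mono hsub ?_
  have : (LinearMap.range (testToLp D (densityMeasure D m))).topologicalClosure = ⊤ := by
    rw [Submodule.topologicalClosure_eq_top_iff, Submodule.eq_bot_iff]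
    intro w hw
    obtain ⟨C, hC⟩ := h.bdd
    have hloc : LocL2 D (fun x => m x * w x) := fun K hKD hK => by
      refine (h.locL2 (Lp.memLp w) K hKD hK).of_le_mul (c := C) ?_ ?_
      · exact (h.integrableOn.1.mono_measure (Measure.restrict_mono hKD le_rfl)).mul
          (h.locL2 (Lp.memLp w) K hKD hK).1
      · filter_upwards [ae_restrict_mem hK.measurableSet] with x hx
        have hx' := subset_closure (hKD hx)
        rw [norm_mul, Real.norm_of_nonneg (h.pos x hx').le]
        gcongr
        exact hC x hx'
    have h1 : (fun x => m x * w x) =ᵐ[volume.restrict D] (0 : EuclideanSpace ℝ (Fin d) → ℝ) := by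
      refine eq_of_integral_test_eq h.isOpen hloc (LocL2.of_memLp MemLp.zero) fun φ hφ => ?_
      have h2 := (Submodule.mem_orthogonal' _ _).1 hw _ ⟨⟨φ, hφ⟩, rfl⟩
      rw [inner_testToLp] at h2
      replace h2 := (integral_withDensity_eq_integral_toReal_smul₀ h.aemeasurable (by simp)
        (fun x => w x * φ x)).symm.trans h2
      simp only [Pi.zero_apply, zero_mul, integral_zero]
      rw [← setIntegral_mul_test hφ (fun x => m x * w x), ← h2]
      refine integral_congr_ae ?_
      filter_upwards [ae_restrict_mem h.isOpen.measurableSet] with x hx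
      rw [ENNReal.toReal_ofReal (h.pos x (subset_closure hx)).le, smul_eq_mul, mul_assoc]
    rw [Lp.eq_zero_iff_ae_eq_zero]
    refine h.ae_density ?_
    filter_upwards [h1, ae_restrict_mem h.isOpen.measurableSet] with x hx hxD
    exact (mul_eq_zero.1 hx).resolve_left (h.pos x (subset_closure hxD)).ne'
  rw [dense_iff_closure_eq]
  exact congrArg
    (fun S : Submodule ℝ (Lp ℝ 2 (densityMeasure D m)) => (S : Set (Lp ℝ 2 (densityMeasure D m))))
    this

theorem isDirichletForm :
    IsDirichletForm (densityMeasure D m) (domainStar D m) (formStar D m) where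
  zero_mem := by
    have h0 : IsTest D (0 : EuclideanSpace ℝ (Fin d) → ℝ) := IsTest.zero
    exact (h.mem_of_ae h0.mem_BL (Lp.coeFn_zero ℝ 2 _)).1
  add_mem u hu v hv := (h.mem_add hu hv).1
  smul_mem c u hu := (h.mem_smul c hu).1
  dense := h.dense_domainStar
  symm u _ v _ := by
    simp_rw [h.formStar_eq, real_inner_comm]
  add_left u hu v hv w _ := by
    simp_rw [h.formStar_eq, (h.mem_add hu hv).2, inner_add_left, Finset.sum_add_distrib]
    ring
  smul_left c u hu v _ := by
    simp_rw [h.formStar_eq, (h.mem_smul c hu).2, real_inner_smul_left, ← Finset.mul_sum]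
    ring
  nonneg u _ := h.formStar_nonneg u
  closed u hu hc := by
    have hE : Tendsto (fun p : ℕ × ℕ => formStar D m (u p.1 - u p.2) (u p.1 - u p.2)) atTop
        (𝓝 0) := by
      refine squeeze_zero (fun p => h.formStar_nonneg _) (fun p => ?_) hc
      exact le_add_of_nonneg_right (sq_nonneg _)
    have hN : Tendsto (fun p : ℕ × ℕ => ‖u p.1 - u p.2‖ ^ 2) atTop (𝓝 0) := by
      refine squeeze_zero (fun p => sq_nonneg _) (fun p => ?_) hc
      exact le_add_of_nonneg_left (h.formStar_nonneg _)
    have hcauchy : CauchySeq u := by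
      rw [cauchySeq_iff_tendsto_dist_atTop_0]
      simp_rw [dist_eq_norm]
      simpa using hN.sqrt
    obtain ⟨v, hv⟩ := cauchySeq_tendsto_of_complete hcauchy
    choose g hg using fun i => cauchySeq_tendsto_of_complete (h.cauchySeq_grad hu hE i)
    have hW : ∀ i, HasWeakDir D (EuclideanSpace.single i 1) v (g i) := fun i =>
      HasWeakDir.of_tendsto (fun n => (hu n).1) (h.locL2 (Lp.memLp v))
        (fun K hKD hK => h.tendsto_local hv hKD hK) (fun n => hasWeakDir_grad (hu n) i) (hg i)
    have hvm : v ∈ domainStar D m := mem_BL_iff.2 ⟨h.locL2 (Lp.memLp v), fun i => ⟨g i, hW i⟩⟩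
    refine ⟨v, hvm, ?_⟩
    have h1 : ∀ i, Tendsto (fun n => ‖grad D i (u n) - grad D i v‖ ^ 2) atTop (𝓝 0) := fun i => by
      rw [grad_eq h.isOpen hvm (hW i)]
      simpa using (tendsto_iff_norm_sub_tendsto_zero.1 (hg i)).pow 2
    have h2 : Tendsto (fun n => ‖u n - v‖ ^ 2) atTop (𝓝 0) := by
      simpa using (tendsto_iff_norm_sub_tendsto_zero.1 hv).pow 2
    have h3 := ((tendsto_finsetSum Finset.univ fun i _ => h1 i).const_mul (1 / 2 : ℝ)).add h2
    simp only [Finset.sum_const_zero, mul_zero, add_zero] at h3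
    refine h3.congr fun n => ?_
    simp_rw [h.formStar_self, (h.mem_sub (hu n) hvm).2]
  markov u hu v huv := by
    refine h.mem_comp hu (Φ := fun t => min (max t 0) 1) ?_ (by simp) huv
    exact (LipschitzWith.id.max_const 0).min_const 1

theorem isRecurrent : IsRecurrent (densityMeasure D m) (domainStar D m) (formStar D m) := by
  have hfin := h.isFiniteMeasure
  have hone : ∀ i, HasWeakDir D (EuclideanSpace.single i 1) (fun _ => (1 : ℝ))
      (0 : Lp ℝ 2 (volume.restrict D)) := fun i => by
    refine HasWeakDir.congr (g := fun _ => (0 : ℝ)) (fun φ hφ => ?_) (ae_eq_refl _)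
      (Lp.coeFn_zero ℝ 2 (volume.restrict D)).symm
    have hl : LocL2 D fun _ : EuclideanSpace ℝ (Fin d) => (1 : ℝ) := fun K _ hK => by
      have : IsFiniteMeasure (volume.restrict K) := ⟨by simpa using hK.measure_lt_top⟩
      exact memLp_const 1
    -- All translates of `φ` have the same integral, so the derivative in the translation parameter
    -- is zero, that is `∫ ∂ᵢφ = 0`.
    have h1 := hasDerivAt_integral_translate h.isOpen hl hφ (EuclideanSpace.single i 1)
    have h2 : (fun s : ℝ => ∫ x, (1 : ℝ) * φ (x - s • EuclideanSpace.single i (1 : ℝ))) =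
        fun _ => ∫ x, φ x := by
      funext s
      simp_rw [one_mul]
      exact integral_sub_right_eq_self φ _
    rw [h2] at h1
    have h3 := h1.unique (hasDerivAt_const (0 : ℝ) _)
    simpa using h3
  have hmem : (fun _ => (1 : ℝ)) ∈ BL D := mem_BL_iff.2 ⟨fun K _ hK => by
    have : IsFiniteMeasure (volume.restrict K) := ⟨by simpa using hK.measure_lt_top⟩
    exact memLp_const 1, fun i => ⟨0, hone i⟩⟩
  obtain ⟨h1, h2⟩ := h.mem_of_ae hmem (coeFn_oneL2 (μ := densityMeasure D m))
  refine h.isDirichletForm.isRecurrent (fun u hu => ?_) h1 fun v _ => ?_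
  -- Positivity of the semigroup uses the positive part, another normal contraction.
  · refine h.mem_comp hu (Φ := fun t => max t 0) (LipschitzWith.id.max_const 0) (by simp) ?_
    filter_upwards [Lp.coeFn_sup u 0, Lp.coeFn_zero ℝ 2 (densityMeasure D m)] with x h3 h4
    rw [h3, Pi.sup_apply, h4]
    rfl
  · rw [h.formStar_eq]
    refine mul_eq_zero_of_right _ (Finset.sum_eq_zero fun i _ => ?_)
    rw [h2, grad_eq h.isOpen hmem (hone i), inner_zero_left]

theorem approxSeq_mem {u : EuclideanSpace ℝ (Fin d) → ℝ} {a : ℕ → Lp ℝ 2 (densityMeasure D m)}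
    (ha : IsApproxSeq (densityMeasure D m) (domainStar D m) (formStar D m) u a) :
    u ∈ BL D ∧ ∀ i, Tendsto (fun n => grad D i (a n)) atTop (𝓝 (grad D i u)) := by
  choose g hg using fun i => cauchySeq_tendsto_of_complete (h.cauchySeq_grad ha.mem ha.cauchy i)
  obtain ⟨h1, h2⟩ := hasWeakDir_of_ae_tendsto h.isOpen
    (fun n => (Lp.stronglyMeasurable (a n)).measurable) (fun n => (ha.mem n).1)
    (fun n i => hasWeakDir_grad (ha.mem n) i) hg (h.ae_volume ha.ae_tendsto)
  have hu : u ∈ BL D := mem_BL_iff.2 ⟨h1, fun i => ⟨g i, h2 i⟩⟩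
  exact ⟨hu, fun i => by rw [grad_eq h.isOpen hu (h2 i)]; exact hg i⟩

theorem exists_approxSeq {u : EuclideanSpace ℝ (Fin d) → ℝ} (hu : u ∈ BL D) :
    ∃ a, IsApproxSeq (densityMeasure D m) (domainStar D m) (formStar D m) u a := by
  have hfin := h.isFiniteMeasure
  have hum : AEStronglyMeasurable u (densityMeasure D m) :=
    (LocL2.locallyIntegrableOn h.isOpen hu.1).aestronglyMeasurable.mono_ac
      (withDensity_absolutelyContinuous _ _)
  -- Bounded functions are square integrable for the finite measure `m dx`, whereas `u` itself need
  -- not be.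
  have hm : ∀ n, MemLp (trunc n ∘ u) 2 (densityMeasure D m) := fun n =>
    MemLp.of_bound ((trunc_lipschitz n).continuous.comp_aestronglyMeasurable hum) n
      (.of_forall fun x => abs_trunc_le n (u x))
  have hmem := fun n => h.mem_of_ae (BL_comp h.isOpen hu (trunc_lipschitz n) (trunc_zero n)).1
    (hm n).coeFn_toLp
  refine ⟨fun n => (hm n).toLp _, fun n => (hmem n).1, ?_, ?_⟩
  · have h1 : ∀ i, Tendsto (fun p : ℕ × ℕ =>
        ‖grad D i (trunc p.1 ∘ u) - grad D i (trunc p.2 ∘ u)‖ ^ 2) atTop (𝓝 0) := fun i => by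
      have h2 := cauchySeq_iff_tendsto_dist_atTop_0.1 (tendsto_grad_trunc h.isOpen hu i).cauchySeq
      simp_rw [dist_eq_norm] at h2
      simpa using h2.pow 2
    have h3 := (tendsto_finsetSum Finset.univ fun i _ => h1 i).const_mul (1 / 2 : ℝ)
    simp only [Finset.sum_const_zero, mul_zero] at h3
    refine h3.congr fun p => ?_
    simp_rw [h.formStar_self, (h.mem_sub (hmem p.1).1 (hmem p.2).1).2, (hmem _).2]
  · have h1 : ∀ᵐ x ∂densityMeasure D m, ∀ n, ((hm n).toLp _ : Lp ℝ 2 (densityMeasure D m)) x =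
        trunc n (u x) := ae_all_iff.2 fun n => (hm n).coeFn_toLp
    filter_upwards [h1] with x hx
    simp_rw [hx]
    exact tendsto_trunc (u x)

theorem isExtendedDirichletSpace :
    IsExtendedDirichletSpace (densityMeasure D m) (domainStar D m) (formStar D m) (BL D)
      (fun u v => 1 / 2 * dirichlet D u v) := by
  refine ⟨Set.Subset.antisymm ?_ fun u hu => h.exists_approxSeq hu, ?_⟩
  · rintro u ⟨a, ha⟩
    exact (h.approxSeq_mem ha).1
  · intro u _ v _ a b ha hb
    simp only [dirichlet_eq, h.formStar_eq]
    exact (tendsto_finsetSum _ fun i _ =>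
      ((h.approxSeq_mem ha).2 i).inner ((h.approxSeq_mem hb).2 i)).const_mul _

end IsDensity

end BeppoLevi

end

theorem mainTheorem8 {d : ℕ} (D : Set (EuclideanSpace ℝ (Fin d)))
    (hD_open : IsOpen D) (hD_conn : IsConnected D)
    (m : EuclideanSpace ℝ (Fin d) → ℝ)
    (hm_pos : ∀ x ∈ closure D, 0 < m x)
    (hm_cont : ContinuousOn m (closure D))
    (hm_bdd : ∃ C : ℝ, ∀ x ∈ closure D, m x ≤ C)
    (hm_int : MeasureTheory.IntegrableOn m D MeasureTheory.volume) :
    BeppoLevi.IsDirichletForm (BeppoLevi.densityMeasure D m)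
        (BeppoLevi.domainStar D m) (BeppoLevi.formStar D m) ∧
      BeppoLevi.IsRecurrent (BeppoLevi.densityMeasure D m)
        (BeppoLevi.domainStar D m) (BeppoLevi.formStar D m) ∧
      BeppoLevi.IsExtendedDirichletSpace (BeppoLevi.densityMeasure D m)
        (BeppoLevi.domainStar D m) (BeppoLevi.formStar D m)
        (BeppoLevi.BL D) (fun u v => 1 / 2 * BeppoLevi.dirichlet D u v) := by
  have h : BeppoLevi.IsDensity D m := ⟨hD_open, hm_pos, hm_cont, hm_bdd, hm_int⟩
  exact ⟨h.isDirichletForm, h.isRecurrent, h.isExtendedDirichletSpace⟩
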